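/- Let $d\ge 3$ be an integer, let $\frac{d+2}{d-2}<p<p_{\rm JL}$, where $p_{\rm JL}=+\infty$ if $d\le 10$ and $p_{\rm JL}=1+\frac{4}{d-4-2\sqrt{d-1}}$ if $d\ge 11$, and let $1<q<p$. Put $\sigma=\frac d2-\frac{2}{p-1}$. For $\lambda\in\mathbb R$ consider $$u''+\frac{d-1}{r}u'-(r^2-\lambda)u+|u|^{q-1}u+|u|^{p-1}u=0,\qquad u>0,\qquad \lim_{r\to\infty}u(r)=0. \tag{1}$$ Let $\lambda_*\in(0,d)$ and let $\Phi$ be a singular solution of (1) with $\lambda=\lambda_*$, that is, a $C^2$ solution on $(0,\infty)$ with $\Phi(r)\to\infty$ as $r\to0^+$. For $0<r_*<1$ and $w:[r_*,\infty)\to\mathbb R$ put $$\|w\|_{X_{r_*}}=\sup_{r_*\le r\le1}r^{\frac{d-2}{2}}|w(r)|+\sup_{r\ge1}e^{\frac{r^2}{2}}r^{2-\frac{\lambda_*-d}{2}}|w(r)|\in[0,\infty].$$ Then there is $K>0$ with $\Phi(r)=Ke^{-r^2/2}r^{\frac{\lambda_*-d}{2}}(1+O(r^{-2}))$ as $r\to\infty$,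 and there are constants $r_0\in(0,1)$, $\delta>0$, $C>0$, depending only on $d,p,q,\lambda_*,\Phi$, and functions $\psi=\psi_\varepsilon\in C^2((0,\infty))$, $|\varepsilon|<\delta$, independent of $r_*$, such that the following holds. Each $\psi_\varepsilon$ is a decaying solution on $(0,\infty)$ of $$-\psi''-\frac{d+\varepsilon-1}{r}\psi'+(r^2-\lambda_*-\varepsilon)\psi-p\Phi^{p-1}\psi-q\Phi^{q-1}\psi=\frac{p-1}{2}\log(r)\,\Phi^p+\frac{q-1}{2}\log(r)\,\Phi^q+\Big(\frac\varepsilon4+\frac d2-1\Big)\frac{\Phi}{r^2}+\Big(\frac{\Phi'}{r}+\Phi\Big)$$ with $\psi_\varepsilon(r)=Ke^{-r^2/2}r^{\frac{\lambda_*-d}{2}}(1+O(r^{-2}))$ as $r\to\infty$. For every $r_*\in(0,r_0)$ there is a family of functions $w=w_\varepsilon$ on $[r_*,\infty)$ such that: (i) for every $\varepsilon$ with $0<|\varepsilon|<\delta r_*^{\sigma-1}$, $w_\varepsilon$ is $C^2$ on $[r_*,\infty)$, the function $$u=r^{\frac\varepsilon2}\big(\Phi+\varepsilon(\psi_\varepsilon+w_\varepsilon)\big)$$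 is a (positive, $C^2$) solution of (1) on $[r_*,\infty)$ with $\lambda=\lambda_*+\varepsilon$, and $$\|w_\varepsilon\|_{X_{r_*}}+\Big\|\frac{\min\{1,r\}}{1+r}\,w_\varepsilon'\Big\|_{X_{r_*}}\le C|\varepsilon|\,r_*^{1-\sigma};$$ (ii) $w_0=0$, the map $\varepsilon\mapsto w_\varepsilon$ is differentiable at $\varepsilon=0$ with respect to $\|\cdot\|_{X_{r_*}}$, and its derivative satisfies $$\big\|\partial_\varepsilon w_\varepsilon|_{\varepsilon=0}\big\|_{X_{r_*}}\le C\,r_*^{1-\sigma}.$$ -/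

import Mathlib

open Filter Topology Set

noncomputable section

namespace HarmonicField

/-- The (critical Sobolev) exponent `σ = d/2 - 2/(p-1)`. -/
def sigma (d : ℕ) (p : ℝ) : ℝ := (d : ℝ) / 2 - 2 / (p - 1)

/-- `p < p_JL`, the Joseph-Lundgren exponent being `+∞` for `d ≤ 10` and
`1 + 4 / (d - 4 - 2 √(d-1))` for `d ≥ 11`. -/
def BelowJosephLundgren (d : ℕ) (p : ℝ) : Prop :=
  11 ≤ d → p < 1 + 4 / ((d : ℝ) - 4 - 2 * Real.sqrt ((d : ℝ) - 1))

/-- `u` is a positive `C²` solution on the set `S` (an interval unbounded to the right) of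
`u'' + (d-1)/r u' - (r² - lam) u + |u|^(q-1) u + |u|^(p-1) u = 0`, with `u(r) → 0` as `r → ∞`.
Derivatives are taken relative to `S`, hence one-sided at a left end point that belongs to `S`. -/
structure IsPositiveSolutionOn (d : ℕ) (p q lam : ℝ) (S : Set ℝ) (u : ℝ → ℝ) : Prop where
  contDiffOn : ContDiffOn ℝ 2 u S
  pos : ∀ r ∈ S, 0 < u r
  equation : ∀ r ∈ S,
    derivWithin (derivWithin u S) S r + ((d : ℝ) - 1) / r * derivWithin u S r
      - (r ^ 2 - lam) * u r + |u r| ^ (q - 1) * u r + |u r| ^ (p - 1) * u r = 0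
  tendsto_zero : Tendsto u atTop (𝓝 0)

/-- `Φ` is a singular solution: a positive solution on `(0, ∞)` that vanishes at infinity and
blows up at the origin. -/
structure IsSingularSolution (d : ℕ) (p q lam : ℝ) (Φ : ℝ → ℝ) : Prop where
  solution : IsPositiveSolutionOn d p q lam (Ioi 0) Φ
  singular : Tendsto Φ (𝓝[>] 0) atTop

/-- `f(r) = K e^{-r²/2} r^{(lam - d)/2} (1 + O(1/r²))` as `r → ∞`. -/
def HasGaussianTail (d : ℕ) (lam K : ℝ) (f : ℝ → ℝ) : Prop :=
  (fun r : ℝ => f r / (K * (Real.exp (-(r ^ 2) / 2) * r ^ ((lam - (d : ℝ)) / 2))) - 1)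
    =O[atTop] fun r : ℝ => (r ^ 2)⁻¹

/-- The operator
`- ∂_rr - (d + ε - 1)/r ∂_r + (r² - (lam + ε)) - p Φ^(p-1) - q Φ^(q-1)` on `(0, ∞)`. -/
def linOp (d : ℕ) (p q lam : ℝ) (Φ : ℝ → ℝ) (ε : ℝ) (f : ℝ → ℝ) (r : ℝ) : ℝ :=
  -deriv (deriv f) r - ((d : ℝ) + ε - 1) / r * deriv f r + (r ^ 2 - (lam + ε)) * f r
    - p * Φ r ^ (p - 1) * f r - q * Φ r ^ (q - 1) * f r

/-- `ψ` is the first order corrector at the parameter `ε`: the decaying solution on `(0, ∞)`,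
with leading coefficient `K` at infinity, of the inhomogeneous linear equation that makes
`r^(ε/2) (Φ + ε ψ)` solve the nonlinear equation with parameter `lam + ε` up to second order
in `ε`. -/
structure IsCorrector (d : ℕ) (p q lam : ℝ) (Φ : ℝ → ℝ) (K ε : ℝ) (ψ : ℝ → ℝ) : Prop where
  contDiffOn : ContDiffOn ℝ 2 ψ (Ioi 0)
  equation : ∀ r : ℝ, 0 < r →
    linOp d p q lam Φ ε ψ r =
      (p - 1) / 2 * Real.log r * Φ r ^ p + (q - 1) / 2 * Real.log r * Φ r ^ q
        + (ε / 4 + (d : ℝ) / 2 - 1) * (Φ r / r ^ 2) + (deriv Φ r / r + Φ r)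
  tail : HasGaussianTail d lam K ψ

/-- The weighted norm, with values in `[0, ∞]`,
`sup_{rs ≤ r ≤ 1} r^((d-2)/2) |w(r)| + sup_{r ≥ 1} e^(r²/2) r^(2 - (lam - d)/2) |w(r)|`. -/
def XNorm (d : ℕ) (lam rs : ℝ) (w : ℝ → ℝ) : ENNReal :=
  (⨆ r ∈ Icc rs 1, ENNReal.ofReal (r ^ (((d : ℝ) - 2) / 2) * |w r|))
    + ⨆ r ∈ Ici (1 : ℝ),
        ENNReal.ofReal (Real.exp (r ^ 2 / 2) * r ^ (2 - (lam - (d : ℝ)) / 2) * |w r|)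

end HarmonicField

end

/-!
Write `ψ = Φ + χ`, `φ = Φ + χ + w` and `u = r^(ε/2) (Φ + ε φ)`. Since `Φ` and the corrector solve
their equations, `u` solves the nonlinear equation exactly when `w` solves the equation linearised
at `Φ`, with dimension and spectral parameter shifted by `ε`, and with a source that is of second
order in `φ` and `log r` and carries a factor `ε` (`perturbed_equation`, `nonlinearSource`).
Everything thus rests on a theory of decaying solutions of
`-w'' - (d + ε - 1)/r w' + (r² - lam - ε) w - P w = F`, `P = p Φ^(p-1) + q Φ^(q-1)`,
with bounds uniform in the inner radius `rs`.

*Solvability.* In the gauge `w = e^{-r²/2} r^{(lam-d)/2} g` the equation can be integrated twice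
from infinity. Since `P = O(r⁻²)`, this is a contraction on all of `(0, ∞)` for a weight that is
sufficiently singular at the origin (`exists_decaying_gauged_solution`,
`exists_isDecayingSolution`); Lipschitz nonlinearities are treated in the same way.

*Bounds.* On `[1, ∞)` a Lyapunov function for `g` and barriers control the decaying solution by
its source, uniformly in `ε` (`bound_at_infinity`). On `[rs, 1]`, the Joseph-Lundgren condition
means that `r² P` tends to `ω² + ((d-2)/2)²` with `ω > 0` (`oscillation_of_belowJosephLundgren`),
so that `r^{(d-2)/2} w` solves a perturbed harmonic oscillator in the variable `log r`. Its energy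
changes by a bounded factor as long as `|ε| log (1/rs) ≤ 1` (`energy_bound`). Together these give
`ProfileBounds.linear_estimate` in the norm of the problem.

*The singular profile.* The bounds on `Φ` that enter are collected in `ProfileBounds`. At the
origin they come from the Emden-Fowler variables `s = -log r`, `v = r^μ Φ`, `μ = 2/(p-1)`: the
flux `-r^(d-1) Φ'` dominates the mass of `Φ^p` in a ball, which bounds `v`
(`IsLogProfile.upper_bound`); the equation for `v` is autonomous up to an exponentially small
error, and damped in one direction as `p` is Sobolev supercritical, so `v` tends to an equilibrium
(`emdenFowler_convergence`). The equilibrium `0` is excluded because `Φ` would then be bounded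
(`IsLogProfile.not_tendsto_zero`), and the other one is approached at an exponential rate
(`emdenFowler_rate`). At infinity `Φ` decays exponentially, hence its Wronskian with the decaying
solution of the linear equation that it satisfies vanishes, and it is a multiple of that solution
(`IsProfile.gaussian_tail`).

*The perturbation.* By the linear estimate the correctors are bounded by the weight
(`ProfileBounds.corrector_bound`), and a source bounded near the origin by `r^{-γ-2}` times the
weight, `γ = σ - 1`, produces a solution bounded by `rs^{-γ}` times the weight. The nonlinear
source satisfies this bound, with a factor `|ε|`, as long as `w` is bounded by the weight.
Truncating it beyond this bound makes it globally Lipschitz; the solution is bounded by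
`|ε| rs^{-γ}` times the weight, so for `|ε| < δ rs^γ` the truncation is inactive
(`ProfileBounds.exists_perturbation`). The derivative at `ε = 0` is the decaying solution with the
quadratic part of the source (`ProfileBounds.exists_derivative`); the difference quotients
converge to it by the linear estimate for the difference
(`ProfileBounds.perturbation_sub_derivative`).
-/

noncomputable section

namespace HarmonicField

open MeasureTheory

/-! ### Integration from infinity and the decaying solution operator -/

/-- If `|f| ≤ -b'` where `b` decreases to `0`, then `f` is integrable at infinity, its tail
integrals are controlled by `b`, and they can be differentiated. -/
theorem tail_integral_of_barrier {f b b' : ℝ → ℝ} (hf : ContinuousOn f (Ioi 0))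
    (hb : ∀ r, 0 < r → HasDerivAt b (b' r) r) (hfb : ∀ r, 0 < r → |f r| ≤ -b' r)
    (hb0 : Tendsto b atTop (𝓝 0)) {r : ℝ} (hr : 0 < r) :
    IntegrableOn f (Ioi r) ∧ |∫ t in Ioi r, f t| ≤ b r ∧
      HasDerivAt (fun x => ∫ t in Ioi x, f t) (-f r) r := by
  have hint : ∀ x, 0 < x → IntegrableOn f (Ioi x) ∧ |∫ t in Ioi x, f t| ≤ b x := by
    intro x hx
    have hneg : ∀ y ∈ Ioi x, b' y ≤ 0 := fun y hy => by
      have := (abs_nonneg _).trans (hfb y (hx.trans hy)); linarith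
    have hd : ∀ y ∈ Ici x, HasDerivAt b (b' y) y := fun y hy => hb y (hx.trans_le hy)
    have hib := integrableOn_Ioi_deriv_of_nonpos' hd hneg hb0
    have hval := integral_Ioi_of_hasDerivAt_of_nonpos' hd hneg hb0
    have hle : ∀ᵐ y ∂(volume.restrict (Ioi x)), ‖f y‖ ≤ -b' y := by
      filter_upwards [ae_restrict_mem measurableSet_Ioi] with y hy
      exact hfb y (hx.trans hy)
    have hif : IntegrableOn f (Ioi x) :=
      Integrable.mono' hib.neg
        ((hf.mono (Ioi_subset_Ioi hx.le)).aestronglyMeasurable measurableSet_Ioi) hle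
    refine ⟨hif, ?_⟩
    have := norm_integral_le_of_norm_le hib.neg hle
    rw [show (∫ y in Ioi x, (-b') y) = -∫ y in Ioi x, b' y from integral_neg b', hval] at this
    simpa using this
  refine ⟨(hint r hr).1, (hint r hr).2, ?_⟩
  have hr2 : 0 < r / 2 := by linarith
  have hcont : ContinuousAt f r := hf.continuousAt (Ioi_mem_nhds hr)
  have hii : IntervalIntegrable f volume (r / 2) r := by
    apply ContinuousOn.intervalIntegrable
    rw [uIcc_of_le (by linarith)]
    exact hf.mono fun y hy => hr2.trans_le hy.1
  have hD : HasDerivAt (fun x => ∫ t in (r / 2)..x, f t) (f r) r :=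
    intervalIntegral.integral_hasDerivAt_right hii
      (hf.stronglyMeasurableAtFilter isOpen_Ioi r hr) hcont
  have hD2 := hD.const_sub (∫ t in Ioi (r / 2), f t)
  refine hD2.congr_of_eventuallyEq ?_
  filter_upwards [Ioi_mem_nhds (show r / 2 < r by linarith)] with x hx
  have hx' : r / 2 < x := hx
  rw [intervalIntegral.integral_of_le hx'.le]
  have hun : Ioi (r / 2) = Ioc (r / 2) x ∪ Ioi x := (Ioc_union_Ioi_eq_Ioi hx'.le).symm
  have hi0 := (hint _ hr2).1
  have : ∫ t in Ioi (r / 2), f t = (∫ t in Ioc (r / 2) x, f t) + ∫ t in Ioi x, f t := by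
    conv_lhs => rw [hun]
    refine setIntegral_union ?_ measurableSet_Ioi
      (hi0.mono_set Ioc_subset_Ioi_self) (hint x (hr2.trans hx')).1
    rw [Set.disjoint_left]
    intro y hy hy'
    exact absurd hy.2 (not_le.mpr hy')
  simp only [this]
  ring

/-- The weight `(1 + r⁻²)^N`, equal to `1` at infinity and of size `r^(-2N)` at the origin. -/
def originWeight (N : ℕ) (r : ℝ) : ℝ := (1 + (r ^ 2)⁻¹) ^ N

theorem one_le_originWeight (N : ℕ) (r : ℝ) : 1 ≤ originWeight N r :=
  one_le_pow₀ (by have := inv_nonneg.mpr (sq_nonneg r); linarith)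

theorem originWeight_pos (N : ℕ) (r : ℝ) : 0 < originWeight N r :=
  zero_lt_one.trans_le (one_le_originWeight N r)

theorem originWeight_mono {m n : ℕ} (h : m ≤ n) (r : ℝ) : originWeight m r ≤ originWeight n r :=
  pow_le_pow_right₀ (by have := inv_nonneg.mpr (sq_nonneg r); linarith) h

theorem hasDerivAt_originWeight (N : ℕ) {r : ℝ} (hr : 0 < r) :
    HasDerivAt (originWeight N) (-(2 * N * originWeight N r / (r * (1 + r ^ 2)))) r := by
  have h1 : HasDerivAt (fun r : ℝ => 1 + (r ^ 2)⁻¹) (-(2 * r) / (r ^ 2) ^ 2) r := by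
    have := ((hasDerivAt_pow 2 r).inv (by positivity)).const_add 1
    simpa using this
  have h2 := h1.pow N
  refine h2.congr_deriv ?_
  rcases N with _ | N
  · simp
  · unfold originWeight
    have : (1 + (r ^ 2)⁻¹) = (1 + r ^ 2) / r ^ 2 := by field_simp; ring
    simp only [Nat.add_sub_cancel, pow_succ (1 + (r ^ 2)⁻¹) N]
    rw [this]
    field_simp

theorem tendsto_originWeight (N : ℕ) : Tendsto (originWeight N) atTop (𝓝 1) := by
  have h : Tendsto (fun r : ℝ => (r ^ 2)⁻¹) atTop (𝓝 0) :=
    tendsto_inv_atTop_zero.comp (tendsto_pow_atTop (by norm_num))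
  have := (h.const_add 1).pow N
  simp only [add_zero, one_pow] at this
  exact this

theorem continuousOn_originWeight (N : ℕ) : ContinuousOn (originWeight N) (Ioi 0) := fun _ hr =>
  (hasDerivAt_originWeight N hr).continuousAt.continuousWithinAt

/-- The integrating factor of the gauged radial operator `∂² + (-2r + ν/r) ∂`. -/
def gaugeDensity (ν r : ℝ) : ℝ := Real.exp (-r ^ 2) * r ^ ν

theorem gaugeDensity_pos (ν : ℝ) {r : ℝ} (hr : 0 < r) : 0 < gaugeDensity ν r :=
  mul_pos (Real.exp_pos _) (Real.rpow_pos_of_pos hr _)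

theorem hasDerivAt_gaugeDensity (ν : ℝ) {r : ℝ} (hr : 0 < r) :
    HasDerivAt (gaugeDensity ν) ((-2 * r + ν / r) * gaugeDensity ν r) r := by
  have h1 : HasDerivAt (fun r : ℝ => Real.exp (-r ^ 2)) (Real.exp (-r ^ 2) * (-(2 * r))) r := by
    have := ((hasDerivAt_pow 2 r).neg).exp
    simpa using this
  have h2 := Real.hasDerivAt_rpow_const (p := ν) (Or.inl hr.ne')
  refine (h1.mul h2).congr_deriv ?_
  unfold gaugeDensity
  rw [Real.rpow_sub_one hr.ne']
  field_simp

theorem tendsto_gaugeDensity (ν : ℝ) : Tendsto (gaugeDensity ν) atTop (𝓝 0) := by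
  have h := (tendsto_rpow_mul_exp_neg_mul_atTop_nhds_zero ν 1 one_pos)
  refine squeeze_zero' ?_ ?_ h
  · filter_upwards [eventually_gt_atTop 0] with r hr using (gaugeDensity_pos ν hr).le
  · filter_upwards [eventually_ge_atTop 1] with r hr
    unfold gaugeDensity
    rw [mul_comm]
    have : -r ^ 2 ≤ -1 * r := by nlinarith
    gcongr

/-- Barrier for the inner integral `∫_r^∞ ρ τ⁻² (1 + τ⁻²)^N`. -/
theorem hasDerivAt_innerBarrier (ν : ℝ) (N : ℕ) {r : ℝ} (hr : 0 < r) :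
    HasDerivAt (fun r => gaugeDensity ν r * originWeight N r / (r * (1 + r ^ 2)))
      (-(gaugeDensity ν r * originWeight N r / (r * (1 + r ^ 2))) *
        (2 * r - ν / r + 2 * N / (r * (1 + r ^ 2)) + 1 / r + 2 * r / (1 + r ^ 2))) r := by
  have h1 := (hasDerivAt_gaugeDensity ν hr).mul (hasDerivAt_originWeight N hr)
  have h2 : HasDerivAt (fun r : ℝ => r * (1 + r ^ 2)) (1 + 3 * r ^ 2) r := by
    have := (hasDerivAt_id r).mul ((hasDerivAt_pow 2 r).const_add 1)
    refine this.congr_deriv ?_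
    simp; ring
  refine (h1.div h2 (by positivity)).congr_deriv ?_
  simp only [Pi.mul_apply]
  field_simp
  ring

/-- Two successive integrations from infinity gain the factor `1/N` in the weighted norms. -/
theorem gauged_integration {ν : ℝ} {N : ℕ} (hN : 0 < N)
    (hNν : ∀ x : ℝ, 1 ≤ x → ν + 1 ≤ 3 / 2 * x + 2 * N / x)
    {J : ℝ → ℝ} (hJ : ContinuousOn J (Ioi 0)) {S : ℝ}
    (hS : ∀ r, 0 < r → |J r| ≤ S * (r ^ 2)⁻¹ * originWeight N r) :
    ∀ r, 0 < r →
      HasDerivAt (fun x => -∫ t in Ioi x,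
        (gaugeDensity ν t)⁻¹ * ∫ s in Ioi t, gaugeDensity ν s * J s)
        ((gaugeDensity ν r)⁻¹ * ∫ s in Ioi r, gaugeDensity ν s * J s) r ∧
      HasDerivAt (fun t => (gaugeDensity ν t)⁻¹ * ∫ s in Ioi t, gaugeDensity ν s * J s)
        ((2 * r - ν / r) * ((gaugeDensity ν r)⁻¹ * ∫ s in Ioi r, gaugeDensity ν s * J s)
          - J r) r ∧
      IntegrableOn (fun t => (gaugeDensity ν t)⁻¹ * ∫ s in Ioi t, gaugeDensity ν s * J s)
        (Ioi r) ∧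
      IntegrableOn (fun s => gaugeDensity ν s * J s) (Ioi r) ∧
      |∫ t in Ioi r, (gaugeDensity ν t)⁻¹ * ∫ s in Ioi t, gaugeDensity ν s * J s|
        ≤ S / N * (originWeight N r - 1) ∧
      |(gaugeDensity ν r)⁻¹ * ∫ s in Ioi r, gaugeDensity ν s * J s|
        ≤ 2 * S * originWeight N r / (r * (1 + r ^ 2)) := by
  have hS0 : 0 ≤ S := by
    have := (abs_nonneg _).trans (hS 1 one_pos)
    have h1 := originWeight_pos N 1
    by_contra hneg
    have : S * (1 ^ 2)⁻¹ * originWeight N 1 < 0 := by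
      have : S < 0 := not_le.mp hneg
      simpa using mul_neg_of_neg_of_pos this h1
    linarith
  have hρc : ContinuousOn (gaugeDensity ν) (Ioi 0) := fun r hr =>
    (hasDerivAt_gaugeDensity ν hr).continuousAt.continuousWithinAt
  have inner := fun (r : ℝ) (hr : 0 < r) => tail_integral_of_barrier
    (f := fun s => gaugeDensity ν s * J s)
    (b := fun r => 2 * S * (gaugeDensity ν r * originWeight N r / (r * (1 + r ^ 2))))
    (hρc.mul hJ) (fun r hr => (hasDerivAt_innerBarrier ν N hr).const_mul (2 * S))
    (by
      intro r hr
      rw [abs_mul, abs_of_pos (gaugeDensity_pos ν hr)]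
      have hρ := gaugeDensity_pos ν hr
      have hΩ := originWeight_pos N r
      have key : 1 / (2 * r ^ 2) ≤ 1 / (r * (1 + r ^ 2)) * (2 * r - ν / r +
          2 * N / (r * (1 + r ^ 2)) + 1 / r + 2 * r / (1 + r ^ 2)) := by
        have h := hNν (1 + r ^ 2) (by nlinarith)
        have e : 1 / (r * (1 + r ^ 2)) * (2 * r - ν / r +
          2 * N / (r * (1 + r ^ 2)) + 1 / r + 2 * r / (1 + r ^ 2)) =
          (1 / (r ^ 2 * (1 + r ^ 2))) * (2 * r ^ 2 - ν + 2 * N / (1 + r ^ 2) + 1 +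
            2 * r ^ 2 / (1 + r ^ 2)) := by
          field_simp
        rw [e]
        have e2 : 1 / (2 * r ^ 2) = (1 / (r ^ 2 * (1 + r ^ 2))) * ((1 + r ^ 2) / 2) := by
          field_simp
        rw [e2]
        apply mul_le_mul_of_nonneg_left _ (by positivity)
        have : 0 ≤ 2 * r ^ 2 / (1 + r ^ 2) := by positivity
        linarith
      calc gaugeDensity ν r * |J r|
          ≤ gaugeDensity ν r * (S * (r ^ 2)⁻¹ * originWeight N r) :=
            mul_le_mul_of_nonneg_left (hS r hr) hρ.le
        _ = 2 * S * (gaugeDensity ν r * originWeight N r) * (1 / (2 * r ^ 2)) := by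
            field_simp
        _ ≤ 2 * S * (gaugeDensity ν r * originWeight N r) * (1 / (r * (1 + r ^ 2)) *
            (2 * r - ν / r + 2 * N / (r * (1 + r ^ 2)) + 1 / r + 2 * r / (1 + r ^ 2))) :=
            mul_le_mul_of_nonneg_left key (by positivity)
        _ = _ := by ring)
    (by
      have h1 := ((tendsto_gaugeDensity ν).mul (tendsto_originWeight N))
      have h2 : Tendsto (fun r : ℝ => (r * (1 + r ^ 2))⁻¹) atTop (𝓝 0) := by
        refine tendsto_inv_atTop_zero.comp ?_
        refine tendsto_atTop_mono' atTop ?_ tendsto_id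
        filter_upwards [eventually_ge_atTop 0] with r hr
        simp only [id]
        nlinarith [mul_nonneg hr (sq_nonneg r)]
      have := (h1.mul h2).const_mul (2 * S)
      simpa [div_eq_mul_inv] using this) hr
  set h : ℝ → ℝ := fun t => (gaugeDensity ν t)⁻¹ * ∫ s in Ioi t, gaugeDensity ν s * J s with hh
  have hhd : ∀ r, 0 < r → HasDerivAt h ((2 * r - ν / r) * h r - J r) r := by
    intro r hr
    have hρ := (gaugeDensity_pos ν hr).ne'
    have := ((hasDerivAt_gaugeDensity ν hr).inv hρ).mul (inner r hr).2.2
    refine this.congr_deriv ?_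
    simp only [hh, Pi.inv_apply]
    field_simp
    ring
  have hhb : ∀ r, 0 < r → |h r| ≤ 2 * S * originWeight N r / (r * (1 + r ^ 2)) := by
    intro r hr
    have hρ := gaugeDensity_pos ν hr
    simp only [hh]
    rw [abs_mul, abs_of_pos (inv_pos.mpr hρ)]
    calc _ ≤ (gaugeDensity ν r)⁻¹ *
          (2 * S * (gaugeDensity ν r * originWeight N r / (r * (1 + r ^ 2)))) :=
          mul_le_mul_of_nonneg_left (inner r hr).2.1 (inv_pos.mpr hρ).le
      _ = _ := by field_simp
  have outer := fun (r : ℝ) (hr : 0 < r) => tail_integral_of_barrier (f := h)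
    (b := fun r => S / N * (originWeight N r - 1))
    (fun r hr => (hhd r hr).continuousAt.continuousWithinAt)
    (fun r hr => ((hasDerivAt_originWeight N hr).sub_const 1).const_mul (S / N))
    (by
      intro r hr
      refine (hhb r hr).trans (le_of_eq ?_)
      have : (N : ℝ) ≠ 0 := by exact_mod_cast hN.ne'
      field_simp)
    (by
      have := ((tendsto_originWeight N).sub_const 1).const_mul (S / N)
      simpa using this) hr
  intro r hr
  refine ⟨?_, hhd r hr, (outer r hr).1, (inner r hr).1, (outer r hr).2.1, hhb r hr⟩
  have := (outer r hr).2.2.neg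
  rw [neg_neg] at this
  exact this

open MeasureTheory

/-- A Lipschitz right-hand side with inverse square Lipschitz constant admits a solution of the
gauged equation `g'' = (2r - ν/r) g' - J(r, g)` that vanishes at infinity: the double
integration from infinity is a contraction for the weighted supremum norm once the weight at the
origin is singular enough. -/
theorem exists_decaying_gauged_solution {ν B B₀ : ℝ} {n : ℕ} {J : ℝ → ℝ → ℝ}
    (hJc : ContinuousOn (fun z : ℝ × ℝ => J z.1 z.2) (Ioi 0 ×ˢ univ))
    (hL : ∀ r, 0 < r → ∀ x y, |J r x - J r y| ≤ B * (r ^ 2)⁻¹ * |x - y|)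
    (h0 : ∀ r, 0 < r → |J r 0| ≤ B₀ * (r ^ 2)⁻¹ * originWeight n r) :
    ∃ (g h : ℝ → ℝ) (M : ℝ) (N : ℕ), ∀ r, 0 < r →
      HasDerivAt g (h r) r ∧ HasDerivAt h ((2 * r - ν / r) * h r - J r (g r)) r ∧
      |g r| ≤ M * (originWeight N r - 1) ∧
      |h r| ≤ M * (originWeight N r / (r * (1 + r ^ 2))) := by
  -- `2 B ≤ N` makes the contraction factor `B / N` at most `1/2`; the condition on `ν` is what the
  -- barrier of the inner integral needs
  obtain ⟨N, hNn, hNB, hNν, hN0⟩ : ∃ N : ℕ, n ≤ N ∧ 2 * B ≤ N ∧ (ν + 1) ^ 2 ≤ 12 * N ∧ 0 < N := by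
    obtain ⟨k, hk⟩ := exists_nat_ge (2 * B)
    obtain ⟨l, hl⟩ := exists_nat_ge ((ν + 1) ^ 2)
    refine ⟨n + k + l + 1, by omega, ?_, ?_, by omega⟩ <;> push_cast
    · have : (0 : ℝ) ≤ n := n.cast_nonneg
      have : (0 : ℝ) ≤ l := l.cast_nonneg
      linarith
    · have : (0 : ℝ) ≤ n := n.cast_nonneg
      have : (0 : ℝ) ≤ l := l.cast_nonneg
      have : (0 : ℝ) ≤ k := k.cast_nonneg
      linarith
  have hNpos : (0 : ℝ) < N := by exact_mod_cast hN0
  have hNν' : ∀ x : ℝ, 1 ≤ x → ν + 1 ≤ 3 / 2 * x + 2 * N / x := by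
    intro x hx
    have hx0 : 0 < x := by linarith
    rw [← sub_nonneg]
    have : 3 / 2 * x + 2 * N / x - (ν + 1) = (3 / 2 * x ^ 2 + 2 * N - (ν + 1) * x) / x := by
      field_simp
    rw [this]
    apply div_nonneg _ hx0.le
    nlinarith [sq_nonneg (3 * x - (ν + 1))]
  have hB : 0 ≤ B := by
    have := (abs_nonneg _).trans (hL 1 one_pos 1 0)
    simpa using this
  have hB₀ : 0 ≤ B₀ := by
    have := (abs_nonneg _).trans (h0 1 one_pos)
    have h1 := originWeight_pos n 1
    by_contra hneg
    have : B₀ * (1 ^ 2)⁻¹ * originWeight n 1 < 0 := by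
      simpa using mul_neg_of_neg_of_pos (not_le.mp hneg) h1
    linarith
  -- the unknown is `f` with `g r = originWeight N r * f (log r)`, so that the bounded continuous
  -- functions on the line carry the weighted supremum norm
  let Jf : BoundedContinuousFunction ℝ ℝ → ℝ → ℝ := fun f r =>
    J r (originWeight N r * f (Real.log r))
  have hJfc : ∀ f, ContinuousOn (Jf f) (Ioi 0) := by
    intro f
    have h1 : ContinuousOn (fun r : ℝ => originWeight N r * f (Real.log r)) (Ioi 0) := by
      refine (continuousOn_originWeight N).mul (f.continuous.comp_continuousOn ?_)
      exact Real.continuousOn_log.mono fun r hr => (ne_of_gt hr)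
    exact hJc.comp (continuousOn_id.prodMk h1) fun r hr => ⟨hr, mem_univ _⟩
  have hJfd : ∀ f f' r, 0 < r → |Jf f r - Jf f' r| ≤
      B * dist f f' * (r ^ 2)⁻¹ * originWeight N r := by
    intro f f' r hr
    refine (hL r hr _ _).trans ?_
    rw [← mul_sub, abs_mul, abs_of_pos (originWeight_pos N r)]
    have : |f (Real.log r) - f' (Real.log r)| ≤ dist f f' :=
      BoundedContinuousFunction.dist_coe_le_dist (f := f) (g := f') _
    have hw := (originWeight_pos N r).le
    calc B * (r ^ 2)⁻¹ * (originWeight N r * |f (Real.log r) - f' (Real.log r)|)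
        ≤ B * (r ^ 2)⁻¹ * (originWeight N r * dist f f') := by gcongr
      _ = _ := by ring
  have hJfb : ∀ f r, 0 < r → |Jf f r| ≤
      (B₀ + B * dist f 0) * (r ^ 2)⁻¹ * originWeight N r := by
    intro f r hr
    have h1 := hJfd f 0 r hr
    have h2 : |Jf 0 r| ≤ B₀ * (r ^ 2)⁻¹ * originWeight N r := by
      have : Jf 0 r = J r 0 := by simp [Jf]
      rw [this]
      refine (h0 r hr).trans ?_
      exact mul_le_mul_of_nonneg_left (originWeight_mono hNn r) (by positivity)
    have h3 : |Jf f r| ≤ |Jf f r - Jf 0 r| + |Jf 0 r| := by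
      have := abs_add_le (Jf f r - Jf 0 r) (Jf 0 r)
      simpa using this
    calc |Jf f r| ≤ _ := h3
      _ ≤ _ := add_le_add h1 h2
      _ = _ := by ring
  let hf : BoundedContinuousFunction ℝ ℝ → ℝ → ℝ := fun f t =>
    (gaugeDensity ν t)⁻¹ * ∫ s in Ioi t, gaugeDensity ν s * Jf f s
  have key := fun f => gauged_integration hN0 hNν' (hJfc f) (hJfb f)
  let T : BoundedContinuousFunction ℝ ℝ → BoundedContinuousFunction ℝ ℝ := fun f =>
    BoundedContinuousFunction.ofNormedAddCommGroup
      (fun t => (originWeight N (Real.exp t))⁻¹ * -∫ x in Ioi (Real.exp t), hf f x)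
      (by
        rw [continuous_iff_continuousAt]
        intro t
        have h1 : ContinuousAt (originWeight N) (Real.exp t) :=
          (hasDerivAt_originWeight N (Real.exp_pos t)).continuousAt
        have h2 := ((key f) (Real.exp t) (Real.exp_pos t)).1.continuousAt
        have h3 : ContinuousAt (fun t => originWeight N (Real.exp t)) t :=
          ContinuousAt.comp (f := Real.exp) h1 Real.continuous_exp.continuousAt
        have h4 : ContinuousAt (fun t => -∫ x in Ioi (Real.exp t), hf f x) t :=
          ContinuousAt.comp (f := Real.exp) h2 Real.continuous_exp.continuousAt
        exact (h3.inv₀ (originWeight_pos N _).ne').mul h4)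
      ((B₀ + B * dist f 0) / N)
      (by
        intro t
        have h2 := ((key f) (Real.exp t) (Real.exp_pos t)).2.2.2.2.1
        have hw := originWeight_pos N (Real.exp t)
        have hS : 0 ≤ (B₀ + B * dist f 0) / N := by positivity
        rw [Real.norm_eq_abs, abs_mul, abs_neg, abs_of_pos (inv_pos.mpr hw)]
        rw [inv_mul_le_iff₀ hw]
        refine h2.trans ?_
        nlinarith)
  have hT : ContractingWith (1 / 2) T := by
    refine ⟨by
      rw [← NNReal.coe_lt_coe]; norm_num, LipschitzWith.of_dist_le_mul fun f f' => ?_⟩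
    rw [BoundedContinuousFunction.dist_le (by positivity)]
    intro t
    set r := Real.exp t with hrdef
    have hr : 0 < r := Real.exp_pos t
    have kd := gauged_integration hN0 hNν' ((hJfc f).sub (hJfc f')) (hJfd f f') r hr
    have hdiff : ∫ x in Ioi r, (gaugeDensity ν x)⁻¹ * ∫ s in Ioi x, gaugeDensity ν s *
        (Jf f - Jf f') s = (∫ x in Ioi r, hf f x) - ∫ x in Ioi r, hf f' x := by
      rw [← integral_sub (key f r hr).2.2.1 (key f' r hr).2.2.1]
      refine setIntegral_congr_fun measurableSet_Ioi fun x hx => ?_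
      have hx0 : 0 < x := hr.trans hx
      rw [← mul_sub, ← integral_sub (key f x hx0).2.2.2.1 (key f' x hx0).2.2.2.1]
      simp only [Pi.sub_apply, mul_sub]
    have hb := kd.2.2.2.2.1
    rw [hdiff] at hb
    have hw := originWeight_pos N r
    have hval : T f t - T f' t =
        (originWeight N r)⁻¹ * -((∫ x in Ioi r, hf f x) - ∫ x in Ioi r, hf f' x) := by
      simp only [T, BoundedContinuousFunction.coe_ofNormedAddCommGroup]
      rw [← hrdef]
      ring
    rw [Real.dist_eq, hval, abs_mul, abs_neg, abs_of_pos (inv_pos.mpr hw), inv_mul_le_iff₀ hw]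
    refine hb.trans ?_
    have hBN : B / N ≤ 1 / 2 := by
      rw [div_le_iff₀ hNpos]; linarith
    have hd : 0 ≤ dist f f' := dist_nonneg
    have h1 := one_le_originWeight N r
    have hc : (((1 / 2 : NNReal) : ℝ)) = 1 / 2 := by norm_num
    rw [hc]
    calc B * dist f f' / N * (originWeight N r - 1)
        = (B / N) * (dist f f' * (originWeight N r - 1)) := by ring
      _ ≤ (1 / 2) * (dist f f' * (originWeight N r)) := by
          apply mul_le_mul hBN _ (mul_nonneg hd (by linarith)) (by norm_num)
          exact mul_le_mul_of_nonneg_left (by linarith) hd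
      _ = _ := by ring
  obtain ⟨f, hfix⟩ : ∃ f, T f = f := ⟨_, hT.fixedPoint_isFixedPt⟩
  have hg : ∀ r, 0 < r → originWeight N r * f (Real.log r) = -∫ x in Ioi r, hf f x := by
    intro r hr
    have : T f (Real.log r) = f (Real.log r) := by rw [hfix]
    simp only [T, BoundedContinuousFunction.coe_ofNormedAddCommGroup, Real.exp_log hr] at this
    rw [← this, ← mul_assoc, mul_inv_cancel₀ (originWeight_pos N r).ne', one_mul]
  have hS0 : 0 ≤ B₀ + B * dist f 0 := by positivity
  refine ⟨fun r => -∫ x in Ioi r, hf f x, hf f, 2 * (B₀ + B * dist f 0), N, fun r hr => ?_⟩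
  have k := key f r hr
  have hJg : J r (-∫ x in Ioi r, hf f x) = Jf f r := by
    simp only [Jf]; rw [hg r hr]
  refine ⟨k.1, ?_, ?_, ?_⟩
  · simp only [hJg]; exact k.2.1
  · rw [abs_neg]
    refine k.2.2.2.2.1.trans ?_
    apply mul_le_mul_of_nonneg_right _ (by have := one_le_originWeight N r; linarith)
    rw [div_le_iff₀ hNpos]
    have : (1 : ℝ) ≤ N := by exact_mod_cast hN0
    nlinarith
  · exact k.2.2.2.2.2.trans (le_of_eq (by ring))

/-- Away from the origin the weight decays to `1` like `r⁻²`. -/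
theorem originWeight_sub_one_le (N : ℕ) {r : ℝ} (hr : 1 ≤ r) :
    originWeight N r - 1 ≤ 2 ^ N * (r ^ 2)⁻¹ := by
  have hx0 : 0 ≤ (r ^ 2)⁻¹ := by positivity
  have hx1 : (r ^ 2)⁻¹ ≤ 1 := inv_le_one_of_one_le₀ (one_le_pow₀ hr)
  unfold originWeight
  generalize (r ^ 2)⁻¹ = x at *
  induction N with
  | zero => simpa using hx0
  | succ k ih =>
    have h2 : (1 + x) ^ k ≤ 2 ^ k := pow_le_pow_left₀ (by linarith) (by linarith) k
    rw [pow_succ, pow_succ]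
    nlinarith

theorem originWeight_le (N : ℕ) {r : ℝ} (hr : 1 ≤ r) : originWeight N r ≤ 2 ^ N := by
  have hx1 : (r ^ 2)⁻¹ ≤ 1 := inv_le_one_of_one_le₀ (one_le_pow₀ hr)
  exact pow_le_pow_left₀ (by positivity) (by linarith) N

/-! ### Uniform bounds at infinity -/

theorem ge_limit_of_deriv_nonpos {f f' : ℝ → ℝ} {R l : ℝ}
    (hd : ∀ r, R ≤ r → HasDerivAt f (f' r) r) (hneg : ∀ r, R ≤ r → f' r ≤ 0)
    (hl : Tendsto f atTop (𝓝 l)) {r : ℝ} (hr : R ≤ r) : l ≤ f r := by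
  have hanti : AntitoneOn f (Ici R) := by
    refine antitoneOn_of_deriv_nonpos (convex_Ici R)
      (fun x hx => (hd x hx).continuousAt.continuousWithinAt) ?_ ?_
    · intro x hx
      rw [interior_Ici] at hx
      exact (hd x hx.le).differentiableAt.differentiableWithinAt
    · intro x hx
      rw [interior_Ici] at hx
      rw [(hd x hx.le).deriv]
      exact hneg x hx.le
  refine le_of_tendsto hl ?_
  filter_upwards [eventually_ge_atTop r] with x hx
  exact hanti hr (hr.trans hx) hx

theorem le_limit_of_deriv_nonneg {f f' : ℝ → ℝ} {R l : ℝ}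
    (hd : ∀ r, R ≤ r → HasDerivAt f (f' r) r) (hpos : ∀ r, R ≤ r → 0 ≤ f' r)
    (hl : Tendsto f atTop (𝓝 l)) {r : ℝ} (hr : R ≤ r) : f r ≤ l := by
  have := ge_limit_of_deriv_nonpos (f := fun x => -f x) (fun x hx => (hd x hx).neg)
    (fun x hx => neg_nonpos.mpr (hpos x hx)) hl.neg hr
  linarith

theorem hasDerivAt_inv_sq {r : ℝ} (hr : r ≠ 0) :
    HasDerivAt (fun r : ℝ => (r ^ 2)⁻¹) (-(2 * (r ^ 3)⁻¹)) r := by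
  refine ((hasDerivAt_pow 2 r).inv (by positivity)).congr_deriv ?_
  field_simp
  norm_num
  ring

theorem tendsto_inv_pow_atTop {n : ℕ} (hn : n ≠ 0) :
    Tendsto (fun r : ℝ => (r ^ n)⁻¹) atTop (𝓝 0) :=
  tendsto_inv_atTop_zero.comp (tendsto_pow_atTop hn)

/-- Lyapunov step: `g² + r² h²` cannot grow towards the origin faster than the integrable
rate `r⁻³`, as the strong damping `2 r h` absorbs the coupling terms. -/
theorem gauged_lyapunov {ν ν₀ B Y M : ℝ} {g h J : ℝ → ℝ} (hν : |ν| ≤ ν₀)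
    (hg : ∀ r, 1 ≤ r → HasDerivAt g (h r) r)
    (hh : ∀ r, 1 ≤ r → HasDerivAt h ((2 * r - ν / r) * h r - J r) r)
    (hJ : ∀ r, 1 ≤ r → |J r| ≤ (B * |g r| + Y) * (r ^ 2)⁻¹)
    (hgM : ∀ r, 1 ≤ r → |g r| ≤ M * (r ^ 2)⁻¹) (hhM : ∀ r, 1 ≤ r → |h r| ≤ M * (r ^ 3)⁻¹)
    {r : ℝ} (hr : 1 ≤ r) :
    g r ^ 2 + r ^ 2 * h r ^ 2 ≤ 2 * Real.exp (1 + 2 * B ^ 2 + ν₀ ^ 2) * Y ^ 2 := by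
  set C := 1 + 2 * B ^ 2 + ν₀ ^ 2 with hC
  have hC1 : 1 ≤ C := by nlinarith [sq_nonneg B, sq_nonneg ν₀]
  have hM : 0 ≤ M := by have := (abs_nonneg _).trans (hgM 1 le_rfl); simpa using this
  let Λ : ℝ → ℝ := fun r => g r ^ 2 + r ^ 2 * h r ^ 2
  let Λ' : ℝ → ℝ := fun r => 2 * g r * h r + (4 * r ^ 3 + 2 * r - 2 * ν * r) * h r ^ 2
    - 2 * r ^ 2 * h r * J r
  have hΛ : ∀ r, 1 ≤ r → HasDerivAt Λ (Λ' r) r := by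
    intro r hr
    have hr0 : r ≠ 0 := by positivity
    refine (((hg r hr).pow 2).add ((hasDerivAt_pow 2 r).mul ((hh r hr).pow 2))).congr_deriv ?_
    simp only [Λ', Pi.pow_apply]
    field_simp
    norm_num
    ring
  have hΛ' : ∀ r, 1 ≤ r → 0 ≤ Λ' r + (C * Λ r + 2 * Y ^ 2) * (r ^ 3)⁻¹ := by
    intro r hr
    have hr0 : 0 < r := by linarith
    set i := (r ^ 3)⁻¹ with hi
    have hi0 : 0 < i := by positivity
    have hri : r ^ 3 * i = 1 := mul_inv_cancel₀ (by positivity)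
    have e1 : 0 ≤ r ^ 3 * h r ^ 2 + g r ^ 2 * i + 2 * g r * h r := by
      have : r ^ 3 * h r ^ 2 + g r ^ 2 * i + 2 * g r * h r = r ^ 3 * (h r + g r * i) ^ 2 := by
        have : r ^ 3 * (h r + g r * i) ^ 2 = r ^ 3 * h r ^ 2 + (r ^ 3 * i) * (g r ^ 2 * i)
          + (r ^ 3 * i) * (2 * g r * h r) := by ring
        rw [this, hri]; ring
      rw [this]; positivity
    have e2 : 2 * r ^ 2 * h r * J r ≤ r ^ 3 * h r ^ 2 + 2 * (B ^ 2 * g r ^ 2 + Y ^ 2) * i := by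
      have hJr := hJ r hr
      have h1 : 2 * r ^ 2 * h r * J r ≤ 2 * |h r| * (B * |g r| + Y) := by
        calc 2 * r ^ 2 * h r * J r ≤ |2 * r ^ 2 * h r * J r| := le_abs_self _
          _ = 2 * r ^ 2 * |h r| * |J r| := by
            rw [abs_mul, abs_mul, abs_of_pos (by positivity : (0:ℝ) < 2 * r ^ 2)]
          _ ≤ 2 * r ^ 2 * |h r| * ((B * |g r| + Y) * (r ^ 2)⁻¹) := by gcongr
          _ = _ := by field_simp
      have h2 : 2 * |h r| * (B * |g r| + Y) ≤ r ^ 3 * h r ^ 2 + (B * |g r| + Y) ^ 2 * i := by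
        have : r ^ 3 * h r ^ 2 + (B * |g r| + Y) ^ 2 * i - 2 * |h r| * (B * |g r| + Y)
            = r ^ 3 * (|h r| - (B * |g r| + Y) * i) ^ 2 := by
          have : r ^ 3 * (|h r| - (B * |g r| + Y) * i) ^ 2 = r ^ 3 * |h r| ^ 2
            + (r ^ 3 * i) * ((B * |g r| + Y) ^ 2 * i)
            - (r ^ 3 * i) * (2 * |h r| * (B * |g r| + Y)) := by ring
          rw [this, hri, sq_abs]; ring
        have h3 : 0 ≤ r ^ 3 * (|h r| - (B * |g r| + Y) * i) ^ 2 := by positivity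
        linarith
      have h3 : (B * |g r| + Y) ^ 2 ≤ 2 * (B ^ 2 * g r ^ 2 + Y ^ 2) := by
        rw [← sq_abs (g r)]
        nlinarith [sq_nonneg (B * |g r| - Y)]
      have h4 := mul_le_mul_of_nonneg_right h3 hi0.le
      linarith
    have e3 : 0 ≤ r ^ 3 * h r ^ 2 + 2 * (r - ν * r) * h r ^ 2
        + ν₀ ^ 2 * (r ^ 2 * h r ^ 2) * i := by
      have h1 : 0 ≤ r ^ 3 - 2 * ν * r + ν₀ ^ 2 * r ^ 2 * i := by
        have hν2 : ν ^ 2 ≤ ν₀ ^ 2 := by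
          rw [← sq_abs ν]; exact pow_le_pow_left₀ (abs_nonneg _) hν 2
        have : r ^ 2 * i = r⁻¹ := by rw [hi]; field_simp
        rw [mul_assoc (ν₀ ^ 2), this]
        have : r ^ 3 - 2 * ν * r + ν ^ 2 * r⁻¹ = r⁻¹ * (r ^ 2 - ν) ^ 2 := by field_simp; ring
        have h0 : 0 ≤ r⁻¹ * (r ^ 2 - ν) ^ 2 := by positivity
        have := mul_le_mul_of_nonneg_right hν2 (inv_pos.mpr hr0).le
        linarith
      have h2 : 0 ≤ h r ^ 2 := sq_nonneg _
      have := mul_nonneg h1 h2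
      have h3 := mul_nonneg hr0.le h2
      linarith
    have e4 : 0 ≤ (1 + 2 * B ^ 2) * (r ^ 2 * h r ^ 2) * i + ν₀ ^ 2 * g r ^ 2 * i := by positivity
    simp only [Λ, Λ', hC]
    nlinarith
  let Ψ : ℝ → ℝ := fun r => (C * Λ r + 2 * Y ^ 2) * Real.exp (-(C / 2) * (r ^ 2)⁻¹)
  have hΨ : ∀ r, 1 ≤ r → HasDerivAt Ψ (Real.exp (-(C / 2) * (r ^ 2)⁻¹) *
      (C * (Λ' r + (C * Λ r + 2 * Y ^ 2) * (r ^ 3)⁻¹))) r := by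
    intro r hr
    have hr0 : r ≠ 0 := by positivity
    refine ((((hΛ r hr).const_mul C).add_const (2 * Y ^ 2)).mul
      (((hasDerivAt_inv_sq hr0).const_mul (-(C / 2))).exp)).congr_deriv ?_
    ring
  have hlim : Tendsto Ψ atTop (𝓝 (2 * Y ^ 2)) := by
    have h2 := tendsto_inv_pow_atTop (two_ne_zero)
    have hg0 : Tendsto g atTop (𝓝 0) := by
      refine squeeze_zero_norm' ?_ (by simpa using h2.const_mul M)
      filter_upwards [eventually_ge_atTop 1] with r hr using hgM r hr
    have hh0 : Tendsto (fun r => r * h r) atTop (𝓝 0) := by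
      refine squeeze_zero_norm' ?_ (by simpa using h2.const_mul M)
      filter_upwards [eventually_ge_atTop 1] with r hr
      have hr0 : 0 < r := by linarith
      rw [norm_mul, Real.norm_eq_abs, Real.norm_eq_abs, abs_of_pos hr0]
      calc r * |h r| ≤ r * (M * (r ^ 3)⁻¹) := by gcongr; exact hhM r hr
        _ = _ := by field_simp
    have hΛ0 : Tendsto Λ atTop (𝓝 0) := by
      have := (hg0.pow 2).add (hh0.pow 2)
      simp only [mul_pow] at this
      simpa [Λ] using this
    have he : Tendsto (fun r : ℝ => Real.exp (-(C / 2) * (r ^ 2)⁻¹)) atTop (𝓝 1) := by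
      have := (h2.const_mul (-(C / 2)))
      rw [mul_zero] at this
      have h3 := (Real.continuous_exp.tendsto 0).comp this
      rw [Real.exp_zero] at h3
      exact h3
    have := ((hΛ0.const_mul C).add_const (2 * Y ^ 2)).mul he
    simpa [Ψ] using this
  have hmain := le_limit_of_deriv_nonneg hΨ (fun r hr => by
    have := hΛ' r hr
    positivity) hlim hr
  have hΛr : 0 ≤ Λ r := by positivity
  have hexp : 1 ≤ Real.exp C * Real.exp (-(C / 2) * (r ^ 2)⁻¹) := by
    rw [← Real.exp_add]
    apply Real.one_le_exp
    have : (r ^ 2)⁻¹ ≤ 1 := inv_le_one_of_one_le₀ (one_le_pow₀ hr)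
    nlinarith
  have : C * Λ r + 2 * Y ^ 2 ≤ Real.exp C * (2 * Y ^ 2) := by
    calc C * Λ r + 2 * Y ^ 2 ≤ (C * Λ r + 2 * Y ^ 2) *
          (Real.exp C * Real.exp (-(C / 2) * (r ^ 2)⁻¹)) :=
          le_mul_of_one_le_right (by positivity) hexp
      _ = Real.exp C * Ψ r := by simp only [Ψ]; ring
      _ ≤ _ := by gcongr
  have h2 : Λ r ≤ C * Λ r := le_mul_of_one_le_left hΛr hC1
  have : Λ r ≤ Real.exp C * (2 * Y ^ 2) := by nlinarith [sq_nonneg Y]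
  simp only [Λ] at this
  linarith

/-- A bounded solution of the gauged equation is controlled by its source, uniformly in the
parameter `ν`. -/
theorem gauged_bound_at_infinity (ν₀ B : ℝ) (hν₀ : 0 ≤ ν₀) (hB : 0 ≤ B) :
    ∃ C, 0 < C ∧ ∀ (ν Y M : ℝ) (g h J : ℝ → ℝ), |ν| ≤ ν₀ → 0 ≤ Y →
      (∀ r, 1 ≤ r → HasDerivAt g (h r) r) →
      (∀ r, 1 ≤ r → HasDerivAt h ((2 * r - ν / r) * h r - J r) r) →
      (∀ r, 1 ≤ r → |J r| ≤ (B * |g r| + Y) * (r ^ 2)⁻¹) →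
      (∀ r, 1 ≤ r → |g r| ≤ M * (r ^ 2)⁻¹) → (∀ r, 1 ≤ r → |h r| ≤ M * (r ^ 3)⁻¹) →
      ∀ r, 1 ≤ r → |g r| ≤ C * Y * (r ^ 2)⁻¹ ∧ |h r| ≤ C * Y * (r ^ 3)⁻¹ := by
  set C₁ := Real.sqrt (2 * Real.exp (1 + 2 * B ^ 2 + ν₀ ^ 2)) with hC₁
  have hC₁0 : 0 ≤ C₁ := Real.sqrt_nonneg _
  set R := 1 + ν₀ with hR
  set C₂ := (B * C₁ + 1) + C₁ * R ^ 3 with hC₂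
  have hC₂0 : 0 < C₂ := by positivity
  refine ⟨C₂, hC₂0, fun ν Y M g h J hν hY hg hh hJ hgM hhM => ?_⟩
  have hM : 0 ≤ M := by have := (abs_nonneg _).trans (hgM 1 le_rfl); simpa using this
  have hΛ := fun r (hr : 1 ≤ r) => gauged_lyapunov hν hg hh hJ hgM hhM hr
  have hsq : ∀ x : ℝ, x ^ 2 ≤ 2 * Real.exp (1 + 2 * B ^ 2 + ν₀ ^ 2) * Y ^ 2 → |x| ≤ C₁ * Y := by
    intro x hx
    apply abs_le_of_sq_le_sq _ (by positivity)
    rw [mul_pow, hC₁, Real.sq_sqrt (by positivity)]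
    exact hx
  have hg1 : ∀ r, 1 ≤ r → |g r| ≤ C₁ * Y := fun r hr => hsq _ (by
    have := hΛ r hr
    have : 0 ≤ r ^ 2 * h r ^ 2 := by positivity
    linarith)
  have hh1 : ∀ r, 1 ≤ r → |h r| ≤ C₁ * Y := fun r hr => hsq _ (by
    have := hΛ r hr
    have h1 : 1 ≤ r ^ 2 := one_le_pow₀ hr
    nlinarith [sq_nonneg (g r), sq_nonneg (h r)])
  have hJ1 : ∀ r, 1 ≤ r → |J r| ≤ (B * C₁ + 1) * Y * (r ^ 2)⁻¹ := fun r hr => by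
    refine (hJ r hr).trans ?_
    apply mul_le_mul_of_nonneg_right _ (by positivity)
    have := mul_le_mul_of_nonneg_left (hg1 r hr) hB
    linarith
  have hh0 : Tendsto h atTop (𝓝 0) := by
    refine squeeze_zero_norm' ?_ (by
      simpa using (tendsto_inv_pow_atTop (three_ne_zero)).const_mul M)
    filter_upwards [eventually_ge_atTop 1] with r hr using hhM r hr
  have hg0 : Tendsto g atTop (𝓝 0) := by
    refine squeeze_zero_norm' ?_ (by
      simpa using (tendsto_inv_pow_atTop (two_ne_zero)).const_mul M)
    filter_upwards [eventually_ge_atTop 1] with r hr using hgM r hr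
  -- barrier for `h` on `[R, ∞)`, for both signs
  have hbar : ∀ s : ℝ, |s| = 1 → ∀ r, R ≤ r → s * h r ≤ C₂ * Y * (r ^ 3)⁻¹ := by
    intro s hs r hr
    have hd : ∀ r, R ≤ r → HasDerivAt
        (fun r => gaugeDensity ν r * (C₂ * Y * (r ^ 3)⁻¹ - s * h r))
        (gaugeDensity ν r * (-(C₂ * Y * (r ^ 2)⁻¹) * (2 - (ν - 3) / r ^ 2) + s * J r)) r := by
      intro r hr
      have hr1 : 1 ≤ r := by linarith
      have hr0 : 0 < r := by linarith
      have h3 : HasDerivAt (fun r : ℝ => (r ^ 3)⁻¹) (-(3 * (r ^ 4)⁻¹)) r := by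
        refine ((hasDerivAt_pow 3 r).inv (by positivity)).congr_deriv ?_
        field_simp
        norm_num
        ring
      refine ((hasDerivAt_gaugeDensity ν hr0).mul
        ((h3.const_mul (C₂ * Y)).sub ((hh r hr1).const_mul s))).congr_deriv ?_
      simp only [Pi.sub_apply]
      field_simp
      ring
    have hn : ∀ r, R ≤ r →
        gaugeDensity ν r * (-(C₂ * Y * (r ^ 2)⁻¹) * (2 - (ν - 3) / r ^ 2) + s * J r) ≤ 0 := by
      intro r hr
      have hr1 : 1 ≤ r := by linarith
      have hr0 : 0 < r := by linarith
      apply mul_nonpos_of_nonneg_of_nonpos (gaugeDensity_pos ν hr0).le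
      have h1 : s * J r ≤ (B * C₁ + 1) * Y * (r ^ 2)⁻¹ := by
        refine (le_abs_self _).trans ?_
        rw [abs_mul, hs, one_mul]
        exact hJ1 r hr1
      have h2 : 1 ≤ 2 - (ν - 3) / r ^ 2 := by
        have : (ν - 3) / r ^ 2 ≤ 1 := by
          rw [div_le_one (by positivity)]
          have := (le_abs_self ν).trans hν
          nlinarith
        linarith
      have h3 : (B * C₁ + 1) * Y * (r ^ 2)⁻¹ ≤ C₂ * Y * (r ^ 2)⁻¹ := by
        have : B * C₁ + 1 ≤ C₂ := by
          rw [hC₂]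
          linarith [mul_nonneg hC₁0 (by positivity : (0 : ℝ) ≤ R ^ 3)]
        gcongr
      have h4 : 0 ≤ C₂ * Y * (r ^ 2)⁻¹ := by positivity
      nlinarith
    have hl : Tendsto (fun r => gaugeDensity ν r * (C₂ * Y * (r ^ 3)⁻¹ - s * h r))
        atTop (𝓝 0) := by
      have := (tendsto_gaugeDensity ν).mul
        (((tendsto_inv_pow_atTop (three_ne_zero)).const_mul (C₂ * Y)).sub (hh0.const_mul s))
      simpa using this
    have := ge_limit_of_deriv_nonpos hd hn hl hr
    have hr0 : 0 < r := by linarith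
    have := nonneg_of_mul_nonneg_right this (gaugeDensity_pos ν hr0)
    linarith
  have hh2 : ∀ r, 1 ≤ r → |h r| ≤ C₂ * Y * (r ^ 3)⁻¹ := by
    intro r hr
    rcases le_total R r with h1 | h1
    · rw [abs_le]
      have a := hbar 1 (by simp) r h1
      have b := hbar (-1) (by simp) r h1
      constructor <;> linarith
    · refine (hh1 r hr).trans ?_
      have : r ^ 3 ≤ R ^ 3 := pow_le_pow_left₀ (by linarith) h1 3
      rw [← div_eq_mul_inv, le_div_iff₀ (by positivity)]
      calc C₁ * Y * r ^ 3 ≤ C₁ * Y * R ^ 3 := by gcongr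
        _ ≤ C₂ * Y := by
          rw [hC₂]
          have : 0 ≤ (B * C₁ + 1) * Y := by positivity
          linarith
  intro r hr
  refine ⟨?_, hh2 r hr⟩
  -- integrating the bound on `h` from infinity bounds `g`
  have hgb : ∀ s : ℝ, |s| = 1 → s * g r ≤ C₂ * Y * (r ^ 2)⁻¹ := by
    intro s hs
    have hd : ∀ r, 1 ≤ r → HasDerivAt (fun r => C₂ * Y / 2 * (r ^ 2)⁻¹ - s * g r)
        (C₂ * Y / 2 * (-(2 * (r ^ 3)⁻¹)) - s * h r) r := fun r hr =>
      ((hasDerivAt_inv_sq (by positivity)).const_mul _).sub ((hg r hr).const_mul s)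
    have hn : ∀ r, 1 ≤ r → C₂ * Y / 2 * (-(2 * (r ^ 3)⁻¹)) - s * h r ≤ 0 := by
      intro r hr
      have : -(s * h r) ≤ C₂ * Y * (r ^ 3)⁻¹ := by
        refine (neg_le_abs _).trans ?_
        rw [abs_mul, hs, one_mul]; exact hh2 r hr
      linarith
    have hl : Tendsto (fun r => C₂ * Y / 2 * (r ^ 2)⁻¹ - s * g r) atTop (𝓝 0) := by
      have := ((tendsto_inv_pow_atTop (two_ne_zero)).const_mul (C₂ * Y / 2)).sub
        (hg0.const_mul s)
      simpa using this
    have := ge_limit_of_deriv_nonpos hd hn hl hr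
    have : 0 ≤ C₂ * Y / 2 * (r ^ 2)⁻¹ := by positivity
    linarith
  rw [abs_le]
  have a := hgb 1 (by simp)
  have b := hgb (-1) (by simp)
  constructor <;> linarith

/-! ### Decaying solutions of the radial equation -/

/-- The Gaussian profile `e^{-r²/2} r^{(lam-d)/2}`, the decay at infinity of the solutions. -/
def gaussianTail (d lam r : ℝ) : ℝ := Real.exp (-(r ^ 2) / 2) * r ^ ((lam - d) / 2)

theorem gaussianTail_pos (d lam : ℝ) {r : ℝ} (hr : 0 < r) : 0 < gaussianTail d lam r :=
  mul_pos (Real.exp_pos _) (Real.rpow_pos_of_pos hr _)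

theorem hasDerivAt_gaussianTail (d lam : ℝ) {r : ℝ} (hr : 0 < r) :
    HasDerivAt (gaussianTail d lam) ((-r + (lam - d) / 2 / r) * gaussianTail d lam r) r := by
  have h1 : HasDerivAt (fun r : ℝ => Real.exp (-(r ^ 2) / 2))
      (Real.exp (-(r ^ 2) / 2) * (-r)) r := by
    have := (((hasDerivAt_pow 2 r).neg).div_const 2).exp
    refine this.congr_deriv ?_
    simp
    ring
  have h2 := Real.hasDerivAt_rpow_const (p := (lam - d) / 2) (Or.inl hr.ne')
  refine (h1.mul h2).congr_deriv ?_
  unfold gaussianTail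
  rw [Real.rpow_sub_one hr.ne']
  field_simp

theorem continuousOn_gaussianTail (d lam : ℝ) : ContinuousOn (gaussianTail d lam) (Ioi 0) :=
  fun _ hr => (hasDerivAt_gaussianTail d lam hr).continuousAt.continuousWithinAt

/-- `w`, with derivative `w₁`, solves
`w'' + (d + ε - 1)/r w' - (r² - lam - ε) w = -F` on `(0, ∞)`, and
`w = O(e^{-r²/2} r^{(lam-d)/2 - 2})` at infinity, together with the matching bound for the
derivative. -/
structure IsDecayingSolution (d lam ε : ℝ) (F w w₁ : ℝ → ℝ) : Prop where
  hasDerivAt : ∀ r, 0 < r → HasDerivAt w (w₁ r) r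
  hasDerivAt' : ∀ r, 0 < r →
    HasDerivAt w₁ (-((d + ε - 1) / r) * w₁ r + (r ^ 2 - lam - ε) * w r - F r) r
  decay : ∃ M, ∀ r, 1 ≤ r → |w r| ≤ M * (gaussianTail d lam r * (r ^ 2)⁻¹) ∧
    |w₁ r + r * w r| ≤ M * (gaussianTail d lam r * (r ^ 3)⁻¹)

theorem IsDecayingSolution.congr {d lam ε : ℝ} {F F' w w₁ : ℝ → ℝ}
    (h : IsDecayingSolution d lam ε F w w₁) (hF : ∀ r, 0 < r → F r = F' r) :
    IsDecayingSolution d lam ε F' w w₁ :=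
  ⟨h.hasDerivAt, fun r hr => hF r hr ▸ h.hasDerivAt' r hr, h.decay⟩

theorem IsDecayingSolution.const_mul {d lam ε : ℝ} {F w w₁ : ℝ → ℝ}
    (h : IsDecayingSolution d lam ε F w w₁) (c : ℝ) :
    IsDecayingSolution d lam ε (fun r => c * F r) (fun r => c * w r) (fun r => c * w₁ r) := by
  obtain ⟨M, hM⟩ := h.decay
  refine ⟨fun r hr => (h.hasDerivAt r hr).const_mul c, fun r hr =>
    ((h.hasDerivAt' r hr).const_mul c).congr_deriv (by ring), |c| * M, fun r hr => ⟨?_, ?_⟩⟩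
  · rw [abs_mul, mul_assoc]
    exact mul_le_mul_of_nonneg_left (hM r hr).1 (abs_nonneg c)
  · rw [show c * w₁ r + r * (c * w r) = c * (w₁ r + r * w r) by ring, abs_mul, mul_assoc]
    exact mul_le_mul_of_nonneg_left (hM r hr).2 (abs_nonneg c)

theorem IsDecayingSolution.sub {d lam ε : ℝ} {F F' w w₁ w' w₁' : ℝ → ℝ}
    (h : IsDecayingSolution d lam ε F w w₁) (h' : IsDecayingSolution d lam ε F' w' w₁') :
    IsDecayingSolution d lam ε (fun r => F r - F' r) (fun r => w r - w' r)
      (fun r => w₁ r - w₁' r) := by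
  obtain ⟨M, hM⟩ := h.decay
  obtain ⟨M', hM'⟩ := h'.decay
  refine ⟨fun r hr => (h.hasDerivAt r hr).sub (h'.hasDerivAt r hr), fun r hr =>
    ((h.hasDerivAt' r hr).sub (h'.hasDerivAt' r hr)).congr_deriv (by ring),
    M + M', fun r hr => ⟨?_, ?_⟩⟩
  · rw [add_mul]
    exact (abs_sub _ _).trans (add_le_add (hM r hr).1 (hM' r hr).1)
  · rw [add_mul, show w₁ r - w₁' r + r * (w r - w' r) =
      (w₁ r + r * w r) - (w₁' r + r * w' r) by ring]
    exact (abs_sub _ _).trans (add_le_add (hM r hr).2 (hM' r hr).2)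

/-- A solution for the parameter `ε'` solves the equation with parameter `ε` up to first order
terms. -/
theorem IsDecayingSolution.change_parameter {d lam ε : ℝ} {F w w₁ : ℝ → ℝ} (ε' : ℝ)
    (h : IsDecayingSolution d lam ε F w w₁) :
    IsDecayingSolution d lam ε' (fun r => F r + (ε - ε') * (w₁ r / r + w r)) w w₁ :=
  ⟨h.hasDerivAt, fun r hr => (h.hasDerivAt' r hr).congr_deriv (by field_simp; ring), h.decay⟩

theorem IsDecayingSolution.continuousOn {d lam ε : ℝ} {F w w₁ : ℝ → ℝ}
    (h : IsDecayingSolution d lam ε F w w₁) : ContinuousOn w (Ioi 0) :=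
  fun r hr => (h.hasDerivAt r hr).continuousAt.continuousWithinAt

theorem IsDecayingSolution.continuousOn' {d lam ε : ℝ} {F w w₁ : ℝ → ℝ}
    (h : IsDecayingSolution d lam ε F w w₁) : ContinuousOn w₁ (Ioi 0) :=
  fun r hr => (h.hasDerivAt' r hr).continuousAt.continuousWithinAt

/-- Passing from the gauged equation to the radial one. -/
theorem hasDerivAt_gauge {d lam ε : ℝ} {g h : ℝ → ℝ} {J r : ℝ} (hr : 0 < r)
    (hg : HasDerivAt g (h r) r)
    (hh : HasDerivAt h ((2 * r - (lam + ε - 1) / r) * h r - J) r) :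
    HasDerivAt (fun r => gaussianTail d lam r * g r)
        (gaussianTail d lam r * (h r + (-r + (lam - d) / 2 / r) * g r)) r ∧
      HasDerivAt (fun r => gaussianTail d lam r * (h r + (-r + (lam - d) / 2 / r) * g r))
        (-((d + ε - 1) / r) * (gaussianTail d lam r * (h r + (-r + (lam - d) / 2 / r) * g r))
          + (r ^ 2 - lam - ε) * (gaussianTail d lam r * g r)
          - gaussianTail d lam r * (J - (lam - d) / 2 * ((lam - d) / 2 + d + ε - 2)
            * (r ^ 2)⁻¹ * g r)) r := by
  have hG := hasDerivAt_gaussianTail d lam hr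
  have hi : HasDerivAt (fun r : ℝ => -r + (lam - d) / 2 / r)
      (-1 + (lam - d) / 2 * (-(r ^ 2)⁻¹)) r := by
    exact ((hasDerivAt_id r).neg).add ((hasDerivAt_inv hr.ne').const_mul ((lam - d) / 2))
  constructor
  · exact (hG.mul hg).congr_deriv (by ring)
  · refine (hG.mul (hh.add (hi.mul hg))).congr_deriv ?_
    simp only [Pi.add_apply, Pi.mul_apply]
    field_simp
    ring

theorem exp_neg_half_le_gaussianTail {d lam r : ℝ} (hlam : lam ≤ d) (hr : 0 < r) (hr1 : r ≤ 1) :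
    Real.exp (-1 / 2) ≤ gaussianTail d lam r := by
  have h1 : Real.exp (-1 / 2) ≤ Real.exp (-(r ^ 2) / 2) := by
    apply Real.exp_le_exp.mpr; nlinarith
  have h2 : 1 ≤ r ^ ((lam - d) / 2) :=
    Real.one_le_rpow_of_pos_of_le_one_of_nonpos hr hr1 (by linarith)
  calc Real.exp (-1 / 2) = Real.exp (-1 / 2) * 1 := (mul_one _).symm
    _ ≤ _ := mul_le_mul h1 h2 zero_le_one (Real.exp_pos _).le

/-- Solvability of semilinear radial equations with inverse square Lipschitz constant, with
fast decay at infinity. -/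
theorem exists_isDecayingSolution {d lam ε B B₀ : ℝ} {n : ℕ} {H : ℝ → ℝ → ℝ} (hlam : lam ≤ d)
    (hH : ContinuousOn (fun z : ℝ × ℝ => H z.1 z.2) (Ioi 0 ×ˢ univ))
    (hL : ∀ r, 0 < r → ∀ x y, |H r x - H r y| ≤ B * (r ^ 2)⁻¹ * |x - y|)
    (hinf : ∀ r, 1 ≤ r → |H r 0| ≤ B₀ * (gaussianTail d lam r * (r ^ 2)⁻¹))
    (hzero : ∀ r, 0 < r → r ≤ 1 → |H r 0| ≤ B₀ * ((r ^ 2)⁻¹) ^ n) :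
    ∃ w w₁, IsDecayingSolution d lam ε (fun r => H r (w r)) w w₁ := by
  set c := (lam - d) / 2 * ((lam - d) / 2 + d + ε - 2) with hc
  have hB₀ : 0 ≤ B₀ := by
    have := (abs_nonneg _).trans (hzero 1 one_pos le_rfl)
    simpa using this
  obtain ⟨g, h, M, N, hgh⟩ := exists_decaying_gauged_solution (ν := lam + ε - 1)
    (B := B + |c|) (B₀ := B₀ * Real.exp (1 / 2)) (n := n)
    (J := fun r x => H r (gaussianTail d lam r * x) / gaussianTail d lam r + c * (r ^ 2)⁻¹ * x)
    (by
      have hGc : ContinuousOn (fun z : ℝ × ℝ => gaussianTail d lam z.1) (Ioi 0 ×ˢ univ) :=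
        (continuousOn_gaussianTail d lam).comp continuousOn_fst fun z hz => hz.1
      refine ((hH.comp (continuousOn_fst.prodMk (hGc.mul continuousOn_snd))
        fun z hz => ⟨hz.1, mem_univ _⟩).div hGc
        fun z hz => (gaussianTail_pos d lam hz.1).ne').add ?_
      refine (continuousOn_const.mul ((continuousOn_fst.pow 2).inv₀ fun z hz => ?_)).mul
        continuousOn_snd
      exact pow_ne_zero 2 (ne_of_gt hz.1))
    (by
      intro r hr x y
      have hG := gaussianTail_pos d lam hr
      have h1 := hL r hr (gaussianTail d lam r * x) (gaussianTail d lam r * y)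
      rw [← mul_sub, abs_mul, abs_of_pos hG] at h1
      have h2 : H r (gaussianTail d lam r * x) / gaussianTail d lam r + c * (r ^ 2)⁻¹ * x -
          (H r (gaussianTail d lam r * y) / gaussianTail d lam r + c * (r ^ 2)⁻¹ * y) =
          (H r (gaussianTail d lam r * x) - H r (gaussianTail d lam r * y)) /
            gaussianTail d lam r + c * ((r ^ 2)⁻¹ * (x - y)) := by ring
      rw [h2]
      refine (abs_add_le _ _).trans ?_
      rw [abs_div, abs_of_pos hG, abs_mul c, abs_mul (r ^ 2)⁻¹,
        abs_of_pos (by positivity : 0 < (r ^ 2)⁻¹)]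
      have h3 : |H r (gaussianTail d lam r * x) - H r (gaussianTail d lam r * y)| /
          gaussianTail d lam r ≤ B * (r ^ 2)⁻¹ * |x - y| := by
        rw [div_le_iff₀ hG]
        linarith
      linarith)
    (by
      intro r hr
      have hG := gaussianTail_pos d lam hr
      simp only [mul_zero, add_zero]
      rw [abs_div, abs_of_pos hG, div_le_iff₀ hG]
      have he : 1 ≤ Real.exp (1 / 2) := Real.one_le_exp (by norm_num)
      have hi : 0 < (r ^ 2)⁻¹ := by positivity
      rcases le_total 1 r with h1 | h1
      · refine (hinf r h1).trans ?_
        have := one_le_originWeight n r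
        calc B₀ * (gaussianTail d lam r * (r ^ 2)⁻¹)
            = B₀ * 1 * (r ^ 2)⁻¹ * 1 * gaussianTail d lam r := by ring
          _ ≤ _ := by gcongr
      · refine (hzero r hr h1).trans ?_
        have hGl := exp_neg_half_le_gaussianTail hlam hr h1
        have hone : 1 ≤ Real.exp (1 / 2) * gaussianTail d lam r := by
          calc (1 : ℝ) = Real.exp (1 / 2) * Real.exp (-1 / 2) := by
                rw [← Real.exp_add]; norm_num
            _ ≤ _ := by gcongr
        have hi1 : 1 ≤ (r ^ 2)⁻¹ := (one_le_inv₀ (by positivity)).mpr (by nlinarith)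
        have hpow : ((r ^ 2)⁻¹) ^ n ≤ originWeight n r :=
          pow_le_pow_left₀ hi.le (by linarith) n
        have hw := originWeight_pos n r
        calc B₀ * ((r ^ 2)⁻¹) ^ n ≤ B₀ * originWeight n r := by gcongr
          _ = B₀ * 1 * 1 * originWeight n r := by ring
          _ ≤ B₀ * (Real.exp (1 / 2) * gaussianTail d lam r) * (r ^ 2)⁻¹ * originWeight n r := by
              gcongr
          _ = _ := by ring)
  refine ⟨fun r => gaussianTail d lam r * g r,
    fun r => gaussianTail d lam r * (h r + (-r + (lam - d) / 2 / r) * g r), ?_, ?_, ?_⟩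
  · intro r hr
    exact (hasDerivAt_gauge (d := d) hr (hgh r hr).1 (hgh r hr).2.1).1
  · intro r hr
    have hG := gaussianTail_pos d lam hr
    refine (hasDerivAt_gauge (d := d) hr (hgh r hr).1 (hgh r hr).2.1).2.congr_deriv ?_
    rw [← hc]
    field_simp
    ring
  · have hM : 0 ≤ M := by
      have h1 := (abs_nonneg _).trans (hgh 1 one_pos).2.2.2
      have h2 := originWeight_pos N 1
      by_contra hneg
      have : M * (originWeight N 1 / (1 * (1 + 1 ^ 2))) < 0 :=
        mul_neg_of_neg_of_pos (not_le.mp hneg) (by positivity)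
      linarith
    refine ⟨M * 2 ^ N * (1 + |(lam - d) / 2|), fun r hr => ?_⟩
    have hr0 : 0 < r := by linarith
    have hG := gaussianTail_pos d lam hr0
    have hgb : |g r| ≤ M * 2 ^ N * (r ^ 2)⁻¹ := by
      refine (hgh r hr0).2.2.1.trans ?_
      rw [mul_assoc]
      exact mul_le_mul_of_nonneg_left (originWeight_sub_one_le N hr) hM
    have hhb : |h r| ≤ M * 2 ^ N * (r ^ 3)⁻¹ := by
      refine (hgh r hr0).2.2.2.trans ?_
      rw [mul_assoc]
      apply mul_le_mul_of_nonneg_left _ hM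
      rw [div_eq_mul_inv]
      apply mul_le_mul (originWeight_le N hr) _ (by positivity) (by positivity)
      apply inv_anti₀ (by positivity)
      nlinarith
    constructor
    · rw [abs_mul, abs_of_pos hG]
      calc gaussianTail d lam r * |g r| ≤ gaussianTail d lam r * (M * 2 ^ N * (r ^ 2)⁻¹) := by
            gcongr
        _ = M * 2 ^ N * 1 * (gaussianTail d lam r * (r ^ 2)⁻¹) := by ring
        _ ≤ _ := by gcongr; have := abs_nonneg ((lam - d) / 2); linarith
    · have e : gaussianTail d lam r * (h r + (-r + (lam - d) / 2 / r) * g r) +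
          r * (gaussianTail d lam r * g r) =
          gaussianTail d lam r * (h r + (lam - d) / 2 * (r⁻¹ * g r)) := by ring
      rw [e, abs_mul, abs_of_pos hG]
      have : |h r + (lam - d) / 2 * (r⁻¹ * g r)| ≤
          M * 2 ^ N * (r ^ 3)⁻¹ + |(lam - d) / 2| * (r⁻¹ * (M * 2 ^ N * (r ^ 2)⁻¹)) := by
        refine (abs_add_le _ _).trans (add_le_add hhb ?_)
        rw [abs_mul, abs_mul, abs_of_pos (inv_pos.mpr hr0)]
        gcongr
      calc _ ≤ gaussianTail d lam r * (M * 2 ^ N * (r ^ 3)⁻¹ +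
            |(lam - d) / 2| * (r⁻¹ * (M * 2 ^ N * (r ^ 2)⁻¹))) := by gcongr
        _ = _ := by field_simp

/-- Decaying solutions of the linear equation are controlled by the source term for `r ≥ 1`,
uniformly in the parameter. -/
theorem bound_at_infinity (d lam B : ℝ) (hB : 0 ≤ B) {P : ℝ → ℝ}
    (hP : ∀ r, 1 ≤ r → |P r| ≤ B * (r ^ 2)⁻¹) :
    ∃ C, 0 < C ∧ ∀ (ε Y : ℝ) (F w w₁ : ℝ → ℝ), |ε| ≤ 1 → 0 ≤ Y →
      IsDecayingSolution d lam ε (fun r => P r * w r + F r) w w₁ →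
      (∀ r, 1 ≤ r → |F r| ≤ Y * (gaussianTail d lam r * (r ^ 2)⁻¹)) →
      ∀ r, 1 ≤ r → |w r| ≤ C * Y * (gaussianTail d lam r * (r ^ 2)⁻¹) ∧
        |w₁ r| ≤ C * Y * (gaussianTail d lam r * r⁻¹) := by
  set m := (lam - d) / 2 with hm
  obtain ⟨C, hC, hmain⟩ := gauged_bound_at_infinity (|lam| + 2)
    (B + |m| * (|m| + |d| + 3)) (by positivity) (by positivity)
  refine ⟨C * (2 + |m|), by positivity, fun ε Y F w w₁ hε hY hw hF r hr => ?_⟩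
  obtain ⟨M, hM⟩ := hw.decay
  have hM0 : 0 ≤ M := by
    have h1 := (abs_nonneg _).trans (hM 1 le_rfl).1
    have h2 := gaussianTail_pos d lam one_pos
    by_contra hneg
    have : M * (gaussianTail d lam 1 * (1 ^ 2)⁻¹) < 0 :=
      mul_neg_of_neg_of_pos (not_le.mp hneg) (by positivity)
    linarith
  set G := gaussianTail d lam with hGdef
  have hG : ∀ r, 1 ≤ r → 0 < G r := fun r hr => gaussianTail_pos d lam (by linarith)
  let g : ℝ → ℝ := fun r => w r / G r
  let h : ℝ → ℝ := fun r => w₁ r / G r - (-r + m / r) * g r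
  let c := m * (m + d + ε - 2)
  let J : ℝ → ℝ := fun r => (P r * w r + F r) / G r + c * (r ^ 2)⁻¹ * g r
  have hg : ∀ r, 1 ≤ r → HasDerivAt g (h r) r := by
    intro r hr
    have hr0 : 0 < r := by linarith
    have hG0 := (hG r hr).ne'
    refine ((hw.hasDerivAt r hr0).div (hasDerivAt_gaussianTail d lam hr0) hG0).congr_deriv ?_
    simp only [h, g, ← hm, ← hGdef]
    field_simp
  have hh : ∀ r, 1 ≤ r → HasDerivAt h ((2 * r - (lam + ε - 1) / r) * h r - J r) r := by
    intro r hr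
    have hr0 : 0 < r := by linarith
    have hG0 := (hG r hr).ne'
    have hi : HasDerivAt (fun r : ℝ => -r + m / r) (-1 + m * (-(r ^ 2)⁻¹)) r := by
      exact ((hasDerivAt_id r).neg).add ((hasDerivAt_inv hr0.ne').const_mul m)
    refine (((hw.hasDerivAt' r hr0).div (hasDerivAt_gaussianTail d lam hr0) hG0).sub
      (hi.mul (hg r hr))).congr_deriv ?_
    simp only [h, g, J, c, ← hm, ← hGdef]
    have hlam : lam = 2 * m + d := by rw [hm]; ring
    rw [hlam]
    field_simp
    ring
  have hcb : |c| ≤ |m| * (|m| + |d| + 3) := by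
    simp only [c]
    rw [abs_mul]
    gcongr
    have h1 := abs_sub (m + d + ε) 2
    have h2 := abs_add_le (m + d) ε
    have h3 := abs_add_le m d
    rw [abs_two] at h1
    linarith
  have hgw : ∀ r, 1 ≤ r → ∀ A x i, |x| ≤ A * (G r * i) → |x / G r| ≤ A * i := by
    intro r hr A x i hx
    rw [abs_div, abs_of_pos (hG r hr), div_le_iff₀ (hG r hr)]
    linarith
  have hgM : ∀ r, 1 ≤ r → |g r| ≤ M * (r ^ 2)⁻¹ := fun r hr => hgw r hr _ _ _ (hM r hr).1
  have hhM : ∀ r, 1 ≤ r → |h r| ≤ (M * (1 + |m|)) * (r ^ 3)⁻¹ := by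
    intro r hr
    have hr0 : 0 < r := by linarith
    have e : h r = (w₁ r + r * w r) / G r - m * (r⁻¹ * g r) := by
      simp only [h, g]
      have hG0 := (hG r hr).ne'
      field_simp
      ring
    rw [e]
    refine (abs_sub _ _).trans ?_
    have h1 := hgw r hr _ _ _ (hM r hr).2
    have h2 : |m * (r⁻¹ * g r)| ≤ |m| * (r⁻¹ * (M * (r ^ 2)⁻¹)) := by
      rw [abs_mul, abs_mul, abs_of_pos (inv_pos.mpr hr0)]
      gcongr
      exact hgM r hr
    calc _ ≤ M * (r ^ 3)⁻¹ + |m| * (r⁻¹ * (M * (r ^ 2)⁻¹)) := add_le_add h1 h2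
      _ = _ := by field_simp
  have hJ : ∀ r, 1 ≤ r → |J r| ≤ ((B + |m| * (|m| + |d| + 3)) * |g r| + Y) * (r ^ 2)⁻¹ := by
    intro r hr
    have hr0 : 0 < r := by linarith
    have e : J r = P r * g r + F r / G r + c * ((r ^ 2)⁻¹ * g r) := by
      simp only [J, g]; ring
    rw [e]
    have h1 : |P r * g r| ≤ B * (r ^ 2)⁻¹ * |g r| := by
      rw [abs_mul]; gcongr; exact hP r hr
    have h2 := hgw r hr _ _ _ (hF r hr)
    have h3 : |c * ((r ^ 2)⁻¹ * g r)| ≤ (|m| * (|m| + |d| + 3)) * ((r ^ 2)⁻¹ * |g r|) := by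
      rw [abs_mul c, abs_mul (r ^ 2)⁻¹, abs_of_pos (by positivity : 0 < (r ^ 2)⁻¹)]
      gcongr
    have h4 := abs_add_le (P r * g r + F r / G r) (c * ((r ^ 2)⁻¹ * g r))
    have h5 := abs_add_le (P r * g r) (F r / G r)
    linarith
  have hν : |lam + ε - 1| ≤ |lam| + 2 := by
    have h1 := abs_sub (lam + ε) 1
    have h2 := abs_add_le lam ε
    rw [abs_one] at h1
    linarith
  have hgM' : ∀ r, 1 ≤ r → |g r| ≤ (M * (1 + |m|)) * (r ^ 2)⁻¹ := fun r hr =>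
    (hgM r hr).trans (by
      have : M ≤ M * (1 + |m|) := le_mul_of_one_le_right hM0 (by have := abs_nonneg m; linarith)
      gcongr)
  have hfin := hmain (lam + ε - 1) Y (M * (1 + |m|)) g h J hν hY hg hh hJ hgM' hhM r hr
  have hr0 : 0 < r := by linarith
  have hG0 := hG r hr
  have hw' : w r = G r * g r := by simp only [g]; field_simp
  have hw₁' : w₁ r = G r * (h r + (-r + m / r) * g r) := by
    simp only [h]; field_simp; ring
  have hm0 := abs_nonneg m
  constructor
  · rw [hw', abs_mul, abs_of_pos hG0]
    calc G r * |g r| ≤ G r * (C * Y * (r ^ 2)⁻¹) := by gcongr; exact hfin.1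
      _ = C * 1 * Y * (G r * (r ^ 2)⁻¹) := by ring
      _ ≤ _ := by gcongr; linarith
  · rw [hw₁', abs_mul, abs_of_pos hG0]
    have hr1 : (r ^ 3)⁻¹ ≤ r⁻¹ := by
      apply inv_anti₀ hr0
      nlinarith [mul_le_mul hr hr zero_le_one hr0.le]
    have hb : |(-r + m / r) * g r| ≤ (1 + |m|) * r * (C * Y * (r ^ 2)⁻¹) := by
      rw [abs_mul]
      apply mul_le_mul _ hfin.1 (abs_nonneg _) (by positivity)
      refine (abs_add_le _ _).trans ?_
      rw [abs_neg, abs_div, abs_of_pos hr0]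
      have : |m| / r ≤ |m| * r := by
        rw [div_le_iff₀ hr0]; nlinarith [mul_le_mul hr hr zero_le_one hr0.le]
      linarith
    calc G r * |h r + (-r + m / r) * g r|
        ≤ G r * (C * Y * (r ^ 3)⁻¹ + (1 + |m|) * r * (C * Y * (r ^ 2)⁻¹)) := by
          gcongr
          exact (abs_add_le _ _).trans (add_le_add hfin.2 hb)
      _ ≤ G r * (C * Y * r⁻¹ + (1 + |m|) * r * (C * Y * (r ^ 2)⁻¹)) := by gcongr
      _ = _ := by field_simp; ring

/-! ### The energy estimate near the origin -/

theorem le_of_deriv_nonneg_Icc {f f' : ℝ → ℝ} {a b : ℝ}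
    (hd : ∀ r ∈ Icc a b, HasDerivAt f (f' r) r) (hpos : ∀ r ∈ Icc a b, 0 ≤ f' r)
    {r : ℝ} (hr : r ∈ Icc a b) : f r ≤ f b := by
  have hmono : MonotoneOn f (Icc a b) := by
    refine monotoneOn_of_deriv_nonneg (convex_Icc a b)
      (fun x hx => (hd x hx).continuousAt.continuousWithinAt) ?_ ?_
    · intro x hx
      exact (hd x (interior_subset hx)).differentiableAt.differentiableWithinAt
    · intro x hx
      rw [(hd x (interior_subset hx)).deriv]
      exact hpos x (interior_subset hx)
  exact hmono hr ⟨hr.1.trans hr.2, le_rfl⟩ hr.2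

/-- The integral of `τ^(α-1)` over `[r, 1]`, for either sign of `α`. -/
def powerTail (α r : ℝ) : ℝ := (1 - r ^ α) / α

theorem hasDerivAt_powerTail {α r : ℝ} (hα : α ≠ 0) (hr : 0 < r) :
    HasDerivAt (powerTail α) (-(r ^ α / r)) r := by
  have := ((Real.hasDerivAt_rpow_const (p := α) (Or.inl hr.ne')).const_sub 1).div_const α
  refine this.congr_deriv ?_
  rw [Real.rpow_sub_one hr.ne']
  field_simp

theorem powerTail_nonneg {α r : ℝ} (hr : 0 < r) (hr1 : r ≤ 1) : 0 ≤ powerTail α r := by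
  unfold powerTail
  rcases le_total 0 α with h | h
  · exact div_nonneg (by have := Real.rpow_le_one hr.le hr1 h; linarith) h
  · exact div_nonneg_of_nonpos
      (by have := Real.one_le_rpow_of_pos_of_le_one_of_nonpos hr hr1 h; linarith) h

theorem powerTail_anti {α r s : ℝ} (hα : α ≠ 0) (hr : 0 < r) (hrs : r ≤ s) :
    powerTail α s ≤ powerTail α r := by
  unfold powerTail
  rcases lt_or_gt_of_ne hα with h | h
  · have := Real.rpow_le_rpow_of_nonpos hr hrs h.le
    rw [div_le_div_right_of_neg h]; linarith
  · have := Real.rpow_le_rpow hr.le hrs h.le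
    rw [div_le_div_iff_of_pos_right h]; linarith

set_option maxHeartbeats 1000000 in
/-- Oscillatory energy estimate: when the linearised potential is `(ω² + ((d-2)/2)²) / r²` up to
an integrable error, solutions stay of size `r^(-(d-2)/2)` on `[rs, 1]` as long as
`|ε| log (1/rs) ≤ 1`. -/
theorem energy_bound {d lam κ ω B : ℝ} (hκ : 0 < κ) (hκ2 : κ ≤ 2) (hω : 0 < ω) (hB : 0 ≤ B)
    {P : ℝ → ℝ}
    (hP : ∀ r, 0 < r → r ≤ 1 → |r ^ 2 * P r - (ω ^ 2 + ((d - 2) / 2) ^ 2)| ≤ B * r ^ κ) :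
    ∃ C, 0 < C ∧ ∀ (ε rs Y A α : ℝ) (F w w₁ : ℝ → ℝ), |ε| ≤ 1 → 0 < rs → rs ≤ 1 →
      |ε| * -Real.log rs ≤ 1 → α ≠ 0 → 0 ≤ Y → 0 < A →
      (∀ r, 0 < r → HasDerivAt w (w₁ r) r) →
      (∀ r, 0 < r → HasDerivAt w₁
        (-((d + ε - 1) / r) * w₁ r + (r ^ 2 - lam - ε) * w r - (P r * w r + F r)) r) →
      (∀ r, rs ≤ r → r ≤ 1 → r ^ ((d - 2) / 2) * (r ^ 2 * |F r|) ≤ Y * r ^ α) →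
      |w 1| ≤ A → |w₁ 1| ≤ A →
      ∀ r, rs ≤ r → r ≤ 1 →
        r ^ ((d - 2) / 2) * |w r| ≤ C * (A + Y * powerTail α rs) ∧
        r ^ ((d - 2) / 2) * (r * |w₁ r|) ≤ C * (A + Y * powerTail α rs) := by
  set β := (d - 2) / 2 with hβ
  set B₁ := B + 2 + |lam| with hB₁
  have hB₁0 : 0 ≤ B₁ := by positivity
  set c₁ := 2 + |β| / ω with hc₁
  set c₂ := c₁ + B₁ / ω / κ + 1 with hc₂
  set S := 1 + |β| + ω with hS
  have hS1 : 1 ≤ S := by rw [hS]; have := abs_nonneg β; linarith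
  set C₃ := Real.sqrt (2 * Real.exp c₂) with hC₃
  have hC₃0 : 0 < C₃ := Real.sqrt_pos.mpr (by positivity)
  refine ⟨C₃ * S * (1 + 1 / ω + |β| / ω), by positivity, ?_⟩
  intro ε rs Y A α F w w₁ hε hrs hrs1 hlog hα hY hA hw hw₁ hF hwA hw₁A r hr hr1
  have hr0 : 0 < r := hrs.trans_le hr
  set ζ := powerTail α with hζ
  have hζrs : 0 ≤ ζ rs := powerTail_nonneg hrs hrs1
  -- `Z` is the expected size of the solution; it normalises the source in the energy inequality
  set Z := S * A + Y * ζ rs with hZ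
  have hZ0 : 0 < Z := by positivity
  -- Emden-Fowler variables: as functions of `log r`, `z' = y` and `y' = -ω² z + e`, where the
  -- error `e` is small or integrable
  obtain ⟨z, dz⟩ : ∃ z : ℝ → ℝ, z = fun r => r ^ β * w r := ⟨_, rfl⟩
  obtain ⟨y, dy⟩ : ∃ y : ℝ → ℝ, y = fun r => r ^ β * (r * w₁ r + β * w r) := ⟨_, rfl⟩
  obtain ⟨f, df⟩ : ∃ f : ℝ → ℝ, f = fun r => r ^ β * (r ^ 2 * F r) := ⟨_, rfl⟩
  obtain ⟨e, de⟩ : ∃ e : ℝ → ℝ, e = fun r => -(ε * y r) + (ε * β + (ω ^ 2 + β ^ 2 - r ^ 2 * P r)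
    + r ^ 2 * (r ^ 2 - lam - ε)) * z r - f r := ⟨_, rfl⟩
  have hz : ∀ r, 0 < r → HasDerivAt z (y r / r) r := by
    intro r hr
    rw [dz]
    refine ((Real.hasDerivAt_rpow_const (p := β) (Or.inl hr.ne')).mul (hw r hr)).congr_deriv ?_
    simp only [dy]
    rw [Real.rpow_sub_one hr.ne']
    field_simp
    ring
  have hy : ∀ r, 0 < r → HasDerivAt y ((-(ω ^ 2 * z r) + e r) / r) r := by
    intro r hr
    rw [dy]
    refine ((Real.hasDerivAt_rpow_const (p := β) (Or.inl hr.ne')).mul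
      (((hasDerivAt_id r).mul (hw₁ r hr)).add ((hw r hr).const_mul β))).congr_deriv ?_
    simp only [dz, de, df, dy, id, Pi.add_apply, Pi.mul_apply]
    rw [Real.rpow_sub_one hr.ne']
    have hd : d = 2 * β + 2 := by rw [hβ]; ring
    rw [hd]
    field_simp
    ring
  -- the energy of the harmonic oscillator
  obtain ⟨E, dE⟩ : ∃ E : ℝ → ℝ, E = fun r => y r ^ 2 + ω ^ 2 * z r ^ 2 := ⟨_, rfl⟩
  have hE : ∀ r, 0 < r → HasDerivAt E (2 * y r * e r / r) r := by
    intro r hr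
    rw [dE]
    refine (((hy r hr).pow 2).add (((hz r hr).pow 2).const_mul (ω ^ 2))).congr_deriv ?_
    field_simp
    norm_num
    ring
  have hE0 : ∀ r, 0 ≤ E r := fun r => by rw [dE]; positivity
  have hfb : ∀ r, rs ≤ r → r ≤ 1 → |f r| ≤ Y * r ^ α := by
    intro r hr hr1
    have hr0 : 0 < r := hrs.trans_le hr
    simp only [df]
    rw [abs_mul, abs_mul, abs_of_pos (Real.rpow_pos_of_pos hr0 _),
      abs_of_pos (by positivity : 0 < r ^ 2)]
    exact hF r hr hr1
  have hder : ∀ r, rs ≤ r → r ≤ 1 →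
      -(2 * y r * e r) ≤ (c₁ * |ε| + B₁ / ω * r ^ κ + Y / Z * r ^ α) * E r + Z * (Y * r ^ α) := by
    intro r hr hr1
    have hr0 : 0 < r := hrs.trans_le hr
    have hyz : |y r| * |z r| ≤ E r / (2 * ω) := by
      rw [le_div_iff₀ (by positivity)]
      simp only [dE]
      rw [← sq_abs (y r), ← sq_abs (z r)]
      have := sq_nonneg (|y r| - ω * |z r|)
      linarith
    have hyy : |y r| ^ 2 ≤ E r := by
      simp only [dE]
      rw [sq_abs]
      have : 0 ≤ ω ^ 2 * z r ^ 2 := by positivity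
      linarith
    have hrκ : r ^ 2 ≤ r ^ κ := by
      rw [← Real.rpow_natCast r 2]
      exact Real.rpow_le_rpow_of_exponent_ge hr0 hr1 (by exact_mod_cast hκ2)
    have hcoef : |ε * β + (ω ^ 2 + β ^ 2 - r ^ 2 * P r) + r ^ 2 * (r ^ 2 - lam - ε)| ≤
        |ε| * |β| + B₁ * r ^ κ := by
      have h1 : |r ^ 2 * (r ^ 2 - lam - ε)| ≤ (2 + |lam|) * r ^ κ := by
        rw [abs_mul, abs_of_pos (by positivity : 0 < r ^ 2), mul_comm]
        apply mul_le_mul _ hrκ (by positivity) (by positivity)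
        have h2 := abs_sub (r ^ 2 - lam) ε
        have h3 := abs_sub (r ^ 2) lam
        rw [abs_of_pos (by positivity : 0 < r ^ 2)] at h3
        have h4 : r ^ 2 ≤ 1 := pow_le_one₀ hr0.le hr1
        linarith
      have h2 : |ω ^ 2 + β ^ 2 - r ^ 2 * P r| ≤ B * r ^ κ := by
        rw [abs_sub_comm]; exact hP r hr0 hr1
      have h3 := abs_add_le (ε * β + (ω ^ 2 + β ^ 2 - r ^ 2 * P r)) (r ^ 2 * (r ^ 2 - lam - ε))
      have h4 := abs_add_le (ε * β) (ω ^ 2 + β ^ 2 - r ^ 2 * P r)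
      rw [abs_mul ε β] at h4
      rw [hB₁]
      linarith
    have he : |e r| ≤ |ε| * |y r| + (|ε| * |β| + B₁ * r ^ κ) * |z r| + Y * r ^ α := by
      simp only [de]
      refine (abs_sub _ _).trans (add_le_add ?_ (hfb r hr hr1))
      refine (abs_add_le _ _).trans (add_le_add ?_ ?_)
      · rw [abs_neg, abs_mul]
      · rw [abs_mul]; gcongr
    have hrκ0 : 0 < r ^ κ := Real.rpow_pos_of_pos hr0 _
    have hrα0 : 0 < r ^ α := Real.rpow_pos_of_pos hr0 _
    have hYr : 0 ≤ Y * r ^ α := by positivity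
    calc -(2 * y r * e r) ≤ |2 * y r * e r| := neg_le_abs _
      _ = 2 * |y r| * |e r| := by rw [abs_mul, abs_mul, abs_two]
      _ ≤ 2 * |y r| * (|ε| * |y r| + (|ε| * |β| + B₁ * r ^ κ) * |z r| + Y * r ^ α) := by gcongr
      _ = 2 * |ε| * |y r| ^ 2 + 2 * (|ε| * |β| + B₁ * r ^ κ) * (|y r| * |z r|)
          + 2 * |y r| * (Y * r ^ α) := by ring
      _ ≤ 2 * |ε| * E r + 2 * (|ε| * |β| + B₁ * r ^ κ) * (E r / (2 * ω))
          + (E r / Z + Z) * (Y * r ^ α) := by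
          have h5 : 2 * |y r| ≤ E r / Z + Z := by
            have : 2 * |y r| ≤ |y r| ^ 2 / Z + Z := by
              rw [← sub_nonneg]
              have : |y r| ^ 2 / Z + Z - 2 * |y r| = (|y r| - Z) ^ 2 / Z := by
                field_simp; ring
              rw [this]; positivity
            have h6 : |y r| ^ 2 / Z ≤ E r / Z := by gcongr
            linarith
          have := abs_nonneg ε
          gcongr
      _ = _ := by rw [hc₁]; field_simp; ring
  -- `exp K` is the integrating factor of the energy inequality. It is bounded below since the
  -- logarithmic term is at least `-c₁` by the condition `|ε| log (1/rs) ≤ 1`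
  obtain ⟨K, dK⟩ : ∃ K : ℝ → ℝ, K = fun r =>
    c₁ * |ε| * Real.log r - B₁ / ω * powerTail κ r - Y / Z * ζ r := ⟨_, rfl⟩
  have hK : ∀ r, 0 < r → HasDerivAt K
      ((c₁ * |ε| + B₁ / ω * r ^ κ + Y / Z * r ^ α) / r) r := by
    intro r hr
    rw [dK]
    refine ((((Real.hasDerivAt_log hr.ne').const_mul (c₁ * |ε|)).sub
      ((hasDerivAt_powerTail hκ.ne' hr).const_mul (B₁ / ω))).sub
      ((hasDerivAt_powerTail hα hr).const_mul (Y / Z))).congr_deriv ?_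
    field_simp
    ring
  have hc₁0 : 0 ≤ c₁ := by positivity
  have hK0 : ∀ r, rs ≤ r → r ≤ 1 → K r ≤ 0 := by
    intro r hr hr1
    have hr0 : 0 < r := hrs.trans_le hr
    have h1 : Real.log r ≤ 0 := Real.log_nonpos hr0.le hr1
    have h2 := powerTail_nonneg (α := κ) hr0 hr1
    have h3 := powerTail_nonneg (α := α) hr0 hr1
    have h4 : 0 ≤ B₁ / ω * powerTail κ r := by positivity
    have h5 : 0 ≤ Y / Z * ζ r := by positivity
    have h6 : c₁ * |ε| * Real.log r ≤ 0 :=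
      mul_nonpos_of_nonneg_of_nonpos (by positivity) h1
    simp only [dK]
    linarith
  have hKlow : -K r ≤ c₂ := by
    have h1 : -Real.log r ≤ -Real.log rs := by
      have := Real.log_le_log hrs hr; linarith
    have h2 : c₁ * (|ε| * -Real.log r) ≤ c₁ * 1 := by
      apply mul_le_mul_of_nonneg_left _ hc₁0
      exact (mul_le_mul_of_nonneg_left h1 (abs_nonneg ε)).trans hlog
    have h3 : powerTail κ r ≤ 1 / κ := by
      unfold powerTail
      gcongr
      have := Real.rpow_pos_of_pos hr0 κ
      linarith
    have h4 : B₁ / ω * powerTail κ r ≤ B₁ / ω * (1 / κ) := by gcongr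
    have h5 : Y / Z * ζ r ≤ 1 := by
      rw [div_mul_eq_mul_div, div_le_one hZ0, hZ]
      have : Y * ζ r ≤ Y * ζ rs := mul_le_mul_of_nonneg_left (powerTail_anti hα hrs hr) hY
      have : 0 ≤ S * A := by positivity
      linarith
    have h6 : B₁ / ω * (1 / κ) = B₁ / ω / κ := by ring
    simp only [dK]
    rw [hc₂]
    linarith
  have hmain := le_of_deriv_nonneg_Icc (a := rs) (b := 1)
    (f := fun r => E r * Real.exp (K r) - Z * Y * ζ r)
    (f' := fun r => (Real.exp (K r) * (2 * y r * e r +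
      (c₁ * |ε| + B₁ / ω * r ^ κ + Y / Z * r ^ α) * E r) + Z * (Y * r ^ α)) / r)
    (by
      intro r hr
      have hr0 : 0 < r := hrs.trans_le hr.1
      refine (((hE r hr0).mul (hK r hr0).exp).sub
        ((hasDerivAt_powerTail hα hr0).const_mul (Z * Y))).congr_deriv ?_
      field_simp
      ring)
    (by
      intro r hr
      have hr0 : 0 < r := hrs.trans_le hr.1
      have h1 := hder r hr.1 hr.2
      have h2 : Real.exp (K r) ≤ 1 := Real.exp_le_one_iff.mpr (hK0 r hr.1 hr.2)
      have h3 := Real.exp_pos (K r)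
      have h4 : 0 ≤ Z * (Y * r ^ α) := by
        have := Real.rpow_pos_of_pos hr0 α
        positivity
      apply div_nonneg _ hr0.le
      have h5 : Real.exp (K r) * (-(Z * (Y * r ^ α))) ≤ Real.exp (K r) * (2 * y r * e r +
          (c₁ * |ε| + B₁ / ω * r ^ κ + Y / Z * r ^ α) * E r) := by
        apply mul_le_mul_of_nonneg_left _ h3.le
        linarith
      have h6 := mul_le_mul_of_nonneg_right h2 h4
      linarith)
    (r := r) ⟨hr, hr1⟩
  have hζ1 : ζ 1 = 0 := by simp [hζ, powerTail]
  have hK1 : K 1 = 0 := by simp [dK, hζ1]; simp [powerTail]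
  simp only [hζ1, hK1, Real.exp_zero, mul_one, mul_zero, sub_zero] at hmain
  have hE1 : E 1 ≤ (S * A) ^ 2 := by
    have hy1 : |y 1| ≤ (1 + |β|) * A := by
      simp only [dy, Real.one_rpow, one_mul]
      refine (abs_add_le _ _).trans ?_
      rw [abs_mul]
      have := mul_le_mul_of_nonneg_left hwA (abs_nonneg β)
      linarith
    have hz1 : |z 1| ≤ A := by simpa [dz] using hwA
    have h1 : E 1 = |y 1| ^ 2 + (ω * |z 1|) ^ 2 := by
      simp only [dE]; rw [mul_pow, sq_abs, sq_abs]
    have h2 : |y 1| ^ 2 ≤ ((1 + |β|) * A) ^ 2 := pow_le_pow_left₀ (abs_nonneg _) hy1 2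
    have h3 : (ω * |z 1|) ^ 2 ≤ (ω * A) ^ 2 := by gcongr
    have h4 : 0 ≤ 2 * ((1 + |β|) * A) * (ω * A) := by positivity
    have h5 : ((1 + |β| + ω) * A) ^ 2 = ((1 + |β|) * A) ^ 2 + 2 * ((1 + |β|) * A) * (ω * A)
      + (ω * A) ^ 2 := by ring
    rw [h1, hS]
    linarith
  have hζr : ζ r ≤ ζ rs := powerTail_anti hα hrs hr
  have hEr : E r ≤ 2 * Real.exp c₂ * Z ^ 2 := by
    have h1 : E r * Real.exp (K r) ≤ 2 * Z ^ 2 := by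
      have h2 : Z * Y * ζ r ≤ Z * Z := by
        rw [mul_assoc]
        apply mul_le_mul_of_nonneg_left _ hZ0.le
        have := mul_le_mul_of_nonneg_left hζr hY
        have : 0 ≤ S * A := by positivity
        linarith
      have h3 : (S * A) ^ 2 ≤ Z ^ 2 := by
        apply pow_le_pow_left₀ (by positivity)
        have := mul_nonneg hY hζrs
        linarith
      linarith
    calc E r = E r * Real.exp (K r) * Real.exp (-K r) := by
          rw [mul_assoc, ← Real.exp_add]; simp
      _ ≤ 2 * Z ^ 2 * Real.exp c₂ := by gcongr
      _ = _ := by ring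
  have hsq : ∀ x : ℝ, x ^ 2 ≤ E r → |x| ≤ C₃ * Z := by
    intro x hx
    apply abs_le_of_sq_le_sq _ (by positivity)
    rw [mul_pow, hC₃, Real.sq_sqrt (by positivity)]
    exact hx.trans hEr
  have hyb : |y r| ≤ C₃ * Z := hsq _ (by
    simp only [dE]; have : 0 ≤ ω ^ 2 * z r ^ 2 := by positivity
    linarith)
  have hzb : |z r| ≤ C₃ * Z / ω := by
    rw [le_div_iff₀ hω]
    have := hsq (ω * z r) (by simp only [dE]; rw [mul_pow]; have := sq_nonneg (y r); linarith)
    rw [abs_mul, abs_of_pos hω] at this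
    linarith
  have hZS : Z ≤ S * (A + Y * ζ rs) := by
    rw [hZ]
    have : 0 ≤ Y * ζ rs := by positivity
    have := mul_le_mul_of_nonneg_right hS1 this
    linarith
  have hrβ := Real.rpow_pos_of_pos hr0 β
  have hfin : C₃ * Z * (1 + 1 / ω + |β| / ω) ≤
      C₃ * S * (1 + 1 / ω + |β| / ω) * (A + Y * ζ rs) := by
    calc _ ≤ C₃ * (S * (A + Y * ζ rs)) * (1 + 1 / ω + |β| / ω) := by gcongr
      _ = _ := by ring
  have hCZ : 0 < C₃ * Z := by positivity
  constructor
  · refine le_trans ?_ hfin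
    have : r ^ β * |w r| = |z r| := by simp only [dz]; rw [abs_mul, abs_of_pos hrβ]
    rw [this]
    calc |z r| ≤ C₃ * Z * (1 / ω) := by rw [mul_one_div]; exact hzb
      _ ≤ _ := by
        gcongr
        have : 0 ≤ |β| / ω := by positivity
        linarith
  · refine le_trans ?_ hfin
    have e1 : r ^ β * (r * |w₁ r|) = |y r - β * z r| := by
      have : y r - β * z r = r ^ β * (r * w₁ r) := by simp only [dy, dz]; ring
      rw [this, abs_mul, abs_mul, abs_of_pos hrβ, abs_of_pos hr0]
    rw [e1]
    refine (abs_sub _ _).trans ?_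
    rw [abs_mul]
    calc |y r| + |β| * |z r| ≤ C₃ * Z + |β| * (C₃ * Z / ω) := by gcongr
      _ = C₃ * Z * (1 + |β| / ω) := by ring
      _ ≤ _ := by
        gcongr
        have : 0 ≤ 1 / ω := by positivity
        linarith

/-! ### Differential inequalities on half-lines -/

theorem monotoneOn_Ici_of_hasDerivAt {f f' : ℝ → ℝ} {a : ℝ}
    (hd : ∀ s, a ≤ s → HasDerivAt f (f' s) s) (hpos : ∀ s, a ≤ s → 0 ≤ f' s) :
    MonotoneOn f (Ici a) := by
  refine monotoneOn_of_deriv_nonneg (convex_Ici a)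
    (fun x hx => (hd x hx).continuousAt.continuousWithinAt) ?_ ?_
  · intro x hx
    exact (hd x (interior_subset hx)).differentiableAt.differentiableWithinAt
  · intro x hx
    rw [(hd x (interior_subset hx)).deriv]
    exact hpos x (interior_subset hx)

/-- Gronwall: a solution of `D' ≥ γ D` grows at least like `exp (γ s)` times its initial value. -/
theorem exponential_growth {D D' : ℝ → ℝ} {γ a : ℝ}
    (hd : ∀ s, a ≤ s → HasDerivAt D (D' s) s) (h : ∀ s, a ≤ s → γ * D s ≤ D' s)
    {s : ℝ} (hs : a ≤ s) : D a * Real.exp (γ * (s - a)) ≤ D s := by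
  have hmono := monotoneOn_Ici_of_hasDerivAt (a := a)
    (f := fun s => D s * Real.exp (-(γ * (s - a))))
    (f' := fun s => Real.exp (-(γ * (s - a))) * (D' s - γ * D s))
    (by
      intro s hs
      have he : HasDerivAt (fun s => -(γ * (s - a))) (-(γ * 1)) s :=
        (((hasDerivAt_id s).sub_const a).const_mul γ).neg
      exact ((hd s hs).mul he.exp).congr_deriv (by ring))
    (fun s hs => mul_nonneg (Real.exp_pos _).le (by have := h s hs; linarith))
  have := hmono (self_mem_Ici) hs hs
  simp only [sub_self, mul_zero, neg_zero, Real.exp_zero, mul_one] at this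
  calc D a * Real.exp (γ * (s - a))
      ≤ D s * Real.exp (-(γ * (s - a))) * Real.exp (γ * (s - a)) := by gcongr
    _ = D s := by rw [mul_assoc, ← Real.exp_add]; simp

/-- A positive solution of `D' ≥ γ D` outgrows every slower exponential. -/
theorem nonpos_of_slow_growth {D D' : ℝ → ℝ} {γ μ C a : ℝ} (hμ : μ < γ)
    (hd : ∀ s, a ≤ s → HasDerivAt D (D' s) s) (h : ∀ s, a ≤ s → γ * D s ≤ D' s)
    (hC : ∀ s, a ≤ s → D s ≤ C * Real.exp (μ * s)) {s : ℝ} (hs : a ≤ s) : D s ≤ 0 := by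
  by_contra hneg
  have hpos : 0 < D s := not_le.mp hneg
  have hlim : Tendsto (fun t : ℝ => Real.exp ((γ - μ) * t)) atTop atTop :=
    Real.tendsto_exp_atTop.comp (tendsto_id.const_mul_atTop (by linarith))
  obtain ⟨t, ht1, ht2⟩ := ((hlim.eventually_gt_atTop (C * Real.exp (γ * s) / D s)).and
    (eventually_ge_atTop s)).exists
  have h1 := exponential_growth (fun t ht => hd t (hs.trans ht)) (fun t ht => h t (hs.trans ht)) ht2
  have h2 := hC t (hs.trans ht2)
  rw [div_lt_iff₀ hpos] at ht1
  have h3 : D s * Real.exp (γ * (t - s)) ≤ C * Real.exp (μ * t) := h1.trans h2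
  have h4 := mul_le_mul_of_nonneg_right h3 (Real.exp_pos (γ * s - μ * t)).le
  have e1 : D s * Real.exp (γ * (t - s)) * Real.exp (γ * s - μ * t) =
      Real.exp ((γ - μ) * t) * D s := by
    rw [mul_assoc, ← Real.exp_add, mul_comm]; congr 2; ring
  have e2 : C * Real.exp (μ * t) * Real.exp (γ * s - μ * t) = C * Real.exp (γ * s) := by
    rw [mul_assoc, ← Real.exp_add]; congr 2; ring
  rw [e1, e2] at h4
  linarith

theorem exists_tendsto_of_monotoneOn_Ici {f : ℝ → ℝ} {a M : ℝ} (hf : MonotoneOn f (Ici a))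
    (hM : ∀ s, a ≤ s → f s ≤ M) : ∃ l, Tendsto f atTop (𝓝 l) := by
  have hmono : Monotone fun s => f (max s a) := fun s t hst =>
    hf (mem_Ici.mpr (le_max_right _ _)) (mem_Ici.mpr (le_max_right _ _)) (max_le_max_right a hst)
  rcases tendsto_atTop_of_monotone hmono with h | ⟨l, hl⟩
  · obtain ⟨s, hs⟩ := (h.eventually_gt_atTop M).exists
    exact absurd (hM _ (le_max_right s a)) (not_le.mpr hs)
  · refine ⟨l, hl.congr' ?_⟩
    filter_upwards [eventually_ge_atTop a] with s hs
    rw [max_eq_left hs]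

/-- Barbalat's lemma: if `f` converges and `f' = φ + χ` with `φ → 0` and `χ` Lipschitz, then
`χ → 0`. -/
theorem tendsto_zero_of_barbalat {f φ χ χ' : ℝ → ℝ} {a l L : ℝ}
    (hf : ∀ s, a ≤ s → HasDerivAt f (φ s + χ s) s) (hl : Tendsto f atTop (𝓝 l))
    (hφ : Tendsto φ atTop (𝓝 0)) (hχ : ∀ s, a ≤ s → HasDerivAt χ (χ' s) s)
    (hL : ∀ s, a ≤ s → |χ' s| ≤ L) : Tendsto χ atTop (𝓝 0) := by
  have hL0 : 0 ≤ L := (abs_nonneg _).trans (hL a le_rfl)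
  rw [Metric.tendsto_atTop]
  intro η hη
  set δ := η / (4 * (L + 1)) with hδ
  have hδ0 : 0 < δ := by positivity
  have hLδ : L * δ ≤ η / 4 := by
    rw [hδ, ← mul_div_assoc, div_le_div_iff₀ (by positivity) (by norm_num)]
    nlinarith
  have h1 : Tendsto (fun s => (f (s + δ) - f s) / δ) atTop (𝓝 0) := by
    have := ((hl.comp (tendsto_atTop_add_const_right atTop δ tendsto_id)).sub hl).div_const δ
    simpa using this
  rw [Metric.tendsto_atTop] at h1 hφ
  obtain ⟨N₁, hN₁⟩ := h1 (η / 4) (by linarith)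
  obtain ⟨N₂, hN₂⟩ := hφ (η / 4) (by linarith)
  refine ⟨max a (max N₁ N₂), fun s hs => ?_⟩
  have hsa : a ≤ s := (le_max_left _ _).trans hs
  have hs1 : N₁ ≤ s := ((le_max_left _ _).trans (le_max_right _ _)).trans hs
  have hs2 : N₂ ≤ s := ((le_max_right _ _).trans (le_max_right _ _)).trans hs
  obtain ⟨c, hc, hcd⟩ := exists_hasDerivAt_eq_slope f (fun s => φ s + χ s)
    (show s < s + δ by linarith)
    (fun x hx => (hf x (hsa.trans hx.1)).continuousAt.continuousWithinAt)
    (fun x hx => hf x (hsa.trans hx.1.le))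
  have e1 := hN₁ s hs1
  have e2 := hN₂ c (hs2.trans hc.1.le)
  rw [Real.dist_eq, sub_zero] at e1 e2 ⊢
  rw [add_sub_cancel_left] at hcd
  rw [← hcd] at e1
  have e3 : |χ c - χ s| ≤ L * |c - s| := by
    have := (convex_Ici a).norm_image_sub_le_of_norm_hasDerivWithin_le (f := χ) (f' := χ') (C := L)
      (fun x hx => (hχ x hx).hasDerivWithinAt) (fun x hx => hL x hx)
      (show s ∈ Ici a from hsa) (show c ∈ Ici a from hsa.trans hc.1.le)
    simpa [Real.norm_eq_abs] using this
  have e4 : |c - s| ≤ δ := by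
    rw [abs_of_pos (by linarith [hc.1])]; linarith [hc.2]
  have e5 : L * |c - s| ≤ η / 4 := (mul_le_mul_of_nonneg_left e4 hL0).trans hLδ
  rw [abs_lt] at e1 e2 ⊢
  have e6 := abs_le.mp (e3.trans e5)
  constructor <;> linarith [e6.1, e6.2, e1.1, e1.2, e2.1, e2.2]

/-! ### The singular profile at the origin -/

/-- A singular profile: `Φ`, with derivative `Φ₁`, is a positive solution on `(0, ∞)` of the
nonlinear equation that blows up at the origin and vanishes at infinity. -/
structure IsProfile (d p q lam : ℝ) (Φ Φ₁ : ℝ → ℝ) : Prop where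
  pos : ∀ r, 0 < r → 0 < Φ r
  hasDerivAt : ∀ r, 0 < r → HasDerivAt Φ (Φ₁ r) r
  hasDerivAt' : ∀ r, 0 < r → HasDerivAt Φ₁
    (-((d - 1) / r) * Φ₁ r + (r ^ 2 - lam) * Φ r - Φ r ^ q - Φ r ^ p) r
  singular : Tendsto Φ (𝓝[>] 0) atTop
  tendsto_zero : Tendsto Φ atTop (𝓝 0)

/-- The profile in logarithmic variables `s = -log r`: `φ(s) = Φ(r)`, `k(s) = -r Φ'(r)`. -/
structure IsLogProfile (N p q lam : ℝ) (φ k : ℝ → ℝ) : Prop where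
  pos : ∀ s, 0 < φ s
  hasDerivAt : ∀ s, HasDerivAt φ (k s) s
  hasDerivAt' : ∀ s, HasDerivAt k (N * k s - Real.exp (-(2 * s)) *
    ((lam - Real.exp (-(2 * s))) * φ s + φ s ^ q + φ s ^ p)) s
  singular : Tendsto φ atTop atTop

theorem IsProfile.isLogProfile {d p q lam : ℝ} {Φ Φ₁ : ℝ → ℝ} (h : IsProfile d p q lam Φ Φ₁) :
    IsLogProfile (d - 2) p q lam (fun s => Φ (Real.exp (-s)))
      (fun s => -(Real.exp (-s) * Φ₁ (Real.exp (-s)))) := by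
  have he : ∀ s : ℝ, HasDerivAt (fun s : ℝ => Real.exp (-s)) (-Real.exp (-s)) s := fun s => by
    simpa using (hasDerivAt_neg s).exp
  refine ⟨fun s => h.pos _ (Real.exp_pos _), fun s => ?_, fun s => ?_, ?_⟩
  · exact ((h.hasDerivAt _ (Real.exp_pos (-s))).comp s (he s)).congr_deriv (by ring)
  · refine (((he s).mul ((h.hasDerivAt' _ (Real.exp_pos (-s))).comp s (he s))).neg).congr_deriv ?_
    have e2 : Real.exp (-(2 * s)) = Real.exp (-s) ^ 2 := by
      rw [← Real.exp_nat_mul]; congr 1; push_cast; ring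
    rw [e2]
    have := (Real.exp_pos (-s)).ne'
    simp only [Function.comp_apply]
    field_simp
    ring
  · refine h.singular.comp ?_
    rw [tendsto_nhdsWithin_iff]
    exact ⟨Real.tendsto_exp_neg_atTop_nhds_zero, Eventually.of_forall fun s => Real.exp_pos _⟩

/-- The profile is monotone near the origin. -/
theorem IsLogProfile.eventually_nonneg {N p q lam : ℝ} {φ k : ℝ → ℝ} (hlam : 0 < lam)
    (h : IsLogProfile N p q lam φ k) :
    ∃ a, ∀ s, a ≤ s → 0 ≤ k s ∧ Real.exp (-(2 * s)) ≤ lam ∧ 1 ≤ φ s := by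
  have hexp : Tendsto (fun s : ℝ => Real.exp (-(2 * s))) atTop (𝓝 0) :=
    Real.tendsto_exp_neg_atTop_nhds_zero.comp (tendsto_id.const_mul_atTop two_pos)
  obtain ⟨a, ha⟩ := eventually_atTop.mp
    ((hexp.eventually_le_const hlam).and (h.singular.eventually_ge_atTop 1))
  refine ⟨a, fun s hs => ⟨?_, ha s hs⟩⟩
  by_contra hneg
  have hk : 0 < -k s := by linarith [not_le.mp hneg]
  have hgrow : ∀ t, s ≤ t → k t ≤ 0 := by
    intro t ht
    have := exponential_growth (D := fun t => -k t) (γ := N)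
      (fun t _ => (h.hasDerivAt' t).neg) (fun t ht => by
        have hφ := h.pos t
        have h1 := (ha t (hs.trans ht)).1
        have h2 : 0 ≤ Real.exp (-(2 * t)) *
            ((lam - Real.exp (-(2 * t))) * φ t + φ t ^ q + φ t ^ p) := by
          have := Real.rpow_pos_of_pos hφ q
          have := Real.rpow_pos_of_pos hφ p
          have h3 : 0 ≤ (lam - Real.exp (-(2 * t))) * φ t := mul_nonneg (by linarith) hφ.le
          have := Real.exp_pos (-(2 * t))
          positivity
        linarith) ht
    have h2 : 0 < -k s * Real.exp (N * (t - s)) := by positivity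
    linarith
  have hanti := monotoneOn_Ici_of_hasDerivAt (a := s) (f := fun t => -φ t)
    (fun t _ => (h.hasDerivAt t).neg) (fun t ht => by have := hgrow t ht; linarith)
  obtain ⟨t, ht1, ht2⟩ := ((h.singular.eventually_gt_atTop (φ s)).and
    (eventually_ge_atTop s)).exists
  have := hanti self_mem_Ici ht2 ht2
  simp only at this
  linarith

/-- The a priori bound `Φ ≤ C r^(-μ)` and `r |Φ'| ≤ C r^(-μ)`, `μ = 2/(p-1)`. -/
theorem IsLogProfile.upper_bound {N p q lam μ : ℝ} {φ k : ℝ → ℝ} (hN : 0 < N) (hlam : 0 < lam)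
    (hp : 1 < p) (hqp : q < p) (hμ : μ * (p - 1) = 2) (hμN : μ < N)
    (h : IsLogProfile N p q lam φ k) :
    ∃ a M, 0 < M ∧ ∀ s, a ≤ s → φ s ≤ M * Real.exp (μ * s) ∧ 0 ≤ k s ∧
      k s ≤ M * Real.exp (μ * s) ∧ Real.exp (-(2 * s)) ≤ lam ∧ 1 ≤ φ s := by
  obtain ⟨a, ha⟩ := h.eventually_nonneg hlam
  have hμ0 : 0 < μ := by
    by_contra hneg
    have : μ * (p - 1) ≤ 0 := mul_nonpos_of_nonpos_of_nonneg (not_lt.mp hneg) (by linarith)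
    linarith
  have hmono := monotoneOn_Ici_of_hasDerivAt (a := a) (fun t _ => h.hasDerivAt t)
    (fun t ht => (ha t ht).1)
  have hd2 : ∀ s : ℝ, HasDerivAt (fun s : ℝ => Real.exp (-(2 * s)))
      (-(2 * Real.exp (-(2 * s)))) s := fun s =>
    (((hasDerivAt_id s).const_mul 2).neg).exp.congr_deriv (by simp; ring)
  -- the flux is at least the mass of the superlinear term inside the ball
  have hflux : ∀ s, a ≤ s → Real.exp (-(2 * s)) * φ s ^ p / (N + 2) ≤ k s := by
    intro s hs
    have := nonpos_of_slow_growth (D := fun t => Real.exp (-(2 * t)) * (φ s ^ p / (N + 2)) - k t)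
      (γ := N) (μ := 0) (C := Real.exp (-(2 * s)) * (φ s ^ p / (N + 2))) (a := s) hN
      (fun t _ => ((hd2 t).mul_const _).sub (h.hasDerivAt' t))
      (fun t ht => by
        have hφs := h.pos s
        have hφt := h.pos t
        have h1 : φ s ^ p ≤ φ t ^ p :=
          Real.rpow_le_rpow hφs.le (hmono hs (hs.trans ht) ht) (by linarith)
        have h2 : 0 ≤ (lam - Real.exp (-(2 * t))) * φ t :=
          mul_nonneg (by linarith [(ha t (hs.trans ht)).2.1]) hφt.le
        have h3 := Real.rpow_pos_of_pos hφt q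
        have h4 : Real.exp (-(2 * t)) * φ s ^ p ≤ Real.exp (-(2 * t)) *
            ((lam - Real.exp (-(2 * t))) * φ t + φ t ^ q + φ t ^ p) := by
          gcongr
          linarith
        have e : N * (Real.exp (-(2 * t)) * (φ s ^ p / (N + 2))) =
            Real.exp (-(2 * t)) * φ s ^ p - 2 * Real.exp (-(2 * t)) * (φ s ^ p / (N + 2)) := by
          field_simp
          ring
        linarith)
      (fun t ht => by
        have h1 := (ha t (hs.trans ht)).1
        have h2 : Real.exp (-(2 * t)) ≤ Real.exp (-(2 * s)) :=
          Real.exp_le_exp.mpr (by linarith)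
        have h3 : 0 ≤ φ s ^ p / (N + 2) := by
          have := Real.rpow_pos_of_pos (h.pos s) p
          positivity
        have := mul_le_mul_of_nonneg_right h2 h3
        simp only [zero_mul, Real.exp_zero, mul_one]
        linarith) le_rfl
    have e : Real.exp (-(2 * s)) * φ s ^ p / (N + 2) =
      Real.exp (-(2 * s)) * (φ s ^ p / (N + 2)) := by ring
    linarith
  -- the flux bound reads `φ' φ^(-p) ≥ e^(-2s) / (N + 2)`; integrate it from infinity, where
  -- `φ^(1-p)` vanishes
  have hφ1p : ∀ s, a ≤ s → (p - 1) / (2 * (N + 2)) * Real.exp (-(2 * s)) ≤ φ s ^ (1 - p) := by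
    intro s hs
    have := ge_limit_of_deriv_nonpos (R := a) (l := 0)
      (f := fun s => φ s ^ (1 - p) - (p - 1) / (2 * (N + 2)) * Real.exp (-(2 * s)))
      (fun t ht => ((h.hasDerivAt t).rpow_const (p := 1 - p) (Or.inl (h.pos t).ne')).sub
        ((hd2 t).const_mul _))
      (fun t ht => by
        have h1 := hflux t ht
        have hφ := h.pos t
        have e1 : φ t ^ (1 - p - 1) = (φ t ^ p)⁻¹ := by
          rw [← Real.rpow_neg hφ.le]; congr 1; ring
        have hpp := Real.rpow_pos_of_pos hφ p
        have h2 : Real.exp (-(2 * t)) / (N + 2) ≤ k t * (φ t ^ p)⁻¹ := by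
          rw [← div_eq_mul_inv, le_div_iff₀ hpp]
          calc _ = Real.exp (-(2 * t)) * φ t ^ p / (N + 2) := by ring
            _ ≤ _ := h1
        rw [e1]
        have h3 := mul_le_mul_of_nonneg_left h2 (by linarith : 0 ≤ p - 1)
        have e2 : (p - 1) / (2 * (N + 2)) * -(2 * Real.exp (-(2 * t))) =
          -((p - 1) * (Real.exp (-(2 * t)) / (N + 2))) := by field_simp
        rw [e2]
        linarith)
      (by
        have h1 : Tendsto (fun s => φ s ^ (1 - p)) atTop (𝓝 0) := by
          have := (tendsto_rpow_neg_atTop (show 0 < p - 1 by linarith)).comp h.singular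
          refine this.congr fun s => ?_
          simp
        have h2 : Tendsto (fun s : ℝ => Real.exp (-(2 * s))) atTop (𝓝 0) :=
          Real.tendsto_exp_neg_atTop_nhds_zero.comp (tendsto_id.const_mul_atTop two_pos)
        simpa using h1.sub (h2.const_mul ((p - 1) / (2 * (N + 2))))) hs
    linarith
  set c := (p - 1) / (2 * (N + 2)) with hc
  have hc0 : 0 < c := by
    have : 0 < p - 1 := by linarith
    positivity
  set M₁ := c ^ (-(1 / (p - 1))) with hM₁
  have hM₁0 : 0 < M₁ := Real.rpow_pos_of_pos hc0 _
  have hφub : ∀ s, a ≤ s → φ s ≤ M₁ * Real.exp (μ * s) := by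
    intro s hs
    have hp1 : 0 < p - 1 := by linarith
    have h1 : (φ s ^ (1 - p)) ^ (-(1 / (p - 1))) = φ s := by
      rw [← Real.rpow_mul (h.pos s).le]
      have : (1 - p) * -(1 / (p - 1)) = 1 := by field_simp; ring
      rw [this, Real.rpow_one]
    have h2 := Real.rpow_le_rpow_of_nonpos (z := -(1 / (p - 1)))
      (by have := Real.exp_pos (-(2 * s)); positivity) (hφ1p s hs)
      (by have := one_div_pos.mpr hp1; linarith)
    rw [h1, Real.mul_rpow hc0.le (Real.exp_pos _).le, ← Real.exp_mul] at h2
    refine h2.trans (le_of_eq ?_)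
    have hμ' : μ = 2 / (p - 1) := by field_simp; linarith
    rw [hμ', hM₁]
    congr 2
    ring
  -- upper bound for the flux
  have hgub : ∀ s, a ≤ s → Real.exp (-(2 * s)) *
      ((lam - Real.exp (-(2 * s))) * φ s + φ s ^ q + φ s ^ p) ≤
      (lam + 2) * M₁ ^ p * Real.exp (μ * s) := by
    intro s hs
    have hφ1 := (ha s hs).2.2
    have hφ0 := h.pos s
    have h1 : φ s ≤ φ s ^ p := Real.self_le_rpow_of_one_le hφ1 hp.le
    have h2 : φ s ^ q ≤ φ s ^ p := Real.rpow_le_rpow_of_exponent_le hφ1 hqp.le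
    have h3 : φ s ^ p ≤ M₁ ^ p * Real.exp ((μ + 2) * s) := by
      have := Real.rpow_le_rpow hφ0.le (hφub s hs) (show 0 ≤ p by linarith)
      rw [Real.mul_rpow hM₁0.le (Real.exp_pos _).le, ← Real.exp_mul] at this
      convert this using 3
      have : μ * p = μ + 2 := by linarith
      calc (μ + 2) * s = (μ * p) * s := by rw [this]
        _ = _ := by ring
    have h4 : (lam - Real.exp (-(2 * s))) * φ s ≤ lam * φ s ^ p := by
      apply mul_le_mul _ h1 hφ0.le hlam.le
      have := Real.exp_pos (-(2 * s))
      linarith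
    calc _ ≤ Real.exp (-(2 * s)) * ((lam + 2) * (M₁ ^ p * Real.exp ((μ + 2) * s))) := by
          gcongr
          have := mul_le_mul_of_nonneg_left h3 (by linarith : 0 ≤ lam + 2)
          linarith
      _ = (lam + 2) * M₁ ^ p * (Real.exp (-(2 * s)) * Real.exp ((μ + 2) * s)) := by ring
      _ = _ := by rw [← Real.exp_add]; congr 2; ring
  set C₀ := (lam + 2) * M₁ ^ p with hC₀
  have hC₀0 : 0 < C₀ := by
    have := Real.rpow_pos_of_pos hM₁0 p
    positivity
  -- if `k` exceeded this level once, it would grow like `e^(N s)`, and so would `φ`, against the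
  -- bound `φ = O(e^(μ s))` with `μ < N`
  have hkub : ∀ s, a ≤ s → k s ≤ C₀ / (N - μ) * Real.exp (μ * s) := by
    intro s hs
    by_contra hneg
    have hNμ : 0 < N - μ := by linarith
    have hDpos : 0 < k s - C₀ / (N - μ) * Real.exp (μ * s) := by linarith [not_le.mp hneg]
    have hdμ : ∀ t : ℝ, HasDerivAt (fun t : ℝ => Real.exp (μ * t)) (μ * Real.exp (μ * t)) t :=
      fun t => ((hasDerivAt_id t).const_mul μ).exp.congr_deriv (by simp; ring)
    have hdN : ∀ t : ℝ, HasDerivAt (fun t : ℝ => Real.exp (N * (t - s)))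
        (N * Real.exp (N * (t - s))) t := fun t =>
      (((hasDerivAt_id t).sub_const s).const_mul N).exp.congr_deriv (by simp; ring)
    set c' := k s - C₀ / (N - μ) * Real.exp (μ * s) with hc'
    have hgrow : ∀ t, s ≤ t → c' * Real.exp (N * (t - s)) ≤ k t := by
      intro t ht
      have := exponential_growth (D := fun t => k t - C₀ / (N - μ) * Real.exp (μ * t)) (γ := N)
        (a := s) (fun t _ => (h.hasDerivAt' t).sub ((hdμ t).const_mul _))
        (fun t ht => by
          have h1 := hgub t (hs.trans ht)
          have e : C₀ * Real.exp (μ * t) = N * (C₀ / (N - μ) * Real.exp (μ * t)) -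
              C₀ / (N - μ) * (μ * Real.exp (μ * t)) := by
            field_simp
          linarith) ht
      have h2 : 0 < C₀ / (N - μ) * Real.exp (μ * t) := by positivity
      rw [← hc'] at this
      linarith
    have hφgrow := monotoneOn_Ici_of_hasDerivAt (a := s)
      (f := fun t => φ t - c' / N * Real.exp (N * (t - s)))
      (fun t _ => (h.hasDerivAt t).sub ((hdN t).const_mul _))
      (fun t ht => by
        have := hgrow t ht
        have e : c' / N * (N * Real.exp (N * (t - s))) = c' * Real.exp (N * (t - s)) := by
          field_simp
        linarith)
    have hbd : ∀ t, max s 0 ≤ t → c' / N * Real.exp (N * (t - s)) ≤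
        (M₁ + |c' / N|) * Real.exp (μ * t) := by
      intro t ht
      have hst : s ≤ t := (le_max_left _ _).trans ht
      have ht0 : 0 ≤ t := (le_max_right _ _).trans ht
      have h1 := hφgrow self_mem_Ici hst hst
      simp only [sub_self, mul_zero, Real.exp_zero, mul_one] at h1
      have h2 := hφub t (hs.trans hst)
      have h3 : 1 ≤ Real.exp (μ * t) := Real.one_le_exp (by positivity)
      have h4 := h.pos s
      have h5 : c' / N ≤ |c' / N| * Real.exp (μ * t) :=
        (le_abs_self _).trans (le_mul_of_one_le_right (abs_nonneg _) h3)
      linarith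
    have := nonpos_of_slow_growth (D := fun t => c' / N * Real.exp (N * (t - s))) (γ := N)
      (a := max s 0) hμN (fun t _ => (hdN t).const_mul _) (fun t _ => by
        apply le_of_eq; ring) hbd le_rfl
    have h6 : 0 < c' / N * Real.exp (N * (max s 0 - s)) := by positivity
    linarith
  refine ⟨a, max M₁ (C₀ / (N - μ)), lt_max_of_lt_left hM₁0, fun s hs => ⟨?_, (ha s hs).1, ?_,
    (ha s hs).2⟩⟩
  · exact (hφub s hs).trans (by gcongr; exact le_max_left _ _)
  · exact (hkub s hs).trans (by gcongr; exact le_max_right _ _)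

/-! ### The Emden-Fowler equation near its equilibria -/

theorem tendsto_exp_neg_mul {κ : ℝ} (hκ : 0 < κ) :
    Tendsto (fun s : ℝ => Real.exp (-(κ * s))) atTop (𝓝 0) :=
  Real.tendsto_exp_neg_atTop_nhds_zero.comp (tendsto_id.const_mul_atTop hκ)

theorem hasDerivAt_exp_neg_mul (κ s : ℝ) :
    HasDerivAt (fun s : ℝ => Real.exp (-(κ * s))) (-(κ * Real.exp (-(κ * s)))) s :=
  (((hasDerivAt_id s).const_mul κ).neg).exp.congr_deriv (by simp; ring)

/-- A bounded solution of the asymptotically autonomous, anti-damped Emden-Fowler equation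
`v'' = a v' + b v - v^p - R` tends to one of the equilibria. -/
theorem emdenFowler_convergence {a b p κ M s₀ : ℝ} {v x R : ℝ → ℝ} (ha : 0 < a) (hb : 0 < b)
    (hp : 1 < p) (hκ : 0 < κ) (hs₀ : 0 ≤ s₀)
    (hv : ∀ s, s₀ ≤ s → HasDerivAt v (x s) s)
    (hx : ∀ s, s₀ ≤ s → HasDerivAt x (a * x s + b * v s - v s ^ p - R s) s)
    (hv0 : ∀ s, s₀ ≤ s → 0 < v s) (hvM : ∀ s, s₀ ≤ s → v s ≤ M)
    (hxM : ∀ s, s₀ ≤ s → |x s| ≤ M) (hR : ∀ s, s₀ ≤ s → |R s| ≤ M * Real.exp (-(κ * s))) :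
    Tendsto x atTop (𝓝 0) ∧
      (Tendsto v atTop (𝓝 0) ∨ Tendsto v atTop (𝓝 (b ^ (1 / (p - 1))))) := by
  have hM : 0 < M := (hv0 s₀ le_rfl).trans_le (hvM s₀ le_rfl)
  have hRM : ∀ s, s₀ ≤ s → |R s| ≤ M := fun s hs => (hR s hs).trans (by
    have : Real.exp (-(κ * s)) ≤ 1 := Real.exp_le_one_iff.mpr (by
      have := mul_nonneg hκ.le (hs₀.trans hs); linarith)
    exact mul_le_of_le_one_right hM.le this)
  have hR0 : Tendsto R atTop (𝓝 0) := by
    refine squeeze_zero_norm' ?_ (by simpa using (tendsto_exp_neg_mul hκ).const_mul M)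
    filter_upwards [eventually_ge_atTop s₀] with s hs using hR s hs
  have hvp : ∀ s, s₀ ≤ s → 0 < v s ^ p ∧ v s ^ p ≤ M ^ p := fun s hs =>
    ⟨Real.rpow_pos_of_pos (hv0 s hs) p,
      Real.rpow_le_rpow (hv0 s hs).le (hvM s hs) (by linarith)⟩
  have hMp : 0 < M ^ p := Real.rpow_pos_of_pos hM p
  have hx'M : ∀ s, s₀ ≤ s → |a * x s + b * v s - v s ^ p - R s| ≤ a * M + b * M + M ^ p + M := by
    intro s hs
    have h1 := abs_le.mp (hxM s hs)
    have h2 := hv0 s hs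
    have h3 := hvM s hs
    have h4 := hvp s hs
    have h5 := abs_le.mp (hRM s hs)
    have h6 : a * x s ≤ a * M := mul_le_mul_of_nonneg_left h1.2 ha.le
    have h7 : a * -M ≤ a * x s := mul_le_mul_of_nonneg_left h1.1 ha.le
    have h8 : b * v s ≤ b * M := mul_le_mul_of_nonneg_left h3 hb.le
    have h9 : 0 < b * v s := mul_pos hb h2
    have h10 : 0 < b * M := mul_pos hb hM
    rw [abs_le]
    constructor <;> linarith
  -- the mechanical energy, which increases up to an integrable error
  obtain ⟨E, dE⟩ : ∃ E : ℝ → ℝ, E = fun s => x s ^ 2 / 2 - b * v s ^ 2 / 2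
      + v s ^ (p + 1) / (p + 1) := ⟨_, rfl⟩
  have hE : ∀ s, s₀ ≤ s → HasDerivAt E (-(R s * x s) + a * x s ^ 2) s := by
    intro s hs
    rw [dE]
    refine (((((hx s hs).pow 2).div_const 2).sub
      ((((hv s hs).pow 2).const_mul b).div_const 2)).add
      (((hv s hs).rpow_const (p := p + 1) (Or.inl (hv0 s hs).ne')).div_const
        (p + 1))).congr_deriv ?_
    have : p + 1 ≠ 0 := by linarith
    rw [add_sub_cancel_right]
    field_simp
    norm_num
    ring
  have hRx : ∀ s, s₀ ≤ s → |R s * x s| ≤ M * M * Real.exp (-(κ * s)) := by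
    intro s hs
    rw [abs_mul]
    calc |R s| * |x s| ≤ M * Real.exp (-(κ * s)) * M :=
          mul_le_mul (hR s hs) (hxM s hs) (abs_nonneg _) (by positivity)
      _ = _ := by ring
  have hEconv : ∃ l, Tendsto E atTop (𝓝 l) := by
    have hmono := monotoneOn_Ici_of_hasDerivAt (a := s₀)
      (f := fun s => E s - M * M / κ * Real.exp (-(κ * s)))
      (fun s hs => (hE s hs).sub ((hasDerivAt_exp_neg_mul κ s).const_mul _))
      (fun s hs => by
        have h1 := (abs_le.mp (hRx s hs)).2
        have h2 : 0 ≤ a * x s ^ 2 := by positivity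
        have e : M * M / κ * -(κ * Real.exp (-(κ * s))) = -(M * M * Real.exp (-(κ * s))) := by
          field_simp
        rw [e]
        linarith)
    obtain ⟨l, hl⟩ := exists_tendsto_of_monotoneOn_Ici (M := M ^ 2 / 2 + M ^ (p + 1) / (p + 1))
      hmono (fun s hs => by
        have h1 : x s ^ 2 ≤ M ^ 2 := by
          rw [← sq_abs (x s)]; exact pow_le_pow_left₀ (abs_nonneg _) (hxM s hs) 2
        have h2 : v s ^ (p + 1) / (p + 1) ≤ M ^ (p + 1) / (p + 1) := by
          have := Real.rpow_le_rpow (hv0 s hs).le (hvM s hs) (show 0 ≤ p + 1 by linarith)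
          have : 0 < p + 1 := by linarith
          gcongr
        have h3 : 0 ≤ b * v s ^ 2 / 2 := by positivity
        have h4 : 0 ≤ M * M / κ * Real.exp (-(κ * s)) := by positivity
        simp only [dE]
        linarith)
    refine ⟨l, ?_⟩
    have := hl.add ((tendsto_exp_neg_mul hκ).const_mul (M * M / κ))
    simpa using this
  obtain ⟨l, hl⟩ := hEconv
  -- Barbalat for the energy: the dissipation tends to `0`
  have hx2 : Tendsto (fun s => a * x s ^ 2) atTop (𝓝 0) := by
    refine tendsto_zero_of_barbalat (χ' := fun s => a * (2 * x s *
      (a * x s + b * v s - v s ^ p - R s))) (L := a * (2 * M * (a * M + b * M + M ^ p + M)))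
      hE hl ?_ ?_ ?_
    · refine squeeze_zero_norm' ?_ (by simpa using (tendsto_exp_neg_mul hκ).const_mul (M * M))
      filter_upwards [eventually_ge_atTop s₀] with s hs
      rw [norm_neg]
      exact hRx s hs
    · intro s hs
      refine (((hx s hs).pow 2).const_mul a).congr_deriv ?_
      norm_num
    · intro s hs
      rw [abs_mul, abs_mul, abs_mul, abs_of_pos ha, abs_two]
      have h1 := hx'M s hs
      have h2 := hxM s hs
      gcongr
  have hx0 : Tendsto x atTop (𝓝 0) := by
    have h1 : Tendsto (fun s => x s ^ 2) atTop (𝓝 0) := by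
      have := hx2.const_mul a⁻¹
      rw [mul_zero] at this
      refine this.congr fun s => ?_
      field_simp
    have h2 := (Real.continuous_sqrt.tendsto 0).comp h1
    rw [Real.sqrt_zero] at h2
    rw [tendsto_zero_iff_abs_tendsto_zero]
    refine h2.congr fun s => ?_
    simp [Real.sqrt_sq_eq_abs]
  refine ⟨hx0, ?_⟩
  -- Barbalat for `x`, whose derivative is `b v - v^p` up to vanishing terms
  have hF : Tendsto (fun s => b * v s - v s ^ p) atTop (𝓝 0) := by
    refine tendsto_zero_of_barbalat (a := s₀) (f := x) (φ := fun s => a * x s - R s)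
      (χ' := fun s => b * x s - x s * p * v s ^ (p - 1))
      (L := b * M + M * p * M ^ (p - 1)) (fun s hs => ?_) hx0 ?_ ?_ ?_
    · exact (hx s hs).congr_deriv (by ring)
    · simpa using (hx0.const_mul a).sub hR0
    · intro s hs
      exact ((hv s hs).const_mul b).sub ((hv s hs).rpow_const (p := p) (Or.inl (hv0 s hs).ne'))
    · intro s hs
      have h1 := hxM s hs
      have h2 := Real.rpow_le_rpow (hv0 s hs).le (hvM s hs) (show 0 ≤ p - 1 by linarith)
      have h3 := Real.rpow_pos_of_pos (hv0 s hs) (p - 1)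
      have hp0 : 0 < p := by linarith
      refine (abs_sub _ _).trans ?_
      rw [abs_mul, abs_mul, abs_mul, abs_of_pos hb, abs_of_pos hp0, abs_of_pos h3]
      gcongr
  have hp1 : 0 < p - 1 := by linarith
  set A := b ^ (1 / (p - 1)) with hA
  have hA0 : 0 < A := Real.rpow_pos_of_pos hb _
  have hAp : A ^ (p - 1) = b := by
    rw [hA, ← Real.rpow_mul hb.le, one_div_mul_cancel hp1.ne', Real.rpow_one]
  have hfac : ∀ s, s₀ ≤ s → b * v s - v s ^ p = v s * (b - v s ^ (p - 1)) := by
    intro s hs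
    have : v s ^ p = v s * v s ^ (p - 1) := by
      rw [← Real.rpow_one_add' (hv0 s hs).le (by linarith)]; congr 1; ring
    rw [this]; ring
  have hm0 : 0 < A / 2 := by positivity
  have hmb : (A / 2) ^ (p - 1) < b := by
    rw [← hAp]; exact Real.rpow_lt_rpow hm0.le (by linarith) hp1
  -- `v` cannot cross the level `A / 2` for large `s`
  obtain ⟨s₁, hs₁⟩ := eventually_atTop.mp
    ((hF.eventually_lt_const (show 0 < A / 2 * (b - (A / 2) ^ (p - 1)) from
      mul_pos hm0 (by linarith))).and (eventually_ge_atTop s₀))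
  have hne : ∀ s, s₁ ≤ s → v s ≠ A / 2 := by
    intro s hs heq
    have h1 := (hs₁ s hs).1
    rw [hfac s (hs₁ s hs).2, heq] at h1
    exact lt_irrefl _ h1
  have hcont : ContinuousOn v (Ici s₁) := fun s hs =>
    (hv s (hs₁ s hs).2).continuousAt.continuousWithinAt
  have hdich : (∀ s, s₁ ≤ s → v s < A / 2) ∨ (∀ s, s₁ ≤ s → A / 2 < v s) := by
    by_contra hcon
    push Not at hcon
    obtain ⟨⟨s, hs, hs'⟩, ⟨t, ht, ht'⟩⟩ := hcon
    obtain ⟨c, hc, hcv⟩ := (isPreconnected_Ici (a := s₁)).intermediate_value ht hs hcont ⟨ht', hs'⟩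
    exact hne c hc hcv
  rcases hdich with hlt | hgt
  · left
    have hc : 0 < b - (A / 2) ^ (p - 1) := by linarith
    refine squeeze_zero' ?_ ?_ (by simpa using hF.div_const (b - (A / 2) ^ (p - 1)))
    · filter_upwards [eventually_ge_atTop s₀] with s hs using (hv0 s hs).le
    · filter_upwards [eventually_ge_atTop s₁] with s hs
      have hs0 := (hs₁ s hs).2
      rw [le_div_iff₀ hc, hfac s hs0]
      apply mul_le_mul_of_nonneg_left _ (hv0 s hs0).le
      have := Real.rpow_le_rpow (hv0 s hs0).le (hlt s hs).le hp1.le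
      linarith
  · right
    have h1 : Tendsto (fun s => b - v s ^ (p - 1)) atTop (𝓝 0) := by
      refine squeeze_zero_norm' ?_
        (by simpa using (tendsto_zero_iff_abs_tendsto_zero _).mp hF |>.div_const (A / 2))
      filter_upwards [eventually_ge_atTop s₁] with s hs
      have hs0 := (hs₁ s hs).2
      rw [hfac s hs0, le_div_iff₀ hm0, abs_mul, abs_of_pos (hv0 s hs0), mul_comm]
      exact mul_le_mul_of_nonneg_right (hgt s hs).le (norm_nonneg _)
    have h2 : Tendsto (fun s => v s ^ (p - 1)) atTop (𝓝 b) := by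
      have := h1.const_sub b
      simpa using this
    have h3 := h2.rpow_const (p := 1 / (p - 1)) (Or.inl hb.ne')
    refine h3.congr' ?_
    filter_upwards [eventually_ge_atTop s₀] with s hs
    rw [← Real.rpow_mul (hv0 s hs).le, mul_one_div_cancel hp1.ne', Real.rpow_one]

/-- Exponential rate of convergence to the nontrivial equilibrium. The linearisation there
is repelling as `s → ∞`, so a solution that converges does so at the rate of the perturbation
`R`. -/
theorem emdenFowler_rate {a b p κ M s₀ ω : ℝ} {v x R : ℝ → ℝ} (ha : 0 < a) (hb : 0 < b)
    (hp : 1 < p) (hκ : 0 < κ) (hω : 0 < ω) (hω2 : ω ^ 2 = (p - 1) * b - a ^ 2 / 4)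
    (hv : ∀ s, s₀ ≤ s → HasDerivAt v (x s) s)
    (hx : ∀ s, s₀ ≤ s → HasDerivAt x (a * x s + b * v s - v s ^ p - R s) s)
    (hR : ∀ s, s₀ ≤ s → |R s| ≤ M * Real.exp (-(κ * s)))
    (hx0 : Tendsto x atTop (𝓝 0)) (hvA : Tendsto v atTop (𝓝 (b ^ (1 / (p - 1))))) :
    ∃ C s₁, 0 < C ∧ ∀ s, s₁ ≤ s → |v s - b ^ (1 / (p - 1))| ≤ C * Real.exp (-(κ * s)) := by
  have hp1 : 0 < p - 1 := by linarith
  set A := b ^ (1 / (p - 1)) with hA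
  have hA0 : 0 < A := Real.rpow_pos_of_pos hb _
  have hAp : A ^ (p - 1) = b := by
    rw [hA, ← Real.rpow_mul hb.le, one_div_mul_cancel hp1.ne', Real.rpow_one]
  have hApp : A ^ p = b * A := by
    have : A ^ p = A ^ (p - 1) * A := by
      rw [← Real.rpow_add_one' hA0.le (by linarith)]; congr 1; ring
    rw [this, hAp]
  -- linearisation of the nonlinearity at the equilibrium
  have hlin : ∀ θ : ℝ, 0 < θ → ∀ᶠ s in atTop,
      |b * v s - v s ^ p + (p - 1) * b * (v s - A)| ≤ θ * |v s - A| := by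
    intro θ hθ
    have hd : HasDerivAt (fun y : ℝ => b * y - y ^ p) (b - p * A ^ (p - 1)) A :=
      (((hasDerivAt_id A).const_mul b).sub
        (Real.hasDerivAt_rpow_const (p := p) (Or.inl hA0.ne'))).congr_deriv (by simp)
    have := (hasDerivAt_iff_isLittleO.mp hd).def hθ
    filter_upwards [hvA.eventually this] with s hs
    rw [Real.norm_eq_abs, Real.norm_eq_abs, hApp, hAp, smul_eq_mul] at hs
    convert hs using 2
    ring
  have hθ0 : 0 < a * ω / 4 := by positivity
  obtain ⟨s₁, hs₁⟩ := eventually_atTop.mp ((hlin (a * ω / 4) hθ0).and (eventually_ge_atTop s₀))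
  -- `Q` is the energy of the linearisation after removal of the anti-damping, `Q' = a Q` up to
  -- errors. As `Q` grows exponentially once it exceeds `C e^(-2κs)`, and tends to `0`, it never
  -- exceeds this level
  obtain ⟨X, dX⟩ : ∃ X : ℝ → ℝ, X = fun s => x s - a / 2 * (v s - A) := ⟨_, rfl⟩
  obtain ⟨Q, dQ⟩ : ∃ Q : ℝ → ℝ, Q = fun s => X s ^ 2 + ω ^ 2 * (v s - A) ^ 2 := ⟨_, rfl⟩
  obtain ⟨e, de⟩ : ∃ e : ℝ → ℝ, e = fun s => b * v s - v s ^ p + (p - 1) * b * (v s - A) :=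
    ⟨_, rfl⟩
  have hX : ∀ s, s₁ ≤ s → HasDerivAt X (a / 2 * X s - ω ^ 2 * (v s - A) + e s - R s) s := by
    intro s hs
    have hs0 := (hs₁ s hs).2
    have := (hx s hs0).sub (((hv s hs0).sub_const A).const_mul (a / 2))
    simp only [dX, de]
    refine this.congr_deriv ?_
    rw [hω2]
    ring
  have hQ : ∀ s, s₁ ≤ s → HasDerivAt Q (a * Q s + 2 * X s * (e s - R s)) s := by
    intro s hs
    have hs0 := (hs₁ s hs).2
    have := ((hX s hs).pow 2).add ((((hv s hs0).sub_const A).pow 2).const_mul (ω ^ 2))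
    have hxX : x s = X s + a / 2 * (v s - A) := by simp only [dX]; ring
    rw [hxX] at this
    rw [dQ]
    refine this.congr_deriv ?_
    norm_num
    ring
  have hQ0 : Tendsto Q atTop (𝓝 0) := by
    have h1 : Tendsto (fun s => v s - A) atTop (𝓝 0) := by simpa using hvA.sub_const A
    have h2 : Tendsto X atTop (𝓝 0) := by
      rw [dX]; simpa using hx0.sub (h1.const_mul (a / 2))
    rw [dQ]
    simpa using (h2.pow 2).add ((h1.pow 2).const_mul (ω ^ 2))
  obtain ⟨s₂, hs₂⟩ := eventually_atTop.mp
    ((hQ0.eventually_le_const one_pos).and (eventually_ge_atTop s₁))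
  set C := 2 / a * M ^ 2 / (2 * κ) with hC
  have hbound : ∀ s, s₂ ≤ s → Q s ≤ C * Real.exp (-(2 * κ * s)) := by
    intro s hs
    have := nonpos_of_slow_growth (D := fun s => Q s - C * Real.exp (-(2 * κ * s)))
      (γ := a / 4) (μ := 0) (C := 1) (a := s₂) (by positivity)
      (fun s hs => (hQ s (hs₂ s hs).2).sub ((hasDerivAt_exp_neg_mul (2 * κ) s).const_mul C))
      (fun s hs => by
        have hs1 := (hs₂ s hs).2
        have h1 : |e s| ≤ a * ω / 4 * |v s - A| := by rw [de]; exact (hs₁ s hs1).1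
        have h2 := hR s (hs₁ s hs1).2
        have hexp : Real.exp (-(2 * κ * s)) = Real.exp (-(κ * s)) ^ 2 := by
          rw [← Real.exp_nat_mul]; congr 1; push_cast; ring
        have h3 : R s ^ 2 ≤ M ^ 2 * Real.exp (-(2 * κ * s)) := by
          rw [hexp, ← mul_pow, ← sq_abs (R s)]
          exact pow_le_pow_left₀ (abs_nonneg _) h2 2
        have h4 : -(2 * X s * e s) ≤ a / 4 * Q s := by
          calc -(2 * X s * e s) ≤ |2 * X s * e s| := neg_le_abs _
            _ = 2 * |X s| * |e s| := by rw [abs_mul, abs_mul, abs_two]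
            _ ≤ 2 * |X s| * (a * ω / 4 * |v s - A|) := by gcongr
            _ = a / 4 * (2 * |X s| * (ω * |v s - A|)) := by ring
            _ ≤ a / 4 * Q s := by
              gcongr
              simp only [dQ]
              have := sq_nonneg (|X s| - ω * |v s - A|)
              rw [← sq_abs (X s), ← sq_abs (v s - A)]
              linarith
        have h5 : 2 * X s * R s ≤ a / 2 * X s ^ 2 + 2 / a * R s ^ 2 := by
          rw [← sub_nonneg]
          have : a / 2 * X s ^ 2 + 2 / a * R s ^ 2 - 2 * X s * R s =
              a / 2 * (X s - 2 / a * R s) ^ 2 := by field_simp; ring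
          rw [this]; positivity
        have h6 : X s ^ 2 ≤ Q s := by
          simp only [dQ]
          have : 0 ≤ ω ^ 2 * (v s - A) ^ 2 := by positivity
          linarith
        have h7 : a / 2 * X s ^ 2 ≤ a / 2 * Q s := by gcongr
        have h8 : 2 / a * R s ^ 2 ≤ 2 / a * (M ^ 2 * Real.exp (-(2 * κ * s))) := by gcongr
        have h9 : C * (2 * κ * Real.exp (-(2 * κ * s))) =
            2 / a * (M ^ 2 * Real.exp (-(2 * κ * s))) := by
          rw [hC]; field_simp
        have h10 : 0 ≤ a / 4 * (C * Real.exp (-(2 * κ * s))) := by positivity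
        linarith)
      (fun s hs => by
        have : 0 ≤ C * Real.exp (-(2 * κ * s)) := by positivity
        have := (hs₂ s hs).1
        simp only [zero_mul, Real.exp_zero, mul_one]
        linarith) hs
    linarith
  refine ⟨Real.sqrt C / ω + 1, s₂, by positivity, fun s hs => ?_⟩
  have h1 := hbound s hs
  have hC0 : 0 ≤ C := by positivity
  have hexp : Real.exp (-(2 * κ * s)) = Real.exp (-(κ * s)) ^ 2 := by
    rw [← Real.exp_nat_mul]; congr 1; push_cast; ring
  have h2 : |ω * (v s - A)| ≤ Real.sqrt C * Real.exp (-(κ * s)) := by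
    apply abs_le_of_sq_le_sq _ (by positivity)
    rw [mul_pow, mul_pow, Real.sq_sqrt hC0, ← hexp]
    refine le_trans ?_ h1
    simp only [dQ]
    have := sq_nonneg (X s)
    linarith
  rw [abs_mul, abs_of_pos hω] at h2
  have h3 : |v s - A| ≤ Real.sqrt C / ω * Real.exp (-(κ * s)) := by
    rw [div_mul_eq_mul_div, le_div_iff₀ hω]; linarith
  have := Real.exp_pos (-(κ * s))
  linarith

/-! ### Asymptotics of the profile at the origin -/

/-- The rescaled profile `r^μ Φ(r)` cannot tend to `0` at the origin: otherwise
`-r Φ' = o(Φ)` there, which makes `Φ` bounded. -/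
theorem IsLogProfile.not_tendsto_zero {N p q lam μ : ℝ} {φ k : ℝ → ℝ} (hN : 1 ≤ N)
    (hlam : 0 < lam) (hq : 1 < q) (hqp : q < p) (hμ : μ * (p - 1) = 2) (hμN : μ < N)
    (h : IsLogProfile N p q lam φ k)
    (h0 : Tendsto (fun s => Real.exp (-(μ * s)) * φ s) atTop (𝓝 0)) : False := by
  have hp : 1 < p := hq.trans hqp
  have hp1 : 0 < p - 1 := by linarith
  obtain ⟨a, M, hM, hb⟩ := h.upper_bound (by linarith) hlam hp hqp hμ hμN
  have hμ0 : 0 < μ := by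
    by_contra hneg
    have : μ * (p - 1) ≤ 0 := mul_nonpos_of_nonpos_of_nonneg (not_lt.mp hneg) hp1.le
    linarith
  -- `g φ` is the source, `0 ≤ g ≤ (2 + lam) e^{-2s} φ^{p-1} → 0`
  obtain ⟨g, dg⟩ : ∃ g : ℝ → ℝ, g = fun s => (2 + lam) * (Real.exp (-(2 * s)) * φ s ^ (p - 1)) :=
    ⟨_, rfl⟩
  have hsource : ∀ s, a ≤ s → Real.exp (-(2 * s)) *
      ((lam - Real.exp (-(2 * s))) * φ s + φ s ^ q + φ s ^ p) ≤ g s * φ s := by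
    intro s hs
    have hφ1 := (hb s hs).2.2.2.2
    have hφ0 := h.pos s
    have e1 : φ s ^ p = φ s ^ (p - 1) * φ s := by
      rw [← Real.rpow_add_one' hφ0.le (by linarith)]; congr 1; ring
    have h1 : φ s ^ q ≤ φ s ^ p := Real.rpow_le_rpow_of_exponent_le hφ1 hqp.le
    have h2 : φ s ≤ φ s ^ p := Real.self_le_rpow_of_one_le hφ1 hp.le
    have h3 : (lam - Real.exp (-(2 * s))) * φ s ≤ lam * φ s ^ p := by
      apply mul_le_mul _ h2 hφ0.le hlam.le
      have := Real.exp_pos (-(2 * s)); linarith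
    calc _ ≤ Real.exp (-(2 * s)) * ((2 + lam) * φ s ^ p) := by
          gcongr; linarith
      _ = g s * φ s := by rw [dg, e1]; ring
  have hg0 : Tendsto g atTop (𝓝 0) := by
    have h1 := (h0.rpow_const (p := p - 1) (Or.inr hp1.le)).const_mul (2 + lam)
    rw [Real.zero_rpow hp1.ne', mul_zero] at h1
    rw [dg]
    refine h1.congr fun s => ?_
    rw [Real.mul_rpow (Real.exp_pos _).le (h.pos s).le, ← Real.exp_mul]
    congr 3
    calc -(μ * s) * (p - 1) = -(μ * (p - 1)) * s := by ring
      _ = _ := by rw [hμ]; ring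
  set η := min (1 / 2) (1 / (2 * (p - 1))) with hη
  have hη0 : 0 < η := lt_min (by norm_num) (by positivity)
  have hη2 : η ≤ 1 / 2 := min_le_left _ _
  have hηp : η * (p - 1) ≤ 1 / 2 := by
    calc η * (p - 1) ≤ 1 / (2 * (p - 1)) * (p - 1) := by gcongr; exact min_le_right _ _
      _ = 1 / 2 := by field_simp
  have hηN : 0 < η * (N - η) := mul_pos hη0 (by linarith)
  obtain ⟨S, hS⟩ := eventually_atTop.mp (((hg0.eventually_le_const hηN).and
    (hg0.eventually_le_const (show 0 < η * ((N - μ) / 2) by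
      have : 0 < N - μ := by linarith
      positivity))).and (eventually_ge_atTop a))
  -- if `k > η φ` held once, it would hold from then on, and `k` would grow like
  -- `e^((N + μ) s / 2)`, faster than its a priori bound allows
  have hslow : ∀ s, S ≤ s → k s ≤ η * φ s := by
    intro s₁ hs₁
    by_contra hneg
    have hpos : 0 < k s₁ - η * φ s₁ := by linarith [not_le.mp hneg]
    have hkη : ∀ s, s₁ ≤ s → η * φ s ≤ k s := by
      intro s hs
      have := exponential_growth (D := fun s => k s - η * φ s) (γ := N - η) (a := s₁)
        (fun s _ => (h.hasDerivAt' s).sub ((h.hasDerivAt s).const_mul η))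
        (fun s hs => by
          have h1 := hsource s (hS s (hs₁.trans hs)).2
          have h2 := mul_le_mul_of_nonneg_right (hS s (hs₁.trans hs)).1.1 (h.pos s).le
          linarith) hs
      have h2 : 0 < (k s₁ - η * φ s₁) * Real.exp ((N - η) * (s - s₁)) :=
        mul_pos hpos (Real.exp_pos _)
      linarith
    have := nonpos_of_slow_growth (D := k) (γ := (N + μ) / 2) (μ := μ) (C := M) (a := s₁)
      (by linarith) (fun s _ => h.hasDerivAt' s)
      (fun s hs => by
        have h1 := hsource s (hS s (hs₁.trans hs)).2
        have h2 := mul_le_mul_of_nonneg_right (hS s (hs₁.trans hs)).1.2 (h.pos s).le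
        have h3 : (N - μ) / 2 * (η * φ s) ≤ (N - μ) / 2 * k s :=
          mul_le_mul_of_nonneg_left (hkη s hs) (by linarith)
        linarith)
      (fun s hs => (hb s (hS s (hs₁.trans hs)).2).2.2.1) le_rfl
    have h3 := mul_pos hη0 (h.pos s₁)
    linarith
  set S' := max S 0 with hS'
  have hSS : S ≤ S' := le_max_left _ _
  -- hence `φ` grows slower than `e^{ηs}`
  set c := φ S' * Real.exp (-(η * S')) with hc
  have hc0 : 0 < c := mul_pos (h.pos _) (Real.exp_pos _)
  have hφη : ∀ s, S' ≤ s → φ s ≤ c * Real.exp (η * s) := by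
    intro s hs
    have := monotoneOn_Ici_of_hasDerivAt (a := S') (f := fun s => -(φ s * Real.exp (-(η * s))))
      (fun s _ => ((h.hasDerivAt s).mul (hasDerivAt_exp_neg_mul η s)).neg)
      (fun s hs => by
        have h1 := mul_le_mul_of_nonneg_right (hslow s (hSS.trans hs)) (Real.exp_pos (-(η * s))).le
        linarith) self_mem_Ici hs hs
    have h2 : φ s * Real.exp (-(η * s)) ≤ c := by rw [hc]; linarith
    calc φ s = φ s * Real.exp (-(η * s)) * Real.exp (η * s) := by
          rw [mul_assoc, ← Real.exp_add]; simp
      _ ≤ _ := by gcongr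
  set C := (2 + lam) * c ^ (p - 1) * c with hC
  have hC0 : 0 < C := by
    have := Real.rpow_pos_of_pos hc0 (p - 1)
    positivity
  have hsmall : ∀ s, S' ≤ s → g s * φ s ≤ C * Real.exp (-(1 / 2 * s)) := by
    intro s hs
    have hs0 : 0 ≤ s := (le_max_right _ _).trans hs
    have h1 := hφη s hs
    have h2 := Real.rpow_le_rpow (h.pos s).le h1 hp1.le
    rw [Real.mul_rpow hc0.le (Real.exp_pos _).le, ← Real.exp_mul] at h2
    have hφ0 := h.pos s
    have hcp := Real.rpow_pos_of_pos hc0 (p - 1)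
    calc g s * φ s = (2 + lam) * (Real.exp (-(2 * s)) * φ s ^ (p - 1)) * φ s := by rw [dg]
      _ ≤ (2 + lam) * (Real.exp (-(2 * s)) * (c ^ (p - 1) * Real.exp (η * s * (p - 1)))) *
          (c * Real.exp (η * s)) := by gcongr
      _ = C * (Real.exp (-(2 * s)) * Real.exp (η * s * (p - 1)) * Real.exp (η * s)) := by
          rw [hC]; ring
      _ ≤ C * Real.exp (-(1 / 2 * s)) := by
          rw [← Real.exp_add, ← Real.exp_add]
          gcongr
          have h3 := mul_le_mul_of_nonneg_right hηp hs0
          have h4 := mul_le_mul_of_nonneg_right hη2 hs0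
          linarith
  -- the flux `k` is integrable, so `φ` stays bounded, against the singularity at the origin
  have hk : ∀ s, S' ≤ s → k s ≤ C / N * Real.exp (-(1 / 2 * s)) := by
    intro s hs
    have hN0 : 0 < N := by linarith
    have := nonpos_of_slow_growth (D := fun s => k s - C / N * Real.exp (-(1 / 2 * s)))
      (γ := N) (μ := μ) (C := M) (a := S') hμN
      (fun s _ => (h.hasDerivAt' s).sub ((hasDerivAt_exp_neg_mul (1 / 2) s).const_mul _))
      (fun s hs => by
        have h1 := hsource s (hS s (hSS.trans hs)).2
        have h2 := hsmall s hs
        have h3 : N * (C / N * Real.exp (-(1 / 2 * s))) = C * Real.exp (-(1 / 2 * s)) := by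
          field_simp
        have h4 : 0 ≤ C / N * (1 / 2 * Real.exp (-(1 / 2 * s))) := by positivity
        linarith)
      (fun s hs => by
        have h1 := (hb s (hS s (hSS.trans hs)).2).2.2.1
        have h4 : 0 ≤ C / N * Real.exp (-(1 / 2 * s)) := by positivity
        linarith) hs
    linarith
  have hmono := monotoneOn_Ici_of_hasDerivAt (a := S')
    (f := fun s => -(φ s + 2 * (C / N) * Real.exp (-(1 / 2 * s))))
    (fun s _ => ((h.hasDerivAt s).add ((hasDerivAt_exp_neg_mul (1 / 2) s).const_mul _)).neg)
    (fun s hs => by have := hk s hs; linarith)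
  obtain ⟨t, ht1, ht2⟩ := ((h.singular.eventually_gt_atTop
    (φ S' + 2 * (C / N) * Real.exp (-(1 / 2 * S')))).and (eventually_ge_atTop S')).exists
  have := hmono self_mem_Ici ht2 ht2
  have hN0 : 0 < N := by linarith
  have h4 : 0 ≤ 2 * (C / N) * Real.exp (-(1 / 2 * t)) := by positivity
  linarith

/-- Asymptotics of the profile at the origin, in logarithmic variables: `v = e^(-μs) φ` solves the
Emden-Fowler equation up to an error `R = O(e^(-κs))`, `κ = μ (p - q)`, caused by the lower order
terms. The anti-damping `N - 2μ` is positive because `p` is Sobolev supercritical. -/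
theorem IsLogProfile.asymptotics {N p q lam μ ω : ℝ} {φ k : ℝ → ℝ} (hN : 1 ≤ N)
    (hlam : 0 < lam) (hq : 1 < q) (hqp : q < p) (hμ : μ * (p - 1) = 2) (hμN : μ < N / 2)
    (hω : 0 < ω) (hω2 : ω ^ 2 = p * (μ * (N - μ)) - (N / 2) ^ 2)
    (h : IsLogProfile N p q lam φ k) :
    ∃ C s₀, 0 < C ∧ ∀ s, s₀ ≤ s →
      φ s ≤ C * Real.exp (μ * s) ∧ |k s| ≤ C * Real.exp (μ * s) ∧ Real.exp (μ * s) ≤ C * φ s ∧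
      |Real.exp (-(2 * s)) * φ s ^ (p - 1) - μ * (N - μ)| ≤ C * Real.exp (-(μ * (p - q) * s)) := by
  have hp : 1 < p := hq.trans hqp
  have hp1 : 0 < p - 1 := by linarith
  have hμ0 : 0 < μ := by
    by_contra hneg
    have : μ * (p - 1) ≤ 0 := mul_nonpos_of_nonpos_of_nonneg (not_lt.mp hneg) hp1.le
    linarith
  obtain ⟨a, M, hM, hb⟩ := h.upper_bound (by linarith) hlam hp hqp hμ (by linarith)
  set b := μ * (N - μ) with hb_def
  have hb0 : 0 < b := mul_pos hμ0 (by linarith)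
  set κ := μ * (p - q) with hκ_def
  have hκ0 : 0 < κ := mul_pos hμ0 (by linarith)
  have hκ2 : κ ≤ 2 := by
    rw [hκ_def, ← hμ]; gcongr
  have hμp : μ * p = μ + 2 := by linarith
  obtain ⟨v, dv⟩ : ∃ v : ℝ → ℝ, v = fun s => Real.exp (-(μ * s)) * φ s := ⟨_, rfl⟩
  obtain ⟨x, dx⟩ : ∃ x : ℝ → ℝ, x = fun s => Real.exp (-(μ * s)) * k s - μ * v s := ⟨_, rfl⟩
  obtain ⟨R, dR⟩ : ∃ R : ℝ → ℝ, R = fun s => Real.exp (-(2 * s)) *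
    ((lam - Real.exp (-(2 * s))) * v s) + Real.exp (-(κ * s)) * v s ^ q := ⟨_, rfl⟩
  have hφv : ∀ s, φ s = Real.exp (μ * s) * v s := fun s => by
    rw [dv]
    simp only
    rw [← mul_assoc, ← Real.exp_add]; simp
  have hv0 : ∀ s, 0 < v s := fun s => by rw [dv]; exact mul_pos (Real.exp_pos _) (h.pos s)
  have hv : ∀ s, HasDerivAt v (x s) s := by
    intro s
    have := (hasDerivAt_exp_neg_mul μ s).mul (h.hasDerivAt s)
    rw [dx, dv]
    exact this.congr_deriv (by ring)
  have hx : ∀ s, HasDerivAt x ((N - 2 * μ) * x s + b * v s - v s ^ p - R s) s := by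
    intro s
    have := ((hasDerivAt_exp_neg_mul μ s).mul (h.hasDerivAt' s)).sub ((hv s).const_mul μ)
    have hk : Real.exp (-(μ * s)) * k s = x s + μ * v s := by rw [dx]; ring
    have e1 : Real.exp (-(μ * s)) * (Real.exp (-(2 * s)) * φ s ^ p) = v s ^ p := by
      rw [hφv s, Real.mul_rpow (Real.exp_pos _).le (hv0 s).le, ← Real.exp_mul, ← mul_assoc,
        ← mul_assoc, ← Real.exp_add, ← Real.exp_add]
      have : -(μ * s) + -(2 * s) + μ * s * p = 0 := by
        have : μ * s * p = (μ * p) * s := by ring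
        rw [this, hμp]; ring
      rw [this, Real.exp_zero, one_mul]
    have e2 : Real.exp (-(μ * s)) * (Real.exp (-(2 * s)) * φ s ^ q) =
        Real.exp (-(κ * s)) * v s ^ q := by
      rw [hφv s, Real.mul_rpow (Real.exp_pos _).le (hv0 s).le, ← Real.exp_mul, ← mul_assoc,
        ← mul_assoc, ← Real.exp_add, ← Real.exp_add]
      congr 2
      have : κ = μ * p - μ * q := by rw [hκ_def]; ring
      rw [this, hμp]; ring
    have e3 : Real.exp (-(μ * s)) * φ s = v s := by rw [dv]
    have h0 := this
    change HasDerivAt (fun s => Real.exp (-(μ * s)) * k s - μ * v s) _ s at h0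
    rw [← dx] at h0
    refine h0.congr_deriv ?_
    simp only [dR]
    linear_combination (N - μ) * hk - e1 - e2 -
      Real.exp (-(2 * s)) * (lam - Real.exp (-(2 * s))) * e3 - v s * hb_def
  set s₀ := max a 0 with hs₀
  have hbd : ∀ s, s₀ ≤ s → v s ≤ M ∧ |x s| ≤ M + μ * M ∧
      |R s| ≤ (lam * M + M ^ q) * Real.exp (-(κ * s)) := by
    intro s hs
    have hsa : a ≤ s := (le_max_left _ _).trans hs
    have hs0 : 0 ≤ s := (le_max_right _ _).trans hs
    obtain ⟨h1, h2, h3, h4, h5⟩ := hb s hsa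
    have hee : Real.exp (-(μ * s)) * Real.exp (μ * s) = 1 := by rw [← Real.exp_add]; simp
    have hvM : v s ≤ M := by
      calc v s = Real.exp (-(μ * s)) * φ s := by rw [dv]
        _ ≤ Real.exp (-(μ * s)) * (M * Real.exp (μ * s)) := by gcongr
        _ = (Real.exp (-(μ * s)) * Real.exp (μ * s)) * M := by ring
        _ = M := by rw [hee, one_mul]
    have hkM : Real.exp (-(μ * s)) * k s ≤ M := by
      calc _ ≤ Real.exp (-(μ * s)) * (M * Real.exp (μ * s)) := by gcongr
        _ = (Real.exp (-(μ * s)) * Real.exp (μ * s)) * M := by ring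
        _ = M := by rw [hee, one_mul]
    refine ⟨hvM, ?_, ?_⟩
    · simp only [dx]
      have h6 : 0 ≤ Real.exp (-(μ * s)) * k s := by positivity
      have h7 : μ * v s ≤ μ * M := by gcongr
      have h8 : 0 < μ * v s := mul_pos hμ0 (hv0 s)
      have h9 : 0 < μ * M := mul_pos hμ0 hM
      rw [abs_le]; constructor <;> linarith
    · have h6 : Real.exp (-(2 * s)) ≤ Real.exp (-(κ * s)) := by
        apply Real.exp_le_exp.mpr
        have := mul_le_mul_of_nonneg_right hκ2 hs0
        linarith
      have h7 : 0 ≤ (lam - Real.exp (-(2 * s))) * v s := mul_nonneg (by linarith) (hv0 s).le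
      have h8 : (lam - Real.exp (-(2 * s))) * v s ≤ lam * M := by
        have := Real.exp_pos (-(2 * s))
        exact mul_le_mul (by linarith) hvM (hv0 s).le hlam.le
      have h9 := Real.rpow_le_rpow (hv0 s).le hvM (show 0 ≤ q by linarith)
      have h10 := Real.rpow_pos_of_pos (hv0 s) q
      simp only [dR]
      rw [abs_of_nonneg (by positivity)]
      calc _ ≤ Real.exp (-(κ * s)) * (lam * M) + Real.exp (-(κ * s)) * M ^ q := by gcongr
        _ = _ := by ring
  set M' := (M + μ * M) + (lam * M + M ^ q) with hM'
  have hMq := Real.rpow_pos_of_pos hM q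
  have ha0 : 0 < N - 2 * μ := by linarith
  have hM1 : 0 < μ * M := by positivity
  have hM2 : 0 < lam * M := by positivity
  have hRb : ∀ s, s₀ ≤ s → |R s| ≤ M' * Real.exp (-(κ * s)) := fun s hs =>
    (hbd s hs).2.2.trans (by gcongr; rw [hM']; linarith)
  obtain ⟨hx0, hdich⟩ := emdenFowler_convergence (M := M') ha0 hb0 hp hκ0 (le_max_right a 0)
    (fun s _ => hv s) (fun s _ => hx s) (fun s _ => hv0 s)
    (fun s hs => (hbd s hs).1.trans (by rw [hM']; linarith))
    (fun s hs => (hbd s hs).2.1.trans (by rw [hM']; linarith)) hRb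
  have hvA : Tendsto v atTop (𝓝 (b ^ (1 / (p - 1)))) := by
    rcases hdich with h0 | h1
    · exact (h.not_tendsto_zero hN hlam hq hqp hμ (by linarith) (by rw [dv] at h0; exact h0)).elim
    · exact h1
  obtain ⟨C₁, s₁, hC₁, hrate⟩ := emdenFowler_rate (M := M') ha0 hb0 hp hκ0 hω
    (by rw [hω2, hb_def]; ring) (fun s _ => hv s) (fun s _ => hx s) hRb hx0 hvA
  set A := b ^ (1 / (p - 1)) with hA
  have hA0 : 0 < A := Real.rpow_pos_of_pos hb0 _
  have hAp : A ^ (p - 1) = b := by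
    rw [hA, ← Real.rpow_mul hb0.le, one_div_mul_cancel hp1.ne', Real.rpow_one]
  -- the power function is Lipschitz near `A`
  obtain ⟨L, hL⟩ : ∃ L, ∀ᶠ y in 𝓝 A, |y ^ (p - 1) - A ^ (p - 1)| ≤ L * |y - A| := by
    have hd := (Real.hasDerivAt_rpow_const (p := p - 1) (Or.inl hA0.ne')).isBigO_sub
    obtain ⟨L, hL⟩ := hd.bound
    exact ⟨L, hL⟩
  obtain ⟨s₂, hs₂⟩ := eventually_atTop.mp (((hvA.eventually hL).and
    (hvA.eventually_const_le (show A / 2 < A by linarith))).and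
    ((eventually_ge_atTop s₀).and (eventually_ge_atTop s₁)))
  refine ⟨M + 2 / A + |L| * C₁, s₂, by positivity, fun s hs => ?_⟩
  obtain ⟨⟨h1, h2⟩, h3, h4⟩ := hs₂ s hs
  have hsa : a ≤ s := (le_max_left _ _).trans h3
  obtain ⟨hb1, hb2, hb3, -, -⟩ := hb s hsa
  have hC1 : 0 ≤ |L| * C₁ := by positivity
  have hC2 : 0 < 2 / A := by positivity
  refine ⟨hb1.trans (by gcongr; linarith), ?_, ?_, ?_⟩
  · rw [abs_of_nonneg hb2]
    exact hb3.trans (by gcongr; linarith)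
  · rw [hφv s]
    have he := Real.exp_pos (μ * s)
    have h5 : 1 ≤ 2 / A * v s := by
      rw [div_mul_eq_mul_div, le_div_iff₀ hA0]; linarith
    have h6 : 0 < v s := hv0 s
    calc Real.exp (μ * s) = 1 * Real.exp (μ * s) := (one_mul _).symm
      _ ≤ (2 / A * v s) * Real.exp (μ * s) := by gcongr
      _ = (2 / A) * (Real.exp (μ * s) * v s) := by ring
      _ ≤ _ := by gcongr; linarith
  · have e1 : Real.exp (-(2 * s)) * φ s ^ (p - 1) = v s ^ (p - 1) := by
      rw [hφv s, Real.mul_rpow (Real.exp_pos _).le (hv0 s).le, ← Real.exp_mul, ← mul_assoc,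
        ← Real.exp_add]
      have : -(2 * s) + μ * s * (p - 1) = 0 := by
        have : μ * s * (p - 1) = (μ * (p - 1)) * s := by ring
        rw [this, hμ]; ring
      rw [this, Real.exp_zero, one_mul]
    rw [e1, ← hAp]
    calc |v s ^ (p - 1) - A ^ (p - 1)| ≤ L * |v s - A| := h1
      _ ≤ |L| * (C₁ * Real.exp (-(κ * s))) := by
          gcongr
          · exact le_abs_self L
          · exact hrate s h4
      _ = (|L| * C₁) * Real.exp (-(κ * s)) := by ring
      _ ≤ _ := by gcongr; linarith

/-! ### The singular profile at infinity -/

/-- On compact intervals of `(0, ∞)` all continuous positive weights are comparable. -/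
theorem exists_bound_Icc {f g : ℝ → ℝ} {a b : ℝ} (ha : 0 < a) (hf : ContinuousOn f (Ioi 0))
    (hg : ContinuousOn g (Ioi 0)) (hg0 : ∀ r, 0 < r → 0 < g r) :
    ∃ C, 0 < C ∧ ∀ r, a ≤ r → r ≤ b → |f r| ≤ C * g r := by
  have hsub : Icc a b ⊆ Ioi 0 := fun r hr => ha.trans_le hr.1
  obtain ⟨C, hC⟩ := isCompact_Icc.exists_bound_of_continuousOn
    ((hf.mono hsub).div (hg.mono hsub) fun r hr => (hg0 r (hsub hr)).ne')
  refine ⟨|C| + 1, by positivity, fun r h1 h2 => ?_⟩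
  have hr := hg0 r (ha.trans_le h1)
  have := hC r ⟨h1, h2⟩
  rw [Real.norm_eq_abs, Pi.div_apply, abs_div, abs_of_pos hr, div_le_iff₀ hr] at this
  refine this.trans ?_
  gcongr
  linarith [le_abs_self C]

theorem exists_bound_of_eventually_atTop {f g : ℝ → ℝ} (hf : ContinuousOn f (Ioi 0))
    (hg : ContinuousOn g (Ioi 0)) (hg0 : ∀ r, 0 < r → 0 < g r)
    (h : ∃ C, ∀ᶠ r in atTop, |f r| ≤ C * g r) :
    ∃ C, 0 < C ∧ ∀ r, 1 ≤ r → |f r| ≤ C * g r := by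
  obtain ⟨C, hC⟩ := h
  obtain ⟨R, hR⟩ := eventually_atTop.mp hC
  obtain ⟨C', hC', hb⟩ := exists_bound_Icc (b := R) one_pos hf hg hg0
  refine ⟨|C| + C', by positivity, fun r hr => ?_⟩
  have hgr := hg0 r (by linarith)
  rcases le_total r R with h1 | h1
  · exact (hb r hr h1).trans (by gcongr; linarith [abs_nonneg C])
  · exact (hR r h1).trans (by gcongr; linarith [le_abs_self C])

theorem exists_bound_of_near_zero {f g : ℝ → ℝ} (hf : ContinuousOn f (Ioi 0))
    (hg : ContinuousOn g (Ioi 0)) (hg0 : ∀ r, 0 < r → 0 < g r)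
    (h : ∃ C δ, 0 < δ ∧ ∀ r, 0 < r → r ≤ δ → |f r| ≤ C * g r) :
    ∃ C, 0 < C ∧ ∀ r, 0 < r → r ≤ 1 → |f r| ≤ C * g r := by
  obtain ⟨C, δ, hδ, hC⟩ := h
  obtain ⟨C', hC', hb⟩ := exists_bound_Icc (b := 1) hδ hf hg hg0
  refine ⟨|C| + C', by positivity, fun r hr hr1 => ?_⟩
  have hgr := hg0 r hr
  rcases le_total δ r with h1 | h1
  · exact (hb r h1 hr1).trans (by gcongr; linarith [abs_nonneg C])
  · exact (hC r hr h1).trans (by gcongr; linarith [le_abs_self C])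

theorem continuousOn_rpow_Ioi (y : ℝ) : ContinuousOn (fun r : ℝ => r ^ y) (Ioi 0) := fun r hr =>
  (Real.continuousAt_rpow_const r y (Or.inl (ne_of_gt hr))).continuousWithinAt

theorem continuousOn_inv_sq : ContinuousOn (fun r : ℝ => (r ^ 2)⁻¹) (Ioi 0) := fun _ hr =>
  (hasDerivAt_inv_sq (ne_of_gt hr)).continuousAt.continuousWithinAt

theorem rpow_le_inv_sq_pow {r y : ℝ} {n : ℕ} (hr : 0 < r) (hr1 : r ≤ 1) (hy : -y ≤ 2 * n) :
    r ^ y ≤ ((r ^ 2)⁻¹) ^ n := by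
  have : ((r ^ 2)⁻¹) ^ n = r ^ (-(2 * n : ℝ)) := by
    rw [Real.rpow_neg hr.le, inv_pow, ← pow_mul, ← Real.rpow_natCast]
    push_cast
    rfl
  rw [this]
  exact Real.rpow_le_rpow_of_exponent_ge hr hr1 (by linarith)

theorem tendsto_exp_neg_sq_mul_rpow (y : ℝ) :
    Tendsto (fun r : ℝ => Real.exp (-(r ^ 2) / 2) * r ^ y) atTop (𝓝 0) := by
  have h := tendsto_rpow_mul_exp_neg_mul_atTop_nhds_zero y (1 / 2) (by norm_num)
  refine squeeze_zero' ?_ ?_ h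
  · filter_upwards [eventually_gt_atTop 0] with r hr
    have := Real.rpow_pos_of_pos hr y
    positivity
  · filter_upwards [eventually_ge_atTop 1] with r hr
    rw [mul_comm]
    have h1 : -(r ^ 2) / 2 ≤ -(1 / 2) * r := by nlinarith
    have := Real.rpow_pos_of_pos (show 0 < r by linarith) y
    gcongr

theorem IsProfile.continuousOn {d p q lam : ℝ} {Φ Φ₁ : ℝ → ℝ} (h : IsProfile d p q lam Φ Φ₁) :
    ContinuousOn Φ (Ioi 0) := fun r hr => (h.hasDerivAt r hr).continuousAt.continuousWithinAt

theorem IsProfile.continuousOn' {d p q lam : ℝ} {Φ Φ₁ : ℝ → ℝ} (h : IsProfile d p q lam Φ Φ₁) :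
    ContinuousOn Φ₁ (Ioi 0) := fun r hr => (h.hasDerivAt' r hr).continuousAt.continuousWithinAt

theorem IsProfile.continuousOn_rpow {d p q lam : ℝ} {Φ Φ₁ : ℝ → ℝ} (h : IsProfile d p q lam Φ Φ₁)
    (y : ℝ) : ContinuousOn (fun r => Φ r ^ y) (Ioi 0) := fun r hr =>
  ((h.hasDerivAt r hr).continuousAt.rpow_const (Or.inl (h.pos r hr).ne')).continuousWithinAt

/-- At infinity the profile decreases and decays exponentially; this is a first rough bound. -/
theorem IsProfile.exponential_decay {d p q lam : ℝ} {Φ Φ₁ : ℝ → ℝ} (hd : 1 ≤ d) (hp : 1 < p)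
    (hq : 1 < q) (h : IsProfile d p q lam Φ Φ₁) :
    ∃ C, ∀ᶠ r in atTop, Φ r ≤ C * Real.exp (-r) ∧ |Φ₁ r| ≤ C := by
  have hlim : ∀ y : ℝ, 1 < y → Tendsto (fun r => Φ r ^ (y - 1)) atTop (𝓝 0) := fun y hy => by
    have := h.tendsto_zero.rpow_const (p := y - 1) (Or.inr (by linarith))
    rwa [Real.zero_rpow (by linarith)] at this
  obtain ⟨R, hR⟩ := eventually_atTop.mp (((eventually_ge_atTop (|lam| + 2)).and
    ((hlim p hp).eventually_le_const (show (0 : ℝ) < 1 / 2 by norm_num))).and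
    ((hlim q hq).eventually_le_const (show (0 : ℝ) < 1 / 2 by norm_num)))
  have hfac : ∀ y : ℝ, 1 < y → ∀ r, 0 < r → Φ r ^ y = Φ r ^ (y - 1) * Φ r := fun y hy r hr => by
    rw [← Real.rpow_add_one' (h.pos r hr).le (by linarith)]; congr 1; ring
  have hcoef : ∀ r, R ≤ r → 0 < r ∧ Φ r ≤ (r ^ 2 - lam) * Φ r - Φ r ^ q - Φ r ^ p := by
    intro r hr
    obtain ⟨⟨h1, h2⟩, h3⟩ := hR r hr
    have hl := abs_nonneg lam
    have hr0 : 0 < r := by linarith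
    refine ⟨hr0, ?_⟩
    rw [hfac p hp r hr0, hfac q hq r hr0]
    have h4 : 1 ≤ r ^ 2 - lam - Φ r ^ (q - 1) - Φ r ^ (p - 1) := by
      have := le_abs_self lam
      nlinarith
    have := mul_le_mul_of_nonneg_right h4 (h.pos r hr0).le
    linarith
  have hW : ∀ r, R ≤ r → HasDerivAt (fun r => r ^ (d - 1) * Φ₁ r)
      (r ^ (d - 1) * ((r ^ 2 - lam) * Φ r - Φ r ^ q - Φ r ^ p)) r := by
    intro r hr
    have hr0 := (hcoef r hr).1
    refine ((Real.hasDerivAt_rpow_const (p := d - 1) (Or.inl hr0.ne')).mul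
      (h.hasDerivAt' r hr0)).congr_deriv ?_
    rw [Real.rpow_sub_one hr0.ne' (d - 1)]
    field_simp
    ring
  have hWmono := monotoneOn_Ici_of_hasDerivAt hW (fun r hr => by
    have h1 := (hcoef r hr).2
    have h2 := h.pos r (hcoef r hr).1
    have h3 := Real.rpow_pos_of_pos (hcoef r hr).1 (d - 1)
    exact mul_nonneg h3.le (by linarith))
  have hneg : ∀ r, R ≤ r → Φ₁ r ≤ 0 := by
    intro r hr
    by_contra hcon
    have hr0 := (hcoef r hr).1
    have hpos : 0 < r ^ (d - 1) * Φ₁ r :=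
      mul_pos (Real.rpow_pos_of_pos hr0 _) (not_le.mp hcon)
    have hmono := monotoneOn_Ici_of_hasDerivAt (a := r)
      (fun t ht => h.hasDerivAt t (hr0.trans_le ht)) (fun t ht => by
        have h1 := hWmono hr (hr.trans ht) ht
        have h2 := Real.rpow_pos_of_pos (hr0.trans_le ht) (d - 1)
        exact (pos_of_mul_pos_right (hpos.trans_le h1) h2.le).le)
    obtain ⟨t, ht1, ht2⟩ := ((h.tendsto_zero.eventually_lt_const (h.pos r hr0)).and
      (eventually_ge_atTop r)).exists
    have := hmono self_mem_Ici ht2 ht2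
    linarith
  -- `Φ'² - Φ²` is nonincreasing with nonnegative limit
  have hsq : ∀ r, R ≤ r → Φ r ≤ -Φ₁ r := by
    intro r hr
    have hanti := monotoneOn_Ici_of_hasDerivAt (a := R) (f := fun r => Φ r ^ 2 - Φ₁ r ^ 2)
      (fun t ht => ((h.hasDerivAt t (hcoef t ht).1).pow 2).sub
        ((h.hasDerivAt' t (hcoef t ht).1).pow 2))
      (fun t ht => by
        obtain ⟨ht0, h1⟩ := hcoef t ht
        have h2 := hneg t ht
        have h3 : 0 ≤ -((d - 1) / t) * Φ₁ t := by
          have : 0 ≤ (d - 1) / t := div_nonneg (by linarith) ht0.le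
          nlinarith
        norm_num
        have h4 : Φ t ≤ -((d - 1) / t) * Φ₁ t + (t ^ 2 - lam) * Φ t - Φ t ^ q - Φ t ^ p := by
          linarith
        have h5 := mul_le_mul_of_nonpos_left h4 h2
        linarith)
    have hle : Φ r ^ 2 - Φ₁ r ^ 2 ≤ 0 := by
      have hl : Tendsto (fun t => Φ t ^ 2) atTop (𝓝 0) := by simpa using h.tendsto_zero.pow 2
      refine ge_of_tendsto hl ?_
      filter_upwards [eventually_ge_atTop r] with t ht
      have h1 := hanti hr (hr.trans ht) ht
      have h2 := sq_nonneg (Φ₁ t)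
      simp only at h1
      linarith
    have hΦ := h.pos r (hcoef r hr).1
    have h2 := hneg r hr
    have h3 : Φ r ^ 2 ≤ (-Φ₁ r) ^ 2 := by rw [neg_sq]; linarith
    exact (pow_le_pow_iff_left₀ hΦ.le (by linarith) two_ne_zero).mp h3
  have hR1 : ∀ r, R ≤ r → 1 ≤ r := fun r hr => by
    have := (hR r hr).1.1
    have := abs_nonneg lam
    linarith
  refine ⟨Φ R * Real.exp R + R ^ (d - 1) * |Φ₁ R|, ?_⟩
  filter_upwards [eventually_ge_atTop R] with r hr
  have hR0 : 0 < R := (hcoef R le_rfl).1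
  have hRd := Real.rpow_pos_of_pos hR0 (d - 1)
  have hΦR := h.pos R hR0
  constructor
  · have hanti := monotoneOn_Ici_of_hasDerivAt (a := R) (f := fun r => -(Φ r * Real.exp r))
      (fun t ht => ((h.hasDerivAt t (hcoef t ht).1).mul (Real.hasDerivAt_exp t)).neg)
      (fun t ht => by
        have := mul_le_mul_of_nonneg_right (hsq t ht) (Real.exp_pos t).le
        linarith) self_mem_Ici hr hr
    have h1 : Φ r * Real.exp r ≤ Φ R * Real.exp R := by simpa using hanti
    calc Φ r = Φ r * Real.exp r * Real.exp (-r) := by rw [mul_assoc, ← Real.exp_add]; simp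
      _ ≤ _ := by
        gcongr
        have : 0 ≤ R ^ (d - 1) * |Φ₁ R| := by positivity
        linarith
  · have h1 : R ^ (d - 1) * Φ₁ R ≤ r ^ (d - 1) * Φ₁ r := hWmono self_mem_Ici hr hr
    have h2 := hneg r hr
    have h3 := hneg R le_rfl
    have h4 : 1 ≤ r ^ (d - 1) := Real.one_le_rpow (hR1 r hr) (by linarith)
    rw [abs_of_nonpos h2, abs_of_nonpos h3]
    have h5 : 0 < Φ R * Real.exp R := by positivity
    nlinarith

/-- The profile has an exact Gaussian tail: it is a multiple of the decaying solution of the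
linear equation with potential `Φ^(p-1) + Φ^(q-1)`, as their Wronskian vanishes. -/
theorem IsProfile.gaussian_tail {d p q lam : ℝ} {Φ Φ₁ : ℝ → ℝ} (hd : 1 ≤ d) (hlam : lam ≤ d)
    (hp : 1 < p) (hq : 1 < q) (h : IsProfile d p q lam Φ Φ₁)
    (hpot : ∃ B, ∀ r, 0 < r → Φ r ^ (p - 1) + Φ r ^ (q - 1) ≤ B * (r ^ 2)⁻¹) :
    ∃ K M, 0 < K ∧ ∀ᶠ r in atTop,
      |Φ r - K * gaussianTail d lam r| ≤ M * (gaussianTail d lam r * (r ^ 2)⁻¹) ∧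
      |Φ₁ r / r + Φ r| ≤ M * (gaussianTail d lam r * (r ^ 2)⁻¹) := by
  obtain ⟨B, hB⟩ := hpot
  set m := (lam - d) / 2 with hm
  set c := m * (m + d + 0 - 2) with hc
  set G := gaussianTail d lam with hG_def
  have hG : ∀ r, 0 < r → 0 < G r := fun r hr => gaussianTail_pos d lam hr
  have hpot0 : ∀ r, 0 < r → 0 < Φ r ^ (p - 1) + Φ r ^ (q - 1) := fun r hr =>
    add_pos (Real.rpow_pos_of_pos (h.pos r hr) _) (Real.rpow_pos_of_pos (h.pos r hr) _)
  have hB0 : 0 < B := by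
    have := (hpot0 1 one_pos).trans_le (hB 1 one_pos); simpa using this
  have hpotc : ContinuousOn (fun r => Φ r ^ (p - 1) + Φ r ^ (q - 1)) (Ioi 0) :=
    (h.continuousOn_rpow _).add (h.continuousOn_rpow _)
  obtain ⟨n, hn⟩ := exists_nat_ge (-m)
  -- `θ = G + w` is the solution of the linear equation satisfied by `Φ` with `θ ~ G` at infinity;
  -- the exact Gaussian profile `G` leaves the error `c r⁻² G`
  obtain ⟨w, w₁, hw⟩ := exists_isDecayingSolution (d := d) (lam := lam) (ε := 0) (B := B)
    (B₀ := B + |c|) (n := n + 1)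
    (H := fun r x => (Φ r ^ (p - 1) + Φ r ^ (q - 1)) * (x + G r) + c * (r ^ 2)⁻¹ * G r) hlam
    (by
      have h1 : ContinuousOn (fun z : ℝ × ℝ => G z.1) (Ioi 0 ×ˢ univ) :=
        (continuousOn_gaussianTail d lam).comp continuousOn_fst fun z hz => hz.1
      have h2 : ContinuousOn (fun z : ℝ × ℝ => Φ z.1 ^ (p - 1) + Φ z.1 ^ (q - 1))
          (Ioi 0 ×ˢ univ) :=
        hpotc.comp continuousOn_fst fun z hz => hz.1
      have h3 : ContinuousOn (fun z : ℝ × ℝ => (z.1 ^ 2)⁻¹) (Ioi 0 ×ˢ univ) :=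
        continuousOn_inv_sq.comp continuousOn_fst fun z hz => hz.1
      exact (h2.mul (continuousOn_snd.add h1)).add ((continuousOn_const.mul h3).mul h1))
    (by
      intro r hr x y
      rw [show (Φ r ^ (p - 1) + Φ r ^ (q - 1)) * (x + G r) + c * (r ^ 2)⁻¹ * G r -
        ((Φ r ^ (p - 1) + Φ r ^ (q - 1)) * (y + G r) + c * (r ^ 2)⁻¹ * G r) =
        (Φ r ^ (p - 1) + Φ r ^ (q - 1)) * (x - y) by ring, abs_mul, abs_of_pos (hpot0 r hr)]
      gcongr
      exact hB r hr)
    (by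
      intro r hr
      have hr0 : 0 < r := by linarith
      have hGr := hG r hr0
      rw [zero_add, ← add_mul, abs_mul, abs_of_pos hGr]
      calc _ ≤ (B * (r ^ 2)⁻¹ + |c| * (r ^ 2)⁻¹) * G r := by
            gcongr
            refine (abs_add_le _ _).trans (add_le_add ?_ ?_)
            · rw [abs_of_pos (hpot0 r hr0)]; exact hB r hr0
            · rw [abs_mul, abs_of_pos (by positivity : 0 < (r ^ 2)⁻¹)]
        _ = _ := by ring)
    (by
      intro r hr0 hr1
      have hGr := hG r hr0
      rw [zero_add, ← add_mul, abs_mul, abs_of_pos hGr]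
      have hGle : G r ≤ ((r ^ 2)⁻¹) ^ n := by
        have h1 : r ^ m ≤ ((r ^ 2)⁻¹) ^ n := rpow_le_inv_sq_pow hr0 hr1 (by
          have : (0 : ℝ) ≤ n := n.cast_nonneg
          linarith)
        have h2 : Real.exp (-(r ^ 2) / 2) ≤ 1 :=
          Real.exp_le_one_iff.mpr (by have := sq_nonneg r; linarith)
        have h3 := Real.rpow_pos_of_pos hr0 m
        calc G r = Real.exp (-(r ^ 2) / 2) * r ^ m := rfl
          _ ≤ 1 * r ^ m := by gcongr
          _ ≤ _ := by rw [one_mul]; exact h1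
      calc _ ≤ (B * (r ^ 2)⁻¹ + |c| * (r ^ 2)⁻¹) * ((r ^ 2)⁻¹) ^ n := by
            gcongr
            refine (abs_add_le _ _).trans (add_le_add ?_ ?_)
            · rw [abs_of_pos (hpot0 r hr0)]; exact hB r hr0
            · rw [abs_mul, abs_of_pos (by positivity : 0 < (r ^ 2)⁻¹)]
        _ = _ := by rw [pow_succ]; ring)
  obtain ⟨M, hM⟩ := hw.decay
  obtain ⟨θ, dθ⟩ : ∃ θ : ℝ → ℝ, θ = fun r => G r + w r := ⟨_, rfl⟩
  obtain ⟨θ₁, dθ₁⟩ : ∃ θ₁ : ℝ → ℝ, θ₁ = fun r => (-r + m / r) * G r + w₁ r := ⟨_, rfl⟩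
  have hθ : ∀ r, 0 < r → HasDerivAt θ (θ₁ r) r := fun r hr => by
    rw [dθ, dθ₁]
    exact (hasDerivAt_gaussianTail d lam hr).add (hw.hasDerivAt r hr)
  have hθ₁ : ∀ r, 0 < r → HasDerivAt θ₁ (-((d - 1) / r) * θ₁ r + (r ^ 2 - lam) * θ r
      - (Φ r ^ (p - 1) + Φ r ^ (q - 1)) * θ r) r := fun r hr => by
    have h1 := (hasDerivAt_gauge (d := d) (lam := lam) (ε := 0) (g := fun _ => 1)
      (h := fun _ => 0) (J := 0) hr (hasDerivAt_const r (1 : ℝ)) (by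
        simpa using hasDerivAt_const r (0 : ℝ))).2
    have h2 := h1.add (hw.hasDerivAt' r hr)
    have e : (fun r => gaussianTail d lam r * (0 + (-r + (lam - d) / 2 / r) * 1)) + w₁ = θ₁ := by
      funext r
      simp only [Pi.add_apply, dθ₁, zero_add, mul_one]
      rw [mul_comm]
    rw [e] at h2
    refine h2.congr_deriv ?_
    simp only [dθ, dθ₁, hc]
    rw [← hm, ← hG_def]
    ring
  -- the Wronskian of `θ` and `Φ` in divergence form: constant, and `0` at infinity
  obtain ⟨W, dW⟩ : ∃ W : ℝ → ℝ, W = fun r => r ^ (d - 1) * (θ r * Φ₁ r - θ₁ r * Φ r) := ⟨_, rfl⟩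
  have hfac : ∀ y : ℝ, 1 < y → ∀ r, 0 < r → Φ r ^ y = Φ r ^ (y - 1) * Φ r := fun y hy r hr => by
    rw [← Real.rpow_add_one' (h.pos r hr).le (by linarith)]; congr 1; ring
  have hW : ∀ r, 0 < r → HasDerivAt W 0 r := by
    intro r hr
    rw [dW]
    refine ((Real.hasDerivAt_rpow_const (p := d - 1) (Or.inl hr.ne')).mul
      (((hθ r hr).mul (h.hasDerivAt' r hr)).sub
        ((hθ₁ r hr).mul (h.hasDerivAt r hr)))).congr_deriv ?_
    rw [hfac p hp r hr, hfac q hq r hr, Real.rpow_sub_one hr.ne' (d - 1)]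
    simp only [Pi.sub_apply, Pi.mul_apply]
    field_simp
    ring
  -- bounds for `θ`
  have hM0 : 0 ≤ M := by
    have h1 := (abs_nonneg _).trans (hM 1 le_rfl).1
    have h2 := hG 1 one_pos
    by_contra hneg
    have : M * (G 1 * (1 ^ 2)⁻¹) < 0 := mul_neg_of_neg_of_pos (not_le.mp hneg) (by positivity)
    linarith
  have hθb : ∀ r, 1 ≤ r → |θ r - G r| ≤ M * (G r * (r ^ 2)⁻¹) := fun r hr => by
    have := (hM r hr).1
    simpa [dθ] using this
  have hθ₁b : ∀ r, 1 ≤ r → |θ₁ r + r * θ r| ≤ (|m| + M) * (G r * r⁻¹) := fun r hr => by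
    have hr0 : 0 < r := by linarith
    have hGr := hG r hr0
    have e : θ₁ r + r * θ r = m * (G r * r⁻¹) + (w₁ r + r * w r) := by
      simp only [dθ, dθ₁]; field_simp; ring
    have hi : (r ^ 3)⁻¹ ≤ r⁻¹ := by
      apply inv_anti₀ hr0
      nlinarith [mul_le_mul hr hr zero_le_one hr0.le]
    rw [e, add_mul]
    refine (abs_add_le _ _).trans (add_le_add ?_ ((hM r hr).2.trans (by gcongr)))
    rw [abs_mul, abs_of_pos (by positivity : 0 < G r * r⁻¹)]
  obtain ⟨C₀, hC₀⟩ := h.exponential_decay hd hp hq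
  have hW0 : ∀ r, 0 < r → W r = 0 := by
    have hlim : Tendsto W atTop (𝓝 0) := by
      have hbig : Tendsto (fun r : ℝ => ((1 + M) * |C₀| + (|m| + M + 1 + M)) *
          (Real.exp (-(r ^ 2) / 2) * r ^ (m + d))) atTop (𝓝 0) := by
        simpa using (tendsto_exp_neg_sq_mul_rpow (m + d)).const_mul
          ((1 + M) * |C₀| + (|m| + M + 1 + M))
      refine squeeze_zero_norm' ?_ hbig
      filter_upwards [eventually_ge_atTop 1, hC₀,
        h.tendsto_zero.eventually_le_const one_pos] with r hr hC hΦ1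
      have hr0 : 0 < r := by linarith
      have hGr := hG r hr0
      have hΦ0 := h.pos r hr0
      have hi2 : (r ^ 2)⁻¹ ≤ 1 := inv_le_one_of_one_le₀ (one_le_pow₀ hr)
      have hi1 : r⁻¹ ≤ 1 := inv_le_one_of_one_le₀ hr
      have h1 : |θ r| ≤ (1 + M) * G r := by
        have h2 := hθb r hr
        have h3 : M * (G r * (r ^ 2)⁻¹) ≤ M * (G r * 1) := by gcongr
        have h4 := abs_sub_abs_le_abs_sub (θ r) (G r)
        rw [abs_of_pos hGr] at h4
        linarith
      have h5 : |θ₁ r| ≤ (|m| + M + 1 + M) * (r * G r) := by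
        have h2 := hθ₁b r hr
        have h3 : (|m| + M) * (G r * r⁻¹) ≤ (|m| + M) * (r * G r) := by
          have : G r * r⁻¹ ≤ G r * r := by gcongr; linarith
          have := mul_le_mul_of_nonneg_left this (by positivity : 0 ≤ |m| + M)
          linarith
        have h4 := abs_sub (θ₁ r + r * θ r) (r * θ r)
        rw [add_sub_cancel_right, abs_mul r, abs_of_pos hr0] at h4
        have h6 := mul_le_mul_of_nonneg_left h1 hr0.le
        linarith
      have hGr' : r ^ (d - 1) * (r * G r) = Real.exp (-(r ^ 2) / 2) * r ^ (m + d) := by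
        have : r ^ (d - 1) * r = r ^ d := by
          rw [← Real.rpow_add_one hr0.ne']; congr 1; ring
        rw [← mul_assoc, this, Real.rpow_add hr0]
        simp only [hG_def, gaussianTail, ← hm]
        ring
      have hrd := Real.rpow_pos_of_pos hr0 (d - 1)
      have hΦC : |Φ₁ r| ≤ |C₀| := hC.2.trans (le_abs_self _)
      rw [Real.norm_eq_abs, dW, ← hGr']
      simp only
      rw [abs_mul, abs_of_pos hrd]
      calc r ^ (d - 1) * |θ r * Φ₁ r - θ₁ r * Φ r|
          ≤ r ^ (d - 1) * ((1 + M) * (r * G r) * |C₀| + (|m| + M + 1 + M) * (r * G r) * 1) := by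
            gcongr
            refine (abs_sub _ _).trans (add_le_add ?_ ?_)
            · rw [abs_mul]
              have : (1 + M) * G r ≤ (1 + M) * (r * G r) := by
                have := mul_le_mul_of_nonneg_right hr hGr.le
                have := mul_le_mul_of_nonneg_left this (by positivity : 0 ≤ 1 + M)
                linarith
              exact mul_le_mul (h1.trans this) hΦC (abs_nonneg _) (by positivity)
            · rw [abs_mul, abs_of_pos hΦ0]
              exact mul_le_mul h5 hΦ1 hΦ0.le (by positivity)
        _ = _ := by ring
    intro r hr
    have h1 := ge_limit_of_deriv_nonpos (R := r) (fun t ht => hW t (hr.trans_le ht))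
      (fun _ _ => le_rfl) hlim le_rfl
    have h2 := le_limit_of_deriv_nonneg (R := r) (fun t ht => hW t (hr.trans_le ht))
      (fun _ _ => le_rfl) hlim le_rfl
    linarith
  have hθpos : ∀ r, 1 + 2 * M ≤ r → G r / 2 ≤ θ r := by
    intro r hr
    have hr1 : 1 ≤ r := by linarith
    have hr0 : 0 < r := by linarith
    have h1 := (abs_le.mp (hθb r hr1)).1
    have hGr := hG r hr0
    have h2 : M * (r ^ 2)⁻¹ ≤ 1 / 2 := by
      rw [← div_eq_mul_inv, div_le_iff₀ (by positivity)]
      nlinarith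
    have h3 : M * (G r * (r ^ 2)⁻¹) ≤ G r * (1 / 2) := by
      calc _ = G r * (M * (r ^ 2)⁻¹) := by ring
        _ ≤ _ := by gcongr
    linarith
  set R := 1 + 2 * M with hR
  have hR1 : 1 ≤ R := by linarith
  have hθ0 : ∀ r, R ≤ r → 0 < θ r := fun r hr => by
    have := hθpos r hr
    have := hG r (by linarith)
    linarith
  set K := Φ R / θ R with hK
  have hK0 : 0 < K := div_pos (h.pos R (by linarith)) (hθ0 R le_rfl)
  have hWz : ∀ r, 0 < r → θ r * Φ₁ r = θ₁ r * Φ r := fun r hr => by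
    have h1 := hW0 r hr
    rw [dW] at h1
    rcases mul_eq_zero.mp h1 with h2 | h2
    · exact absurd h2 (Real.rpow_pos_of_pos hr _).ne'
    · linarith
  have hquot : ∀ r, R ≤ r → HasDerivAt (fun r => Φ r / θ r) 0 r := by
    intro r hr
    have hr0 : 0 < r := by linarith
    refine ((h.hasDerivAt r hr0).div (hθ r hr0) (hθ0 r hr).ne').congr_deriv ?_
    rw [div_eq_zero_iff]
    left
    have := hWz r hr0
    linarith
  have hΦK : ∀ r, R ≤ r → Φ r = K * θ r := by
    intro r hr
    have h1 := monotoneOn_Ici_of_hasDerivAt hquot (fun _ _ => le_rfl) self_mem_Ici hr hr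
    have h2 := monotoneOn_Ici_of_hasDerivAt (fun r hr => (hquot r hr).neg)
      (fun _ _ => by simp) self_mem_Ici hr hr
    have h3 : Φ r / θ r = K := by
      simp only [Pi.neg_apply] at h2
      linarith
    rw [← h3, div_mul_cancel₀ _ (hθ0 r hr).ne']
  have hΦ₁K : ∀ r, R ≤ r → Φ₁ r = K * θ₁ r := by
    intro r hr
    have h1 := hWz r (by linarith)
    rw [hΦK r hr] at h1
    have := (hθ0 r hr).ne'
    have h2 : θ r * (Φ₁ r - K * θ₁ r) = 0 := by linarith
    rcases mul_eq_zero.mp h2 with h3 | h3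
    · exact absurd h3 this
    · linarith
  refine ⟨K, K * (|m| + M), hK0, ?_⟩
  filter_upwards [eventually_ge_atTop R] with r hr
  have hr1 : 1 ≤ r := by linarith
  have hr0 : 0 < r := by linarith
  have hGr := hG r hr0
  constructor
  · rw [hΦK r hr, ← mul_sub, abs_mul, abs_of_pos hK0, mul_assoc]
    gcongr
    refine (hθb r hr1).trans ?_
    gcongr
    linarith [abs_nonneg m]
  · have e : Φ₁ r / r + Φ r = K * ((θ₁ r + r * θ r) / r) := by
      rw [hΦK r hr, hΦ₁K r hr]; field_simp
    rw [e, abs_mul, abs_of_pos hK0, mul_assoc, abs_div, abs_of_pos hr0]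
    gcongr
    rw [div_le_iff₀ hr0]
    refine (hθ₁b r hr1).trans (le_of_eq ?_)
    field_simp

/-! ### Two-sided bounds for the singular profile -/

/-- The weight dual to the norm of the problem: a multiple of `r^(-(d-2)/2)` on `(0, 1]` and
`e^(-r²/2) r^((lam-d)/2-2)` on `[1, ∞)`. -/
def decayWeight (d lam r : ℝ) : ℝ :=
  min r 1 ^ (-((d - 2) / 2)) * (gaussianTail d lam (max r 1) * (max r 1 ^ 2)⁻¹)

theorem decayWeight_of_le_one (d lam : ℝ) {r : ℝ} (hr : r ≤ 1) :
    decayWeight d lam r = r ^ (-((d - 2) / 2)) * Real.exp (-1 / 2) := by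
  simp [decayWeight, gaussianTail, hr]

theorem decayWeight_of_one_le (d lam : ℝ) {r : ℝ} (hr : 1 ≤ r) :
    decayWeight d lam r = gaussianTail d lam r * (r ^ 2)⁻¹ := by
  simp [decayWeight, hr]

theorem decayWeight_pos (d lam : ℝ) {r : ℝ} (hr : 0 < r) : 0 < decayWeight d lam r := by
  have h1 : 0 < max r 1 := lt_max_of_lt_left hr
  have h2 := gaussianTail_pos d lam h1
  have h3 := Real.rpow_pos_of_pos (lt_min hr one_pos) (-((d - 2) / 2))
  unfold decayWeight
  positivity

theorem continuousOn_decayWeight (d lam : ℝ) : ContinuousOn (decayWeight d lam) (Ioi 0) := by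
  have h1 : ContinuousOn (fun r : ℝ => min r 1) (Ioi 0) :=
    (continuous_id.min continuous_const).continuousOn
  have h2 : ContinuousOn (fun r : ℝ => max r 1) (Ioi 0) :=
    (continuous_id.max continuous_const).continuousOn
  have hm : MapsTo (fun r : ℝ => max r 1) (Ioi 0) (Ioi 0) := fun r hr =>
    mem_Ioi.mpr (lt_max_of_lt_left hr)
  refine (h1.rpow_const fun r hr => Or.inl (lt_min hr one_pos).ne').mul
    (((continuousOn_gaussianTail d lam).comp h2 hm).mul ((h2.pow 2).inv₀ fun r hr => ?_))
  exact (pow_pos (hm hr) 2).ne'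

theorem exists_bound_of_zero_of_infinity {f g : ℝ → ℝ} (hg : ∀ r, 0 < r → 0 ≤ g r)
    (h0 : ∃ C, 0 < C ∧ ∀ r, 0 < r → r ≤ 1 → f r ≤ C * g r)
    (h1 : ∃ C, 0 < C ∧ ∀ r, 1 ≤ r → f r ≤ C * g r) :
    ∃ C, 0 < C ∧ ∀ r, 0 < r → f r ≤ C * g r := by
  obtain ⟨C, hC, h0⟩ := h0
  obtain ⟨C', hC', h1⟩ := h1
  refine ⟨C + C', by positivity, fun r hr => ?_⟩
  have hgr := hg r hr
  rcases le_total r 1 with h | h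
  · exact (h0 r hr h).trans (by gcongr; linarith)
  · exact (h1 r h).trans (by gcongr; linarith)

/-- The asymptotics at the origin in the original variable: `Φ` is comparable to `r^(-μ)`, and
`r² Φ^(p-1)` tends to `μ (d - 2 - μ)` at a polynomial rate. -/
theorem IsProfile.near_zero {d p q lam μ ω : ℝ} {Φ Φ₁ : ℝ → ℝ} (hd : 3 ≤ d) (hlam : 0 < lam)
    (hq : 1 < q) (hqp : q < p) (hμ : μ * (p - 1) = 2) (hμd : μ < (d - 2) / 2) (hω : 0 < ω)
    (hω2 : ω ^ 2 = p * (μ * (d - 2 - μ)) - ((d - 2) / 2) ^ 2)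
    (h : IsProfile d p q lam Φ Φ₁) :
    ∃ C δ, 0 < C ∧ 0 < δ ∧ ∀ r, 0 < r → r ≤ δ →
      Φ r ≤ C * r ^ (-μ) ∧ |r * Φ₁ r| ≤ C * r ^ (-μ) ∧ r ^ (-μ) ≤ C * Φ r ∧
      |r ^ 2 * Φ r ^ (p - 1) - μ * (d - 2 - μ)| ≤ C * r ^ (μ * (p - q)) := by
  obtain ⟨C, s₀, hC, hb⟩ := h.isLogProfile.asymptotics (by linarith) hlam hq hqp hμ hμd hω hω2
  refine ⟨C, Real.exp (-s₀), hC, Real.exp_pos _, fun r hr hrδ => ?_⟩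
  have hs : s₀ ≤ -Real.log r := by
    have := (Real.log_le_iff_le_exp hr).mpr hrδ
    linarith
  obtain ⟨h1, h2, h3, h4⟩ := hb _ hs
  have e1 : Real.exp (- -Real.log r) = r := by rw [neg_neg, Real.exp_log hr]
  have e2 : Real.exp (μ * -Real.log r) = r ^ (-μ) := by
    rw [Real.rpow_def_of_pos hr]; congr 1; ring
  have e3 : Real.exp (-(2 * -Real.log r)) = r ^ 2 := by
    rw [← Real.rpow_natCast, Real.rpow_def_of_pos hr]; congr 1; push_cast; ring
  have e4 : Real.exp (-(μ * (p - q) * -Real.log r)) = r ^ (μ * (p - q)) := by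
    rw [Real.rpow_def_of_pos hr]; congr 1; ring
  rw [e1, e2] at h1 h2 h3
  rw [e1, e3, e4] at h4
  rw [abs_neg] at h2
  exact ⟨h1, h2, h3, h4⟩

/-- Powers of the profile decay faster than any power at infinity. -/
theorem IsProfile.rpow_decay {d p q lam : ℝ} {Φ Φ₁ : ℝ → ℝ} (hd : 1 ≤ d) (hp : 1 < p) (hq : 1 < q)
    (h : IsProfile d p q lam Φ Φ₁) {y : ℝ} (hy : 0 < y) (k : ℕ) :
    ∃ C, 0 < C ∧ ∀ r, 1 ≤ r → Φ r ^ y ≤ C * (r ^ k)⁻¹ := by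
  obtain ⟨C, hC⟩ := h.exponential_decay hd hp hq
  have hlim := tendsto_rpow_mul_exp_neg_mul_atTop_nhds_zero k y hy
  obtain ⟨C', hC', hb⟩ := exists_bound_of_eventually_atTop (f := fun r => Φ r ^ y)
    (g := fun r => (r ^ k)⁻¹) (h.continuousOn_rpow y)
    ((continuous_pow k).continuousOn.inv₀ fun r hr => (pow_pos hr k).ne')
    (fun r hr => inv_pos.mpr (pow_pos hr k)) ⟨|C| ^ y, by
      filter_upwards [hC, hlim.eventually_le_const one_pos, eventually_gt_atTop 0] with r h1 h2 hr
      have hΦ := h.pos r hr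
      rw [abs_of_pos (Real.rpow_pos_of_pos hΦ y)]
      have h3 : Φ r ≤ |C| * Real.exp (-r) := h1.1.trans (by gcongr; exact le_abs_self C)
      refine (Real.rpow_le_rpow hΦ.le h3 hy.le).trans ?_
      rw [Real.mul_rpow (abs_nonneg C) (Real.exp_pos _).le, ← Real.exp_mul]
      gcongr
      rw [Real.rpow_natCast] at h2
      rw [le_inv_comm₀ (Real.exp_pos _) (pow_pos hr k), ← Real.exp_neg]
      have h4 : Real.exp (-y * r) = (Real.exp (y * r))⁻¹ := by rw [← Real.exp_neg]; congr 1; ring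
      rw [h4, ← div_eq_mul_inv, div_le_one (Real.exp_pos _)] at h2
      refine h2.trans (le_of_eq ?_)
      congr 1; ring⟩
  exact ⟨C', hC', fun r hr => (le_abs_self _).trans (hb r hr)⟩

/-- The properties of the singular profile that the perturbation argument uses. With
`t = min r 1` and `E = max r 1`, each bound reads as a power law in `t` at the origin and as a
decay estimate in `E` at infinity; `γ = σ - 1` measures how much less singular than the weight
the profile is. -/
structure ProfileBounds (d p q lam γ K : ℝ) (Φ Φ₁ : ℝ → ℝ) : Prop where
  profile : IsProfile d p q lam Φ Φ₁
  dim : 3 ≤ d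
  lam_le : lam ≤ d
  one_lt_q : 1 < q
  one_lt_p : 1 < p
  γ_pos : 0 < γ
  K_pos : 0 < K
  tail : ∃ C, 0 < C ∧ ∀ r, 1 ≤ r →
    |Φ r - K * gaussianTail d lam r| ≤ C * (gaussianTail d lam r * (r ^ 2)⁻¹)
  upper : ∃ C, 0 < C ∧ ∀ r, 0 < r →
    Φ r ≤ C * (min r 1 ^ γ * max r 1 ^ 2 * decayWeight d lam r)
  lower : ∃ C, 0 < C ∧ ∀ r, 0 < r → decayWeight d lam r ≤ C * (min r 1 ^ (-γ) * Φ r)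
  slope : ∃ C, 0 < C ∧ ∀ r, 0 < r →
    |Φ₁ r / r + Φ r| ≤ C * (min r 1 ^ (γ - 2) * decayWeight d lam r)
  rpow_p : ∀ k : ℕ, ∃ C, 0 < C ∧ ∀ r, 0 < r →
    Φ r ^ (p - 1) ≤ C * ((min r 1 ^ 2)⁻¹ * (max r 1 ^ k)⁻¹)
  rpow_q : ∀ k : ℕ, ∃ C, 0 < C ∧ ∀ r, 0 < r →
    Φ r ^ (q - 1) ≤ C * ((min r 1 ^ 2)⁻¹ * (max r 1 ^ k)⁻¹)
  potential : ∃ ω κ B : ℝ, 0 < ω ∧ 0 < κ ∧ κ ≤ 2 ∧ 0 ≤ B ∧ ∀ r, 0 < r → r ≤ 1 →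
    |r ^ 2 * (p * Φ r ^ (p - 1) + q * Φ r ^ (q - 1)) - (ω ^ 2 + ((d - 2) / 2) ^ 2)| ≤ B * r ^ κ

/-- In the supercritical oscillatory range every singular profile satisfies the bounds, with
`γ = (d-2)/2 - μ = σ - 1`. In between the two asymptotic regimes compactness suffices. -/
theorem IsProfile.profileBounds {d p q lam μ ω : ℝ} {Φ Φ₁ : ℝ → ℝ} (hd : 3 ≤ d) (hlam : 0 < lam)
    (hlamd : lam ≤ d) (hq : 1 < q) (hqp : q < p) (hμ : μ * (p - 1) = 2) (hμd : μ < (d - 2) / 2)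
    (hω : 0 < ω) (hω2 : ω ^ 2 = p * (μ * (d - 2 - μ)) - ((d - 2) / 2) ^ 2)
    (h : IsProfile d p q lam Φ Φ₁) :
    ∃ K, ProfileBounds d p q lam ((d - 2) / 2 - μ) K Φ Φ₁ := by
  have hp : 1 < p := hq.trans hqp
  have hp1 : 0 < p - 1 := by linarith
  have hμ0 : 0 < μ := by
    by_contra hneg
    have : μ * (p - 1) ≤ 0 := mul_nonpos_of_nonpos_of_nonneg (not_lt.mp hneg) hp1.le
    linarith
  obtain ⟨C₀, δ, hC₀, hδ, h0⟩ := h.near_zero hd hlam hq hqp hμ hμd hω hω2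
  have hκ : 0 < μ * (p - q) := mul_pos hμ0 (by linarith)
  have hκ2 : μ * (p - q) ≤ 2 := by
    rw [← hμ]; exact mul_le_mul_of_nonneg_left (by linarith) hμ0.le
  have hid : ContinuousOn (fun r : ℝ => r) (Ioi 0) := continuousOn_id
  -- bounds on `(0, 1]`
  obtain ⟨C₁, hC₁, h1⟩ := exists_bound_of_near_zero h.continuousOn (continuousOn_rpow_Ioi (-μ))
    (fun r hr => Real.rpow_pos_of_pos hr _) ⟨C₀, δ, hδ, fun r hr hrδ => by
      rw [abs_of_pos (h.pos r hr)]; exact (h0 r hr hrδ).1⟩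
  obtain ⟨C₂, hC₂, h2⟩ := exists_bound_of_near_zero (hid.mul h.continuousOn')
    (continuousOn_rpow_Ioi (-μ)) (fun r hr => Real.rpow_pos_of_pos hr _)
    ⟨C₀, δ, hδ, fun r hr hrδ => (h0 r hr hrδ).2.1⟩
  obtain ⟨C₃, hC₃, h3⟩ := exists_bound_of_near_zero (continuousOn_rpow_Ioi (-μ)) h.continuousOn
    h.pos ⟨C₀, δ, hδ, fun r hr hrδ => by
      rw [abs_of_pos (Real.rpow_pos_of_pos hr _)]; exact (h0 r hr hrδ).2.2.1⟩
  obtain ⟨C₄, hC₄, h4⟩ := exists_bound_of_near_zero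
    (((hid.pow 2).mul (h.continuousOn_rpow (p - 1))).sub
      (continuousOn_const (c := μ * (d - 2 - μ)))) (continuousOn_rpow_Ioi (μ * (p - q)))
    (fun r hr => Real.rpow_pos_of_pos hr _) ⟨C₀, δ, hδ, fun r hr hrδ => (h0 r hr hrδ).2.2.2⟩
  simp only [Pi.mul_apply, Pi.sub_apply, Pi.pow_apply] at h2 h4
  have h5 : ∀ r, 0 < r → r ≤ 1 → r ^ 2 * Φ r ^ (q - 1) ≤ C₁ ^ (q - 1) * r ^ (μ * (p - q)) := by
    intro r hr hr1
    have e1 := Real.rpow_le_rpow (h.pos r hr).le ((le_abs_self _).trans (h1 r hr hr1))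
      (show 0 ≤ q - 1 by linarith)
    rw [Real.mul_rpow hC₁.le (Real.rpow_pos_of_pos hr _).le, ← Real.rpow_mul hr.le] at e1
    have e2 : r ^ (μ * (p - q)) = r ^ 2 * r ^ (-μ * (q - 1)) := by
      rw [← Real.rpow_natCast, ← Real.rpow_add hr]
      congr 1; push_cast; linarith
    rw [e2]
    have := mul_le_mul_of_nonneg_left e1 (sq_nonneg r)
    linarith
  have h6 : ∀ r, 0 < r → r ≤ 1 → r ^ 2 * Φ r ^ (p - 1) ≤ C₄ + |μ * (d - 2 - μ)| := by
    intro r hr hr1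
    have e1 := (le_abs_self _).trans (h4 r hr hr1)
    have e2 := Real.rpow_le_one hr.le hr1 hκ.le
    have e3 := mul_le_mul_of_nonneg_left e2 hC₄.le
    have := le_abs_self (μ * (d - 2 - μ))
    linarith
  have hpow : ∀ y : ℝ, 1 < y → (∃ C, 0 < C ∧ ∀ r, 0 < r → r ≤ 1 → r ^ 2 * Φ r ^ (y - 1) ≤ C) →
      ∀ k : ℕ, ∃ C, 0 < C ∧ ∀ r, 0 < r →
        Φ r ^ (y - 1) ≤ C * ((min r 1 ^ 2)⁻¹ * (max r 1 ^ k)⁻¹) := by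
    rintro y hy ⟨C, hC, hb⟩ k
    refine exists_bound_of_zero_of_infinity (fun r hr => ?_) ⟨C, hC, fun r hr hr1 => ?_⟩ ?_
    · have : 0 < max r 1 := lt_max_of_lt_left hr
      positivity
    · rw [min_eq_left hr1, max_eq_right hr1]
      have := hb r hr hr1
      have hr2 : 0 < r ^ 2 := by positivity
      rw [one_pow, inv_one, mul_one, ← div_eq_mul_inv, le_div_iff₀ hr2]
      linarith
    · obtain ⟨C', hC', hb'⟩ := h.rpow_decay (by linarith) hp hq (show 0 < y - 1 by linarith) k
      refine ⟨C', hC', fun r hr => ?_⟩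
      rw [min_eq_right hr, max_eq_left hr]
      simpa using hb' r hr
  have hpp := hpow p hp ⟨_, by positivity, h6⟩
  have hpq := hpow q hq ⟨C₁ ^ (q - 1), Real.rpow_pos_of_pos hC₁ _, fun r hr hr1 =>
    (h5 r hr hr1).trans (mul_le_of_le_one_right (Real.rpow_pos_of_pos hC₁ _).le
      (Real.rpow_le_one hr.le hr1 hκ.le))⟩
  obtain ⟨K, M, hK, htail⟩ := h.gaussian_tail (by linarith) hlamd hp hq (by
    obtain ⟨C, hC, hb⟩ := hpp 2
    obtain ⟨C', hC', hb'⟩ := hpq 2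
    refine ⟨C + C', fun r hr => ?_⟩
    have e : (min r 1 ^ 2)⁻¹ * (max r 1 ^ 2)⁻¹ = (r ^ 2)⁻¹ := by
      rw [← mul_inv, ← mul_pow, min_mul_max, mul_one]
    have e1 := hb r hr
    have e2 := hb' r hr
    rw [e] at e1 e2
    linarith)
  have hG : ∀ r, 0 < r → 0 < gaussianTail d lam r := fun r hr => gaussianTail_pos d lam hr
  have hGc := continuousOn_gaussianTail d lam
  have hGi : ∀ r, 0 < r → 0 < gaussianTail d lam r * (r ^ 2)⁻¹ := fun r hr =>
    mul_pos (hG r hr) (by positivity)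
  -- bounds on `[1, ∞)`
  obtain ⟨C₅, hC₅, h7⟩ := exists_bound_of_eventually_atTop
    (h.continuousOn.sub ((continuousOn_const (c := K)).mul hGc)) (hGc.mul continuousOn_inv_sq) hGi
    ⟨M, htail.mono fun r hr => hr.1⟩
  obtain ⟨C₆, hC₆, h8⟩ := exists_bound_of_eventually_atTop
    ((h.continuousOn'.div hid fun r hr => (ne_of_gt hr)).add h.continuousOn)
    (hGc.mul continuousOn_inv_sq) hGi ⟨M, htail.mono fun r hr => hr.2⟩
  obtain ⟨C₇, hC₇, h9⟩ := exists_bound_of_eventually_atTop hGc h.continuousOn h.pos ⟨2 / K, by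
    filter_upwards [htail, eventually_gt_atTop 0, (tendsto_pow_atTop (α := ℝ)
      two_ne_zero).eventually_ge_atTop (2 * |M| / K)] with r hr hr0 hr2
    have hGr := hG r hr0
    rw [abs_of_pos hGr]
    have hM : M * (gaussianTail d lam r * (r ^ 2)⁻¹) ≤ K / 2 * gaussianTail d lam r := by
      have : |M| * (r ^ 2)⁻¹ ≤ K / 2 := by
        rw [← div_eq_mul_inv, div_le_iff₀ (by positivity)]
        rw [div_le_iff₀ hK] at hr2
        linarith
      calc _ ≤ |M| * (gaussianTail d lam r * (r ^ 2)⁻¹) := by gcongr; exact le_abs_self M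
        _ = |M| * (r ^ 2)⁻¹ * gaussianTail d lam r := by ring
        _ ≤ _ := by gcongr
    have := (abs_le.mp (hr.1.trans hM)).1
    rw [div_mul_eq_mul_div, le_div_iff₀ hK]
    linarith⟩
  simp only [Pi.mul_apply, Pi.sub_apply, Pi.add_apply, Pi.div_apply] at h7 h8
  have htpos : ∀ r y : ℝ, 0 < r → 0 < min r 1 ^ y := fun r y hr =>
    Real.rpow_pos_of_pos (lt_min hr one_pos) y
  have hw := fun r (hr : 0 < r) => decayWeight_pos d lam hr
  have hE : ∀ r : ℝ, 0 < r → 0 < max r 1 := fun r hr => lt_max_of_lt_left hr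
  have hexp := Real.exp_pos (1 / 2)
  have hexp1 : Real.exp (-1 / 2) * Real.exp (1 / 2) = 1 := by
    rw [← Real.exp_add]; norm_num
  have hexp2 : Real.exp (-1 / 2) ≤ 1 := Real.exp_le_one_iff.mpr (by norm_num)
  refine ⟨K, h, hd, hlamd, hq, hp, by linarith, hK, ⟨C₅, hC₅, h7⟩, ?_, ?_, ?_, hpp, hpq, ?_⟩
  · refine exists_bound_of_zero_of_infinity (fun r hr => ?_)
      ⟨C₁ * Real.exp (1 / 2), by positivity, fun r hr hr1 => ?_⟩
      ⟨K + C₅, by positivity, fun r hr => ?_⟩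
    · have := htpos r ((d - 2) / 2 - μ) hr
      have := hw r hr
      positivity
    · rw [decayWeight_of_le_one d lam hr1, min_eq_left hr1, max_eq_right hr1]
      refine ((le_abs_self _).trans (h1 r hr hr1)).trans (le_of_eq ?_)
      have e : r ^ (-μ) = r ^ ((d - 2) / 2 - μ) * r ^ (-((d - 2) / 2)) := by
        rw [← Real.rpow_add hr]; congr 1; ring
      rw [e]
      linear_combination (-(C₁ * (r ^ ((d - 2) / 2 - μ) * r ^ (-((d - 2) / 2))))) * hexp1
    · rw [decayWeight_of_one_le d lam hr, min_eq_right hr, max_eq_left hr, Real.one_rpow]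
      have hr0 : 0 < r := by linarith
      have e1 := (abs_le.mp (h7 r hr)).2
      have e2 : (r ^ 2)⁻¹ ≤ 1 := inv_le_one_of_one_le₀ (one_le_pow₀ hr)
      have e3 := mul_le_mul_of_nonneg_left e2 (mul_pos hC₅ (hG r hr0)).le
      have e4 : 1 * r ^ 2 * (gaussianTail d lam r * (r ^ 2)⁻¹) = gaussianTail d lam r := by
        field_simp
      rw [e4]
      linarith
  · refine exists_bound_of_zero_of_infinity (fun r hr => ?_)
      ⟨C₃, hC₃, fun r hr hr1 => ?_⟩ ⟨C₇, hC₇, fun r hr => ?_⟩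
    · exact (mul_pos (htpos r _ hr) (h.pos r hr)).le
    · rw [decayWeight_of_le_one d lam hr1, min_eq_left hr1]
      have e : r ^ (-((d - 2) / 2)) = r ^ (-((d - 2) / 2 - μ)) * r ^ (-μ) := by
        rw [← Real.rpow_add hr]; congr 1; ring
      have e1 := (le_abs_self _).trans (h3 r hr hr1)
      have e2 := Real.rpow_pos_of_pos hr (-((d - 2) / 2))
      have e3 := Real.rpow_pos_of_pos hr (-((d - 2) / 2 - μ))
      have e4 := mul_le_mul_of_nonneg_left e1 e3.le
      have e5 := mul_le_of_le_one_right e2.le hexp2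
      rw [← e] at e4
      linarith
    · rw [decayWeight_of_one_le d lam hr, min_eq_right hr, Real.one_rpow, one_mul]
      have e2 : (r ^ 2)⁻¹ ≤ 1 := inv_le_one_of_one_le₀ (one_le_pow₀ hr)
      have := mul_le_of_le_one_right (hG r (by linarith)).le e2
      exact this.trans ((le_abs_self _).trans (h9 r hr))
  · refine exists_bound_of_zero_of_infinity (fun r hr => ?_)
      ⟨(C₂ + C₁) * Real.exp (1 / 2), by positivity, fun r hr hr1 => ?_⟩
      ⟨C₆, hC₆, fun r hr => ?_⟩
    · exact (mul_pos (htpos r _ hr) (hw r hr)).le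
    · rw [decayWeight_of_le_one d lam hr1, min_eq_left hr1]
      have hr2 : 0 < r ^ 2 := by positivity
      have e : r ^ (-μ) = r ^ 2 * (r ^ ((d - 2) / 2 - μ - 2) * r ^ (-((d - 2) / 2))) := by
        rw [← Real.rpow_add hr, ← Real.rpow_natCast, ← Real.rpow_add hr]
        congr 1; push_cast; ring
      have e1 : Φ₁ r / r + Φ r = (r * Φ₁ r + r ^ 2 * Φ r) / r ^ 2 := by field_simp
      rw [e1, abs_div, abs_of_pos hr2, div_le_iff₀ hr2]
      have e2 := h2 r hr hr1
      have e3 := h1 r hr hr1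
      have e4 : |r ^ 2 * Φ r| ≤ |Φ r| := by
        rw [abs_mul (r ^ 2), abs_of_pos hr2]
        exact mul_le_of_le_one_left (abs_nonneg _) (pow_le_one₀ hr.le hr1)
      refine ((abs_add_le _ _).trans (add_le_add e2 (e4.trans e3))).trans (le_of_eq ?_)
      rw [e]
      linear_combination (-((C₂ + C₁) *
        (r ^ 2 * (r ^ ((d - 2) / 2 - μ - 2) * r ^ (-((d - 2) / 2)))))) * hexp1
    · rw [decayWeight_of_one_le d lam hr, min_eq_right hr, Real.one_rpow, one_mul]
      exact h8 r hr
  · refine ⟨ω, μ * (p - q), p * C₄ + q * C₁ ^ (q - 1), hω, hκ, hκ2, by positivity,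
      fun r hr hr1 => ?_⟩
    have e1 := h4 r hr hr1
    have e2 := h5 r hr hr1
    have e3 : 0 ≤ r ^ 2 * Φ r ^ (q - 1) :=
      mul_nonneg (sq_nonneg r) (Real.rpow_pos_of_pos (h.pos r hr) _).le
    have e4 : r ^ 2 * (p * Φ r ^ (p - 1) + q * Φ r ^ (q - 1)) - (ω ^ 2 + ((d - 2) / 2) ^ 2) =
        p * (r ^ 2 * Φ r ^ (p - 1) - μ * (d - 2 - μ)) + q * (r ^ 2 * Φ r ^ (q - 1)) := by
      rw [hω2]; ring
    rw [e4]
    refine (abs_add_le _ _).trans ?_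
    rw [abs_mul p, abs_mul q, abs_of_nonneg e3, abs_of_pos (show 0 < p by linarith),
      abs_of_pos (show 0 < q by linarith), add_mul, mul_assoc, mul_assoc]
    gcongr

/-! ### The singular solution as a profile -/

theorem contDiffOn_two_of_hasDerivAt {w w₁ w₂ : ℝ → ℝ} (h : ∀ r, 0 < r → HasDerivAt w (w₁ r) r)
    (h' : ∀ r, 0 < r → HasDerivAt w₁ (w₂ r) r) (hc : ContinuousOn w₂ (Ioi 0)) :
    ContDiffOn ℝ 2 w (Ioi 0) := by
  have e1 : EqOn (deriv w) w₁ (Ioi 0) := fun r hr => (h r hr).deriv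
  have e2 : EqOn (deriv w₁) w₂ (Ioi 0) := fun r hr => (h' r hr).deriv
  have h1 : ContDiffOn ℝ (0 + 1) w₁ (Ioi 0) := by
    rw [contDiffOn_succ_iff_deriv_of_isOpen isOpen_Ioi]
    exact ⟨fun r hr => (h' r hr).differentiableAt.differentiableWithinAt, by simp,
      contDiffOn_zero.mpr (hc.congr e2)⟩
  have h2 : ContDiffOn ℝ (1 + 1) w (Ioi 0) := by
    rw [contDiffOn_succ_iff_deriv_of_isOpen isOpen_Ioi]
    refine ⟨fun r hr => (h r hr).differentiableAt.differentiableWithinAt, by simp, ?_⟩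
    rw [zero_add] at h1
    exact h1.congr e1
  rwa [one_add_one_eq_two] at h2

theorem derivWithin_Ici_of_hasDerivAt {w w₁ : ℝ → ℝ} {a : ℝ} (ha : 0 < a)
    (h : ∀ r, 0 < r → HasDerivAt w (w₁ r) r) : EqOn (derivWithin w (Ici a)) w₁ (Ici a) :=
  fun r hr => (h r (ha.trans_le hr)).hasDerivWithinAt.derivWithin (uniqueDiffOn_Ici a r hr)

theorem IsSingularSolution.isProfile {d : ℕ} {p q lam : ℝ} {Φ : ℝ → ℝ}
    (h : IsSingularSolution d p q lam Φ) : IsProfile d p q lam Φ (deriv Φ) := by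
  obtain ⟨⟨hc, hpos, heq, hinf⟩, hsing⟩ := h
  have e1 : EqOn (derivWithin Φ (Ioi 0)) (deriv Φ) (Ioi 0) := fun r hr =>
    derivWithin_of_isOpen isOpen_Ioi hr
  rw [← one_add_one_eq_two, contDiffOn_succ_iff_deriv_of_isOpen isOpen_Ioi] at hc
  obtain ⟨hd, -, hc⟩ := hc
  rw [← zero_add (1 : WithTop ℕ∞), contDiffOn_succ_iff_deriv_of_isOpen isOpen_Ioi] at hc
  refine ⟨hpos, fun r hr => (hd.differentiableAt (Ioi_mem_nhds hr)).hasDerivAt, fun r hr => ?_,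
    hsing, hinf⟩
  refine (hc.1.differentiableAt (Ioi_mem_nhds hr)).hasDerivAt.congr_deriv ?_
  have h1 := heq r hr
  rw [derivWithin_congr e1 (e1 hr), derivWithin_of_isOpen isOpen_Ioi hr, e1 hr] at h1
  have hp := hpos r hr
  rw [abs_of_pos hp, ← Real.rpow_add_one hp.ne', ← Real.rpow_add_one hp.ne', sub_add_cancel,
    sub_add_cancel] at h1
  linarith

/-- The Joseph-Lundgren condition says exactly that the linearisation at the singular profile
oscillates at the origin. -/
theorem oscillation_of_belowJosephLundgren {d : ℕ} {p : ℝ} (hd : 3 ≤ d)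
    (hp : ((d : ℝ) + 2) / ((d : ℝ) - 2) < p) (hJL : BelowJosephLundgren d p) :
    1 < p ∧ 2 / (p - 1) < ((d : ℝ) - 2) / 2 ∧
      0 < p * (2 / (p - 1) * ((d : ℝ) - 2 - 2 / (p - 1))) - (((d : ℝ) - 2) / 2) ^ 2 := by
  have hd3 : (3 : ℝ) ≤ d := by exact_mod_cast hd
  have hd2 : (0 : ℝ) < d - 2 := by linarith
  rw [div_lt_iff₀ hd2] at hp
  have hp1 : 0 < p - 1 := by
    by_contra hneg
    have : (p - 1) * (d - 2) ≤ 0 := mul_nonpos_of_nonpos_of_nonneg (not_lt.mp hneg) hd2.le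
    linarith
  have hμ : 2 / (p - 1) < ((d : ℝ) - 2) / 2 := by
    rw [div_lt_iff₀ hp1]; linarith
  refine ⟨by linarith, hμ, ?_⟩
  obtain ⟨μ, hμ_def⟩ : ∃ μ, μ = 2 / (p - 1) := ⟨_, rfl⟩
  have hμ0 : 0 < μ := by rw [hμ_def]; positivity
  have hμp : p * μ = μ + 2 := by rw [hμ_def]; field_simp; ring
  rw [← hμ_def] at hμ ⊢
  have e : p * (μ * (d - 2 - μ)) - (((d : ℝ) - 2) / 2) ^ 2 =
      (d - 1) - (((d : ℝ) - 4) / 2 - μ) ^ 2 := by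
    rw [← mul_assoc, hμp]; ring
  rw [e, sub_pos]
  have hs : Real.sqrt ((d : ℝ) - 1) ^ 2 = d - 1 := Real.sq_sqrt (by linarith)
  have hs1 : 1 ≤ Real.sqrt ((d : ℝ) - 1) := Real.one_le_sqrt.mpr (by linarith)
  obtain ⟨s, hs_def⟩ : ∃ s, s = Real.sqrt ((d : ℝ) - 1) := ⟨_, rfl⟩
  rw [← hs_def] at hs hs1
  rw [← hs, sq_lt_sq, abs_of_pos (by linarith : 0 < s), abs_lt]
  refine ⟨by linarith, ?_⟩
  rcases le_or_gt 11 d with h | h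
  · have h11 : (11 : ℝ) ≤ d := by exact_mod_cast h
    have hJ := hJL h
    rw [← hs_def] at hJ
    have hpos : 0 < (d : ℝ) - 4 - 2 * s := by nlinarith
    have h1 : (p - 1) * ((d : ℝ) - 4 - 2 * s) < 4 := by
      rw [← lt_div_iff₀ hpos]; linarith
    have h2 : ((d : ℝ) - 4 - 2 * s) / 2 < μ := by
      rw [hμ_def, lt_div_iff₀ hp1]; linarith
    linarith
  · have h10 : (d : ℝ) ≤ 10 := by exact_mod_cast Nat.lt_succ_iff.mp h
    nlinarith

theorem hasGaussianTail_of_bound {d : ℕ} {lam K C : ℝ} {f : ℝ → ℝ} (hK : 0 < K)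
    (h : ∀ r, 1 ≤ r →
      |f r - K * gaussianTail d lam r| ≤ C * (gaussianTail d lam r * (r ^ 2)⁻¹)) :
    HasGaussianTail d lam K f := by
  refine Asymptotics.IsBigO.of_bound (C / K) ?_
  filter_upwards [eventually_ge_atTop 1] with r hr
  have hG := gaussianTail_pos d lam (show 0 < r by linarith)
  have hb := h r hr
  change ‖f r / (K * gaussianTail d lam r) - 1‖ ≤ _
  rw [Real.norm_eq_abs, Real.norm_eq_abs, abs_of_pos (show 0 < (r ^ 2)⁻¹ by positivity)]
  have hKG : 0 < K * gaussianTail d lam r := by positivity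
  rw [div_sub_one hKG.ne', abs_div, abs_of_pos hKG, div_le_iff₀ hKG]
  refine hb.trans (le_of_eq ?_)
  field_simp

/-! ### The linear estimate in the weighted norm -/

/-- The potential `p Φ^(p-1) + q Φ^(q-1)` of the linearised equation. -/
def linPotential (p q : ℝ) (Φ : ℝ → ℝ) (r : ℝ) : ℝ := p * Φ r ^ (p - 1) + q * Φ r ^ (q - 1)

theorem ProfileBounds.linPotential_bound {d p q lam γ K : ℝ} {Φ Φ₁ : ℝ → ℝ}
    (h : ProfileBounds d p q lam γ K Φ Φ₁) :
    ∃ B, 0 < B ∧ ∀ r, 0 < r → |linPotential p q Φ r| ≤ B * (r ^ 2)⁻¹ := by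
  obtain ⟨C, hC, hb⟩ := h.rpow_p 2
  obtain ⟨C', hC', hb'⟩ := h.rpow_q 2
  have hp := h.one_lt_p
  have hq := h.one_lt_q
  refine ⟨p * C + q * C', by positivity, fun r hr => ?_⟩
  have e : (min r 1 ^ 2)⁻¹ * (max r 1 ^ 2)⁻¹ = (r ^ 2)⁻¹ := by
    rw [← mul_inv, ← mul_pow, min_mul_max, mul_one]
  have e1 := hb r hr
  have e2 := hb' r hr
  rw [e] at e1 e2
  have e3 := Real.rpow_pos_of_pos (h.profile.pos r hr) (p - 1)
  have e4 := Real.rpow_pos_of_pos (h.profile.pos r hr) (q - 1)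
  rw [linPotential, abs_of_pos (by positivity), add_mul, mul_assoc, mul_assoc]
  gcongr

/-- Solutions of the linearised equation are controlled in the weighted norm by the source. For
`α > 0` the bound is uniform in `rs`; for `α < 0` it grows like `rs ^ α`. -/
theorem ProfileBounds.linear_estimate {d p q lam γ K α : ℝ} {Φ Φ₁ : ℝ → ℝ}
    (h : ProfileBounds d p q lam γ K Φ Φ₁) (hα : α ≠ 0) :
    ∃ C, 0 < C ∧ ∀ (ε rs Y : ℝ) (F w w₁ : ℝ → ℝ), |ε| ≤ 1 → 0 < rs → rs ≤ 1 →
      |ε| * -Real.log rs ≤ 1 → 0 < Y →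
      IsDecayingSolution d lam ε (fun r => linPotential p q Φ r * w r + F r) w w₁ →
      (∀ r, rs ≤ r → |F r| ≤ Y * (min r 1 ^ (α - 2) * decayWeight d lam r)) →
      ∀ r, rs ≤ r → |w r| ≤ C * (Y * (1 + powerTail α rs)) * decayWeight d lam r ∧
        min r 1 * |w₁ r| ≤ C * (Y * (1 + powerTail α rs)) * ((1 + r) * decayWeight d lam r) := by
  obtain ⟨B, hB, hPB⟩ := h.linPotential_bound
  obtain ⟨ω, κ, B', hω, hκ, hκ2, hB', hPB'⟩ := h.potential
  obtain ⟨C₁, hC₁, h1⟩ := bound_at_infinity d lam B hB.le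
    (fun r hr => hPB r (show 0 < r by linarith))
  obtain ⟨C₂, hC₂, h2⟩ := energy_bound (lam := lam) (P := linPotential p q Φ) hκ hκ2 hω hB' hPB'
  have hexp1 : Real.exp (-1 / 2) * Real.exp (1 / 2) = 1 := by
    rw [← Real.exp_add]; norm_num
  have hexp2 : Real.exp (-1 / 2) ≤ 1 := Real.exp_le_one_iff.mpr (by norm_num)
  have hexp0 := Real.exp_pos (1 / 2)
  refine ⟨C₁ + C₂ * (C₁ + 1) * Real.exp (1 / 2), by positivity, ?_⟩
  intro ε rs Y F w w₁ hε hrs hrs1 hlog hY hw hF r hr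
  have hr0 : 0 < r := hrs.trans_le hr
  have hζ : 0 ≤ powerTail α rs := powerTail_nonneg hrs hrs1
  have hcl := decayWeight_pos d lam hr0
  have hinf := h1 ε Y F w w₁ hε hY.le hw fun r hr => by
    have := hF r (hrs1.trans hr)
    rwa [min_eq_right hr, Real.one_rpow, one_mul, decayWeight_of_one_le d lam hr] at this
  rcases le_total 1 r with hr1 | hr1
  · obtain ⟨e1, e2⟩ := hinf r hr1
    have hle : C₁ * Y ≤ (C₁ + C₂ * (C₁ + 1) * Real.exp (1 / 2)) * (Y * (1 + powerTail α rs)) := by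
      have : Y ≤ Y * (1 + powerTail α rs) := by nlinarith
      have h3 : 0 < C₂ * (C₁ + 1) * Real.exp (1 / 2) := by positivity
      gcongr
      linarith
    refine ⟨?_, ?_⟩
    · rw [← decayWeight_of_one_le d lam hr1] at e1
      exact e1.trans (by gcongr)
    · rw [min_eq_right hr1, one_mul]
      have e3 : gaussianTail d lam r * r⁻¹ = r * decayWeight d lam r := by
        rw [decayWeight_of_one_le d lam hr1]; field_simp
      rw [e3] at e2
      refine e2.trans ?_
      gcongr
      linarith
  · have hG1 : gaussianTail d lam 1 ≤ 1 := by simpa [gaussianTail] using hexp2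
    have hG0 := (gaussianTail_pos d lam one_pos).le
    obtain ⟨e1, e2⟩ := hinf 1 le_rfl
    have hA : |w 1| ≤ C₁ * Y ∧ |w₁ 1| ≤ C₁ * Y := by
      simp only [one_pow, inv_one, mul_one] at e1 e2
      have := mul_le_of_le_one_right (show 0 ≤ C₁ * Y by positivity) hG1
      exact ⟨e1.trans this, e2.trans this⟩
    obtain ⟨e3, e4⟩ := h2 ε rs Y (C₁ * Y) α F w w₁ hε hrs hrs1 hlog hα hY.le (by positivity)
      hw.hasDerivAt hw.hasDerivAt' (fun t ht ht1 => by
        have ht0 : 0 < t := hrs.trans_le ht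
        have e5 := hF t ht
        rw [min_eq_left ht1, decayWeight_of_le_one d lam ht1] at e5
        have e6 : t ^ ((d - 2) / 2) * (t ^ 2 * (Y * (t ^ (α - 2) * (t ^ (-((d - 2) / 2)) *
            Real.exp (-1 / 2))))) = Y * t ^ α * Real.exp (-1 / 2) := by
          rw [Real.rpow_neg ht0.le, Real.rpow_sub ht0, Real.rpow_two]
          have := (Real.rpow_pos_of_pos ht0 ((d - 2) / 2)).ne'
          field_simp
        have e7 := Real.rpow_pos_of_pos ht0 ((d - 2) / 2)
        have e8 := Real.rpow_pos_of_pos ht0 α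
        calc _ ≤ t ^ ((d - 2) / 2) * (t ^ 2 * (Y * (t ^ (α - 2) * (t ^ (-((d - 2) / 2)) *
            Real.exp (-1 / 2))))) := by gcongr
          _ = Y * t ^ α * Real.exp (-1 / 2) := e6
          _ ≤ _ := mul_le_of_le_one_right (by positivity) hexp2) hA.1 hA.2 r hr hr1
    have hβ := Real.rpow_pos_of_pos hr0 ((d - 2) / 2)
    have hle : C₂ * (C₁ * Y + Y * powerTail α rs) ≤ C₂ * (C₁ + 1) * (Y * (1 + powerTail α rs)) := by
      have h5 : C₁ * Y + Y * powerTail α rs ≤ (C₁ + 1) * (Y * (1 + powerTail α rs)) := by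
        have : 0 ≤ C₁ * (Y * powerTail α rs) := by positivity
        linarith
      rw [mul_assoc]
      gcongr
    have hconv : ∀ x, r ^ ((d - 2) / 2) * x ≤ C₂ * (C₁ * Y + Y * powerTail α rs) →
        x ≤ (C₁ + C₂ * (C₁ + 1) * Real.exp (1 / 2)) * (Y * (1 + powerTail α rs)) *
          decayWeight d lam r := by
      intro x hx
      have h6 : x ≤ C₂ * (C₁ + 1) * (Y * (1 + powerTail α rs)) * r ^ (-((d - 2) / 2)) := by
        rw [Real.rpow_neg hr0.le, ← div_eq_mul_inv, le_div_iff₀ hβ, mul_comm]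
        exact hx.trans hle
      have h7 : C₂ * (C₁ + 1) * (Y * (1 + powerTail α rs)) * r ^ (-((d - 2) / 2)) =
          C₂ * (C₁ + 1) * Real.exp (1 / 2) * (Y * (1 + powerTail α rs)) * decayWeight d lam r := by
        rw [decayWeight_of_le_one d lam hr1]
        linear_combination (-(C₂ * (C₁ + 1) * (Y * (1 + powerTail α rs)) *
          r ^ (-((d - 2) / 2)))) * hexp1
      rw [h7] at h6
      refine h6.trans ?_
      gcongr
      linarith
    refine ⟨hconv _ e3, ?_⟩
    rw [min_eq_left hr1]
    refine (hconv _ e4).trans ?_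
    gcongr
    nlinarith

/-- Pointwise bounds by the dual weight give bounds of the norm. -/
theorem XNorm_le {d : ℕ} {lam rs A : ℝ} {w : ℝ → ℝ} (hrs : 0 < rs) (hrs1 : rs ≤ 1) (hA : 0 ≤ A)
    (h : ∀ r, rs ≤ r → |w r| ≤ A * decayWeight d lam r) :
    XNorm d lam rs w ≤ ENNReal.ofReal (2 * A) := by
  rw [XNorm, two_mul, ENNReal.ofReal_add hA hA]
  refine add_le_add (iSup₂_le fun r hr => ENNReal.ofReal_le_ofReal ?_)
    (iSup₂_le fun r hr => ENNReal.ofReal_le_ofReal ?_)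
  · have hr0 : 0 < r := hrs.trans_le hr.1
    have h1 := h r hr.1
    have h2 := Real.rpow_pos_of_pos hr0 (((d : ℝ) - 2) / 2)
    have hexp2 : Real.exp (-1 / 2) ≤ 1 := Real.exp_le_one_iff.mpr (by norm_num)
    rw [decayWeight_of_le_one (d : ℝ) lam hr.2, Real.rpow_neg hr0.le] at h1
    calc _ ≤ r ^ (((d : ℝ) - 2) / 2) *
          (A * ((r ^ (((d : ℝ) - 2) / 2))⁻¹ * Real.exp (-1 / 2))) := by gcongr
      _ = A * Real.exp (-1 / 2) := by field_simp
      _ ≤ A := mul_le_of_le_one_right hA hexp2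
  · have hr1 : 1 ≤ r := hr
    have hr0 : 0 < r := by linarith
    have h1 := h r (hrs1.trans hr1)
    have h2 := Real.rpow_pos_of_pos hr0 (2 - (lam - (d : ℝ)) / 2)
    have h3 := Real.rpow_pos_of_pos hr0 ((lam - (d : ℝ)) / 2)
    rw [decayWeight_of_one_le (d : ℝ) lam hr1, gaussianTail] at h1
    have e1 : Real.exp (r ^ 2 / 2) * Real.exp (-(r ^ 2) / 2) = 1 := by
      rw [← Real.exp_add, ← Real.exp_zero]; congr 1; ring
    calc _ ≤ Real.exp (r ^ 2 / 2) * r ^ (2 - (lam - (d : ℝ)) / 2) *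
          (A * (Real.exp (-(r ^ 2) / 2) * r ^ ((lam - (d : ℝ)) / 2) * (r ^ 2)⁻¹)) := by gcongr
      _ = Real.exp (r ^ 2 / 2) * Real.exp (-(r ^ 2) / 2) * A := by
        rw [Real.rpow_sub hr0, Real.rpow_two]; field_simp
      _ ≤ A := by rw [e1, one_mul]

/-! ### Taylor expansion of the nonlinearity -/

theorem abs_le_of_abs_deriv_le_pow {f f' : ℝ → ℝ} {M : ℝ} {n : ℕ} (hM : 0 ≤ M) (h0 : f 0 = 0)
    (h : ∀ t, |t| ≤ 1 / 2 → HasDerivAt f (f' t) t) (hb : ∀ t, |t| ≤ 1 / 2 → |f' t| ≤ M * |t| ^ n) :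
    ∀ t, |t| ≤ 1 / 2 → |f t| ≤ M * |t| ^ (n + 1) := by
  intro t ht
  have hsub : ∀ x ∈ Icc (-|t|) |t|, |x| ≤ |t| := fun x hx => abs_le.mpr hx
  have := (convex_Icc (-|t|) |t|).norm_image_sub_le_of_norm_hasDerivWithin_le (f := f) (f' := f')
    (C := M * |t| ^ n) (fun x hx => (h x ((hsub x hx).trans ht)).hasDerivWithinAt)
    (fun x hx => (hb x ((hsub x hx).trans ht)).trans
      (mul_le_mul_of_nonneg_left (pow_le_pow_left₀ (abs_nonneg x) (hsub x hx) n) hM))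
    (x := 0) (y := t) (by simp) (abs_le.mp le_rfl)
  rw [h0, sub_zero, sub_zero, Real.norm_eq_abs, Real.norm_eq_abs] at this
  rw [pow_succ, ← mul_assoc]
  exact this

theorem hasDerivAt_one_add_rpow (y : ℝ) {t : ℝ} (ht : |t| ≤ 1 / 2) :
    HasDerivAt (fun t : ℝ => (1 + t) ^ y) (y * (1 + t) ^ (y - 1)) t := by
  have h1 := (abs_le.mp ht).1
  have := ((hasDerivAt_id t).const_add 1).rpow_const (p := y) (Or.inl (by simp; linarith))
  exact this.congr_deriv (by simp)

theorem exists_bound_one_add_rpow (c y : ℝ) :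
    ∃ M, 0 < M ∧ ∀ t : ℝ, |t| ≤ 1 / 2 → |c * (1 + t) ^ y| ≤ M := by
  have hc : ContinuousOn (fun t : ℝ => c * (1 + t) ^ y) (Icc (-(1 / 2)) (1 / 2)) := fun t ht =>
    ((hasDerivAt_one_add_rpow y (abs_le.mpr ht)).const_mul c).continuousAt.continuousWithinAt
  obtain ⟨M, hM⟩ := isCompact_Icc.exists_bound_of_continuousOn hc
  exact ⟨|M| + 1, by positivity, fun t ht =>
    ((hM t (abs_le.mp ht)).trans (le_abs_self M)).trans (by linarith)⟩

theorem one_add_rpow_taylor (s : ℝ) : ∃ C, 0 < C ∧ ∀ x : ℝ, |x| ≤ 1 / 2 →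
    |(1 + x) ^ s - 1 - s * x - s * (s - 1) / 2 * x ^ 2| ≤ C * |x| ^ 3 := by
  obtain ⟨M, hM, hb⟩ := exists_bound_one_add_rpow (s * (s - 1) * (s - 2)) (s - 2 - 1)
  refine ⟨M, hM, ?_⟩
  have h2 := abs_le_of_abs_deriv_le_pow (n := 0)
    (f := fun t => s * (s - 1) * ((1 + t) ^ (s - 2) - 1))
    hM.le (by simp) (fun t ht => ((hasDerivAt_one_add_rpow (s - 2) ht).sub_const 1).const_mul _)
    (fun t ht => by have := hb t ht; rw [pow_zero, mul_one]; rwa [← mul_assoc])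
  have h1 := abs_le_of_abs_deriv_le_pow (n := 1)
    (f := fun t => s * ((1 + t) ^ (s - 1) - 1 - (s - 1) * t)) hM.le (by simp) (fun t ht =>
      ((((hasDerivAt_one_add_rpow (s - 1) ht).sub_const 1).sub
        ((hasDerivAt_id t).const_mul (s - 1))).const_mul s).congr_deriv (by
          rw [show s - 1 - 1 = s - 2 by ring]; ring)) h2
  exact abs_le_of_abs_deriv_le_pow (n := 2)
    (f := fun t => (1 + t) ^ s - 1 - s * t - s * (s - 1) / 2 * t ^ 2) hM.le (by simp) (fun t ht =>
      (((((hasDerivAt_one_add_rpow s ht).sub_const 1).sub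
        ((hasDerivAt_id t).const_mul s))).sub ((hasDerivAt_pow 2 t).const_mul _)).congr_deriv (by
          simp; ring)) h1

theorem abs_exp_taylor (a : ℝ) :
    |Real.exp a - 1 - a - a ^ 2 / 2| ≤ |a| ^ 3 * Real.exp |a| := by
  have := Complex.norm_exp_sub_sum_le_norm_mul_exp (a : ℂ) 3
  rw [Complex.norm_real, Real.norm_eq_abs] at this
  have e : Complex.exp a - ∑ m ∈ Finset.range 3, (a : ℂ) ^ m / (m.factorial : ℂ) =
      ((Real.exp a - 1 - a - a ^ 2 / 2 : ℝ) : ℂ) := by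
    simp [Finset.sum_range_succ]; ring
  rwa [e, Complex.norm_real] at this

/-- The remainder of `e^((s-1)k/2) (1+x)^s` after its first order part. -/
def taylorRemainder (s x k : ℝ) : ℝ :=
  Real.exp ((s - 1) / 2 * k) * (1 + x) ^ s - 1 - s * x - (s - 1) / 2 * k

/-- The second order part of `e^((s-1)l/2) (1+y)^s`. -/
def taylorQuadratic (s y l : ℝ) : ℝ :=
  s * (s - 1) / 2 * y ^ 2 + s * (s - 1) / 2 * (y * l) + (s - 1) ^ 2 / 8 * l ^ 2

theorem taylorQuadratic_smul (s ε y l : ℝ) :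
    taylorQuadratic s (ε * y) (ε * l) = ε ^ 2 * taylorQuadratic s y l := by
  unfold taylorQuadratic; ring

/-- The exponential factor is the price for allowing `k = ε log r` to be large as `r → ∞`. -/
theorem taylorRemainder_sub_quadratic (s : ℝ) (hs : 1 < s) : ∃ C, 0 < C ∧ ∀ x k : ℝ, |x| ≤ 1 / 2 →
    |taylorRemainder s x k - taylorQuadratic s x k| ≤
      C * (|x| + |k|) ^ 3 * Real.exp ((s + 1) * |k|) := by
  obtain ⟨C, hC, hb⟩ := one_add_rpow_taylor s
  obtain ⟨M, hM, hbM⟩ := exists_bound_one_add_rpow 1 s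
  refine ⟨s ^ 3 * M + (1 + s) ^ 2 * C + s * (s * s) + s ^ 2 * (s + s * s), by positivity,
    fun x k hx => ?_⟩
  obtain ⟨a, ha⟩ : ∃ a, a = (s - 1) / 2 * k := ⟨_, rfl⟩
  obtain ⟨E, hE⟩ : ∃ E, E = Real.exp ((s + 1) * |k|) := ⟨_, rfl⟩
  obtain ⟨T, hT⟩ : ∃ T, T = |x| + |k| := ⟨_, rfl⟩
  have hx0 := abs_nonneg x
  have hk0 := abs_nonneg k
  have hT0 : 0 ≤ T := by rw [hT]; positivity
  have hak : |a| ≤ s * |k| := by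
    rw [ha, abs_mul, abs_of_pos (by linarith)]
    gcongr; linarith
  have hexpa : Real.exp |a| ≤ E := by
    rw [hE]; apply Real.exp_le_exp.mpr; nlinarith
  have hE1 : 1 ≤ E := by
    rw [hE]; apply Real.one_le_exp; positivity
  have h1a : 1 + |a| ≤ E := by
    have := Real.add_one_le_exp |a|
    linarith
  have haT : |a| ≤ s * T := hak.trans (by rw [hT]; gcongr; linarith)
  have hxT : |x| ≤ T := by rw [hT]; linarith
  have e1 := abs_exp_taylor a
  have e2 := hb x hx
  have e3 := hbM x hx
  rw [one_mul] at e3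
  have key : taylorRemainder s x k - taylorQuadratic s x k =
      (Real.exp a - 1 - a - a ^ 2 / 2) * (1 + x) ^ s +
      (1 + a + a ^ 2 / 2) * ((1 + x) ^ s - 1 - s * x - s * (s - 1) / 2 * x ^ 2) +
      a * (s * (s - 1) / 2 * x ^ 2) + a ^ 2 / 2 * (s * x + s * (s - 1) / 2 * x ^ 2) := by
    unfold taylorRemainder taylorQuadratic
    rw [← ha]
    rw [show (s - 1) ^ 2 / 8 * k ^ 2 = a ^ 2 / 2 by rw [ha]; ring,
      show s * (s - 1) / 2 * (x * k) = a * (s * x) by rw [ha]; ring]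
    ring
  rw [key, ← hT, ← hE]
  have t1 : |(Real.exp a - 1 - a - a ^ 2 / 2) * (1 + x) ^ s| ≤ s ^ 3 * M * T ^ 3 * E := by
    rw [abs_mul]
    calc _ ≤ ((s * T) ^ 3 * E) * M := by
          gcongr
          exact e1.trans (by gcongr)
      _ = _ := by ring
  have t2 : |(1 + a + a ^ 2 / 2) * ((1 + x) ^ s - 1 - s * x - s * (s - 1) / 2 * x ^ 2)| ≤
      (1 + s) ^ 2 * C * T ^ 3 * E := by
    rw [abs_mul]
    have h3 : |1 + a + a ^ 2 / 2| ≤ E := by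
      have h4 : |1 + a + a ^ 2 / 2| ≤ 1 + |a| + |a| ^ 2 / 2 := by
        refine (abs_add_le _ _).trans (add_le_add ((abs_add_le _ _).trans (by simp)) ?_)
        rw [abs_div, abs_pow]; simp
      exact (h4.trans (Real.quadratic_le_exp_of_nonneg (abs_nonneg a))).trans hexpa
    calc _ ≤ E * (C * T ^ 3) := by
          gcongr
          exact e2.trans (by gcongr)
      _ = 1 * C * T ^ 3 * E := by ring
      _ ≤ _ := by gcongr; nlinarith
  have hs2 : |s * (s - 1) / 2| ≤ s * s := by
    rw [abs_of_nonneg (by have : 0 < s - 1 := by linarith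
                          positivity)]
    nlinarith
  have hs1 : |s| ≤ s := (abs_of_pos (by linarith)).le
  have hx1 : |x| ^ 2 ≤ |x| := by nlinarith
  have t3 : |a * (s * (s - 1) / 2 * x ^ 2)| ≤ s * (s * s) * T ^ 3 * E := by
    rw [abs_mul, abs_mul, abs_pow]
    calc _ ≤ (s * T) * (s * s * T ^ 2) := by gcongr
      _ = s * (s * s) * T ^ 3 * 1 := by ring
      _ ≤ _ := by gcongr
  have t4 : |a ^ 2 / 2 * (s * x + s * (s - 1) / 2 * x ^ 2)| ≤
      s ^ 2 * (s + s * s) * T ^ 3 * E := by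
    rw [abs_mul, abs_div, abs_pow, abs_two]
    have h5 : |s * x + s * (s - 1) / 2 * x ^ 2| ≤ (s + s * s) * |x| := by
      refine (abs_add_le _ _).trans ?_
      rw [abs_mul, abs_mul (s * (s - 1) / 2), abs_pow, add_mul]
      gcongr
    calc _ ≤ (s * T) ^ 2 / 1 * ((s + s * s) * T) := by
          gcongr
          · norm_num
          · exact h5.trans (by gcongr)
      _ = s ^ 2 * (s + s * s) * T ^ 3 * 1 := by ring
      _ ≤ _ := by gcongr
  refine ((abs_add_le _ _).trans (add_le_add ((abs_add_le _ _).trans (add_le_add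
    ((abs_add_le _ _).trans (add_le_add t1 t2)) t3)) t4)).trans (le_of_eq ?_)
  ring

theorem abs_taylorQuadratic_le (s : ℝ) (hs : 1 < s) (y l : ℝ) :
    |taylorQuadratic s y l| ≤ s ^ 2 * (|y| + |l|) ^ 2 := by
  have hs1 : 0 < s - 1 := by linarith
  have h1 : 0 ≤ s * (s - 1) / 2 := by positivity
  have hy := abs_nonneg y
  have hl := abs_nonneg l
  unfold taylorQuadratic
  refine ((abs_add_le _ _).trans (add_le_add_left (abs_add_le _ _) _)).trans ?_
  rw [abs_mul, abs_mul (s * (s - 1) / 2) (y * l), abs_mul y, abs_mul ((s - 1) ^ 2 / 8), abs_pow,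
    abs_pow, abs_of_nonneg h1, abs_of_nonneg (by positivity : 0 ≤ (s - 1) ^ 2 / 8)]
  have h2 : s * (s - 1) / 2 ≤ s ^ 2 := by nlinarith
  have h3 : (s - 1) ^ 2 / 8 ≤ s ^ 2 := by nlinarith
  have h4 : 0 ≤ |y| * |l| := mul_nonneg hy hl
  have a1 := mul_le_mul_of_nonneg_right h2 (sq_nonneg |y|)
  have a2 := mul_le_mul_of_nonneg_right h2 h4
  have a3 := mul_le_mul_of_nonneg_right h3 (sq_nonneg |l|)
  have a4 : 0 ≤ s ^ 2 * (|y| * |l|) := by positivity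
  linarith

theorem abs_taylorRemainder_le (s : ℝ) (hs : 1 < s) : ∃ C, 0 < C ∧ ∀ x k : ℝ, |x| ≤ 1 / 2 →
    |taylorRemainder s x k| ≤ C * (|x| + |k|) ^ 2 * Real.exp ((s + 2) * |k|) := by
  obtain ⟨C, hC, hb⟩ := taylorRemainder_sub_quadratic s hs
  refine ⟨s ^ 2 + C, by positivity, fun x k hx => ?_⟩
  have hx0 := abs_nonneg x
  have hk0 := abs_nonneg k
  have h1 := hb x k hx
  have h2 := abs_taylorQuadratic_le s hs x k
  have h3 : |x| + |k| ≤ Real.exp |k| := by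
    have := Real.add_one_le_exp |k|
    linarith
  have h4 : Real.exp ((s + 2) * |k|) = Real.exp |k| * Real.exp ((s + 1) * |k|) := by
    rw [← Real.exp_add]; congr 1; ring
  have h5 : 1 ≤ Real.exp ((s + 2) * |k|) := Real.one_le_exp (by positivity)
  calc |taylorRemainder s x k|
      = |taylorQuadratic s x k + (taylorRemainder s x k - taylorQuadratic s x k)| := by
        congr 1; ring
    _ ≤ s ^ 2 * (|x| + |k|) ^ 2 * 1 + C * (|x| + |k|) ^ 3 * Real.exp ((s + 1) * |k|) := by
        rw [mul_one]; exact (abs_add_le _ _).trans (add_le_add h2 h1)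
    _ = s ^ 2 * (|x| + |k|) ^ 2 * 1 +
        C * (|x| + |k|) ^ 2 * ((|x| + |k|) * Real.exp ((s + 1) * |k|)) := by ring
    _ ≤ s ^ 2 * (|x| + |k|) ^ 2 * Real.exp ((s + 2) * |k|) +
        C * (|x| + |k|) ^ 2 * Real.exp ((s + 2) * |k|) := by
        rw [h4] at h5 ⊢
        gcongr
    _ = _ := by ring

/-- The Lipschitz constant need not be small: the existence proof for the perturbation only needs a
global Lipschitz bound, and smallness comes from the linear estimate. -/
theorem taylorRemainder_lipschitz (s : ℝ) (hs : 1 < s) : ∃ C, 0 < C ∧ ∀ x x' k : ℝ,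
    |x| ≤ 1 / 2 → |x'| ≤ 1 / 2 →
    |taylorRemainder s x k - taylorRemainder s x' k| ≤ C * Real.exp ((s + 2) * |k|) * |x - x'| := by
  obtain ⟨M, hM, hb⟩ := exists_bound_one_add_rpow s (s - 1)
  refine ⟨M + s, by positivity, fun x x' k hx hx' => ?_⟩
  have h1 := (convex_Icc (-(1 / 2)) (1 / 2 : ℝ)).norm_image_sub_le_of_norm_hasDerivWithin_le
    (f := fun t : ℝ => (1 + t) ^ s)
    (fun t ht => (hasDerivAt_one_add_rpow s (abs_le.mpr ht)).hasDerivWithinAt)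
    (fun t ht => hb t (abs_le.mpr ht)) (abs_le.mp hx') (abs_le.mp hx)
  rw [Real.norm_eq_abs, Real.norm_eq_abs] at h1
  have hk0 := abs_nonneg k
  have h2 : Real.exp ((s - 1) / 2 * k) ≤ Real.exp ((s + 2) * |k|) := by
    apply Real.exp_le_exp.mpr
    have := le_abs_self k
    nlinarith
  have h3 : 1 ≤ Real.exp ((s + 2) * |k|) := Real.one_le_exp (by positivity)
  have e : taylorRemainder s x k - taylorRemainder s x' k =
      Real.exp ((s - 1) / 2 * k) * ((1 + x) ^ s - (1 + x') ^ s) - s * (x - x') := by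
    unfold taylorRemainder; ring
  rw [e]
  refine (abs_sub _ _).trans ?_
  rw [abs_mul, abs_mul s, abs_of_pos (Real.exp_pos _), abs_of_pos (show 0 < s by linarith)]
  calc _ ≤ Real.exp ((s + 2) * |k|) * (M * |x - x'|) +
        s * |x - x'| * Real.exp ((s + 2) * |k|) := by
        refine add_le_add ?_ (le_mul_of_one_le_right (by positivity) h3)
        gcongr
    _ = _ := by ring

/-! ### The first order correctors -/

theorem abs_log_le {y : ℝ} (hy : 0 < y) {r : ℝ} (hr : 0 < r) :
    |Real.log r| ≤ (1 / y + 1) * (min r 1 ^ (-y) * max r 1) := by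
  rcases le_total r 1 with h | h
  · rw [min_eq_left h, max_eq_right h, mul_one]
    have h1 := (Real.abs_log_mul_self_rpow_lt r y hr h hy).le
    have h2 := Real.rpow_pos_of_pos hr y
    rw [abs_mul, abs_of_pos h2] at h1
    rw [Real.rpow_neg hr.le, ← div_eq_mul_inv, le_div_iff₀ h2]
    linarith
  · rw [min_eq_right h, max_eq_left h, Real.one_rpow, one_mul, abs_of_nonneg (Real.log_nonneg h)]
    have h1 := Real.log_le_sub_one_of_pos hr
    have h2 : 0 < 1 / y * r := by positivity
    linarith

theorem ProfileBounds.rpow_mul_bound {d p q lam γ K s : ℝ} {Φ Φ₁ : ℝ → ℝ}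
    (h : ProfileBounds d p q lam γ K Φ Φ₁) (hs : s = p ∨ s = q) (k : ℕ) :
    ∃ C, 0 < C ∧ ∀ r, 0 < r →
      Φ r ^ s * max r 1 ^ k ≤ C * (min r 1 ^ (γ - 2) * decayWeight d lam r) := by
  obtain ⟨C, hC, hb⟩ : ∃ C, 0 < C ∧ ∀ r, 0 < r →
      Φ r ^ (s - 1) ≤ C * ((min r 1 ^ 2)⁻¹ * (max r 1 ^ (k + 2))⁻¹) := by
    rcases hs with rfl | rfl
    exacts [h.rpow_p _, h.rpow_q _]
  obtain ⟨C', hC', hb'⟩ := h.upper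
  refine ⟨C * C', by positivity, fun r hr => ?_⟩
  have hΦ := h.profile.pos r hr
  have ht : 0 < min r 1 := lt_min hr one_pos
  have hE : 0 < max r 1 := lt_max_of_lt_left hr
  have hcl := decayWeight_pos d lam hr
  have h1 := hb r hr
  have h2 := hb' r hr
  have h3 := Real.rpow_pos_of_pos ht γ
  have e : Φ r ^ s = Φ r ^ (s - 1) * Φ r := by
    rw [← Real.rpow_add_one hΦ.ne', sub_add_cancel]
  rw [e, Real.rpow_sub ht, Real.rpow_two]
  have h4 := Real.rpow_pos_of_pos hΦ (s - 1)
  calc _ ≤ C * ((min r 1 ^ 2)⁻¹ * (max r 1 ^ (k + 2))⁻¹) *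
        (C' * (min r 1 ^ γ * max r 1 ^ 2 * decayWeight d lam r)) * max r 1 ^ k := by gcongr
    _ = _ := by rw [pow_add]; field_simp

theorem ProfileBounds.div_sq_bound {d p q lam γ K : ℝ} {Φ Φ₁ : ℝ → ℝ}
    (h : ProfileBounds d p q lam γ K Φ Φ₁) :
    ∃ C, 0 < C ∧ ∀ r, 0 < r → Φ r / r ^ 2 ≤ C * (min r 1 ^ (γ - 2) * decayWeight d lam r) := by
  obtain ⟨C, hC, hb⟩ := h.upper
  refine ⟨C, hC, fun r hr => ?_⟩
  have ht : 0 < min r 1 := lt_min hr one_pos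
  have hE : 0 < max r 1 := lt_max_of_lt_left hr
  have e : r ^ 2 = min r 1 ^ 2 * max r 1 ^ 2 := by rw [← mul_pow, min_mul_max, mul_one]
  rw [div_le_iff₀ (by positivity), Real.rpow_sub ht, Real.rpow_two]
  refine (hb r hr).trans (le_of_eq ?_)
  rw [e]
  field_simp

theorem ProfileBounds.continuousOn_linPotential {d p q lam γ K : ℝ} {Φ Φ₁ : ℝ → ℝ}
    (h : ProfileBounds d p q lam γ K Φ Φ₁) : ContinuousOn (linPotential p q Φ) (Ioi 0) :=
  (continuousOn_const.mul (h.profile.continuousOn_rpow _)).add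
    (continuousOn_const.mul (h.profile.continuousOn_rpow _))

/-- Solvability of perturbations of the linearised equation. The source may have any power
singularity at the origin. -/
theorem ProfileBounds.exists_solution {d p q lam γ K ε B B₀ α : ℝ} {Φ Φ₁ : ℝ → ℝ}
    {N : ℝ → ℝ → ℝ} (h : ProfileBounds d p q lam γ K Φ Φ₁)
    (hN : ContinuousOn (fun z : ℝ × ℝ => N z.1 z.2) (Ioi 0 ×ˢ univ))
    (hL : ∀ r, 0 < r → ∀ x y, |N r x - N r y| ≤ B * (r ^ 2)⁻¹ * |x - y|)
    (h0 : ∀ r, 0 < r → |N r 0| ≤ B₀ * (min r 1 ^ (α - 2) * decayWeight d lam r)) :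
    ∃ w w₁, IsDecayingSolution d lam ε
      (fun r => linPotential p q Φ r * w r + N r (w r)) w w₁ := by
  obtain ⟨B', hB', hP⟩ := h.linPotential_bound
  obtain ⟨n, hn⟩ := exists_nat_ge (-(α - 2 - (d - 2) / 2) / 2)
  have hB₀ : 0 ≤ B₀ := by
    have h1 := (abs_nonneg _).trans (h0 1 one_pos)
    have h2 := decayWeight_pos d lam one_pos
    rw [min_self, Real.one_rpow, one_mul] at h1
    exact nonneg_of_mul_nonneg_left h1 h2
  refine exists_isDecayingSolution (H := fun r x => linPotential p q Φ r * x + N r x)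
    (B := B' + B) (B₀ := B₀) (n := n) h.lam_le ?_ (fun r hr x y => ?_) (fun r hr => ?_)
    (fun r hr hr1 => ?_)
  · exact ((h.continuousOn_linPotential.comp continuousOn_fst fun z hz => hz.1).mul
      continuousOn_snd).add hN
  · have e : linPotential p q Φ r * x + N r x - (linPotential p q Φ r * y + N r y) =
        linPotential p q Φ r * (x - y) + (N r x - N r y) := by ring
    rw [e, add_mul, add_mul]
    refine (abs_add_le _ _).trans (add_le_add ?_ (hL r hr x y))
    rw [abs_mul]
    exact mul_le_mul_of_nonneg_right (hP r hr) (abs_nonneg _)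
  · have := h0 r (show 0 < r by linarith)
    rw [min_eq_right hr, Real.one_rpow, one_mul, decayWeight_of_one_le d lam hr] at this
    simpa using this
  · have h1 := h0 r hr
    rw [min_eq_left hr1, decayWeight_of_le_one d lam hr1, ← mul_assoc (r ^ (α - 2)),
      ← Real.rpow_add hr] at h1
    rw [mul_zero, zero_add]
    refine h1.trans (mul_le_mul_of_nonneg_left ?_ hB₀)
    have hexp2 : Real.exp (-1 / 2) ≤ 1 := Real.exp_le_one_iff.mpr (by norm_num)
    refine (mul_le_of_le_one_right (Real.rpow_pos_of_pos hr _).le hexp2).trans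
      (rpow_le_inv_sq_pow hr hr1 ?_)
    linarith

/-- The source of the equation for `χ = ψ - Φ`, where `ψ` is the corrector at the parameter `ε`. -/
def correctorSource (d p q : ℝ) (Φ Φ₁ : ℝ → ℝ) (ε r : ℝ) : ℝ :=
  (p - 1) * ((Real.log r / 2 + 1) * Φ r ^ p) + (q - 1) * ((Real.log r / 2 + 1) * Φ r ^ q) +
    (ε / 4 + d / 2 - 1) * (Φ r / r ^ 2) + (1 + ε) * (Φ₁ r / r + Φ r)

theorem ProfileBounds.correctorSource_bound {d p q lam γ K : ℝ} {Φ Φ₁ : ℝ → ℝ}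
    (h : ProfileBounds d p q lam γ K Φ Φ₁) :
    ∃ C, 0 < C ∧ ∀ ε r, |ε| ≤ 1 → 0 < r → |correctorSource d p q Φ Φ₁ ε r| ≤
      C * (min r 1 ^ (γ / 2 - 2) * decayWeight d lam r) := by
  have hγ := h.γ_pos
  have hp := h.one_lt_p
  have hq := h.one_lt_q
  have hd := h.dim
  obtain ⟨C₁, hC₁, h1⟩ := h.rpow_mul_bound (Or.inl rfl) 1
  obtain ⟨C₂, hC₂, h2⟩ := h.rpow_mul_bound (Or.inr rfl) 1
  obtain ⟨C₃, hC₃, h3⟩ := h.div_sq_bound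
  obtain ⟨C₄, hC₄, h4⟩ := h.slope
  obtain ⟨L, hL⟩ : ∃ L, L = 1 / (γ / 2) + 1 + 1 := ⟨_, rfl⟩
  have hL0 : 0 < L := by rw [hL]; positivity
  refine ⟨(p - 1) * (L * C₁) + (q - 1) * (L * C₂) + (1 + d) * C₃ + 2 * C₄, ?_, ?_⟩
  · have : 0 < p - 1 := by linarith
    have : 0 < q - 1 := by linarith
    positivity
  intro ε r hε hr
  have hε' := abs_le.mp hε
  have hΦ := h.profile.pos r hr
  have ht : 0 < min r 1 := lt_min hr one_pos
  have ht1 : min r 1 ≤ 1 := min_le_right r 1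
  have hE : 1 ≤ max r 1 := le_max_right r 1
  have hcl := decayWeight_pos d lam hr
  have hpow : min r 1 ^ (γ - 2) ≤ min r 1 ^ (γ / 2 - 2) :=
    Real.rpow_le_rpow_of_exponent_ge ht ht1 (by linarith)
  have hpow0 := Real.rpow_pos_of_pos ht (γ - 2)
  have hpow1 := Real.rpow_pos_of_pos ht (-(γ / 2))
  have hlog : |Real.log r / 2 + 1| ≤ L * (min r 1 ^ (-(γ / 2)) * max r 1) := by
    have e1 := abs_log_le (show 0 < γ / 2 by linarith) hr
    have e2 : 1 ≤ min r 1 ^ (-(γ / 2)) * max r 1 :=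
      one_le_mul_of_one_le_of_one_le
        (Real.one_le_rpow_of_pos_of_le_one_of_nonpos ht ht1 (by linarith)) hE
    have e3 : |Real.log r / 2 + 1| ≤ |Real.log r| + 1 := by
      refine (abs_add_le _ _).trans ?_
      rw [abs_div, abs_two, abs_one]
      linarith [abs_nonneg (Real.log r)]
    rw [hL, add_mul]
    linarith
  have hterm : ∀ {s C : ℝ}, (Φ r ^ s * max r 1 ^ 1 ≤ C * (min r 1 ^ (γ - 2) *
      decayWeight d lam r)) → |(Real.log r / 2 + 1) * Φ r ^ s| ≤
      L * C * (min r 1 ^ (γ / 2 - 2) * decayWeight d lam r) := by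
    intro s C hs
    have e1 := Real.rpow_pos_of_pos hΦ s
    rw [abs_mul, abs_of_pos e1]
    have e2 : min r 1 ^ (γ / 2 - 2) = min r 1 ^ (-(γ / 2)) * min r 1 ^ (γ - 2) := by
      rw [← Real.rpow_add ht]; congr 1; ring
    calc _ ≤ L * (min r 1 ^ (-(γ / 2)) * max r 1) * Φ r ^ s := by gcongr
      _ = L * min r 1 ^ (-(γ / 2)) * (Φ r ^ s * max r 1 ^ 1) := by ring
      _ ≤ L * min r 1 ^ (-(γ / 2)) * (C * (min r 1 ^ (γ - 2) * decayWeight d lam r)) := by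
        gcongr
      _ = _ := by rw [e2]; ring
  have t1 := hterm (h1 r hr)
  have t2 := hterm (h2 r hr)
  have hX : min r 1 ^ (γ - 2) * decayWeight d lam r ≤
      min r 1 ^ (γ / 2 - 2) * decayWeight d lam r := by gcongr
  have t3 : |Φ r / r ^ 2| ≤ C₃ * (min r 1 ^ (γ / 2 - 2) * decayWeight d lam r) := by
    rw [abs_of_pos (by positivity)]
    exact (h3 r hr).trans (by gcongr)
  have t4 := (h4 r hr).trans (mul_le_mul_of_nonneg_left hX hC₄.le)
  obtain ⟨X, hX_def⟩ : ∃ X, X = min r 1 ^ (γ / 2 - 2) * decayWeight d lam r := ⟨_, rfl⟩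
  rw [← hX_def] at t1 t2 t3 t4 ⊢
  unfold correctorSource
  have c3 : |ε / 4 + d / 2 - 1| ≤ 1 + d := by rw [abs_le]; constructor <;> linarith
  have c4 : |1 + ε| ≤ 2 := by rw [abs_le]; constructor <;> linarith
  have c1 : |p - 1| = p - 1 := abs_of_pos (by linarith)
  have c2 : |q - 1| = q - 1 := abs_of_pos (by linarith)
  have b1 := mul_le_mul_of_nonneg_left t1 (abs_nonneg (p - 1))
  have b2 := mul_le_mul_of_nonneg_left t2 (abs_nonneg (q - 1))
  have b3 := mul_le_mul c3 t3 (abs_nonneg _) (by linarith)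
  have b4 := mul_le_mul c4 t4 (abs_nonneg _) (by norm_num)
  rw [← abs_mul] at b1 b2 b3 b4
  rw [c1] at b1
  rw [c2] at b2
  have s1 := abs_add_le ((p - 1) * ((Real.log r / 2 + 1) * Φ r ^ p) +
    (q - 1) * ((Real.log r / 2 + 1) * Φ r ^ q) + (ε / 4 + d / 2 - 1) * (Φ r / r ^ 2))
    ((1 + ε) * (Φ₁ r / r + Φ r))
  have s2 := abs_add_le ((p - 1) * ((Real.log r / 2 + 1) * Φ r ^ p) +
    (q - 1) * ((Real.log r / 2 + 1) * Φ r ^ q)) ((ε / 4 + d / 2 - 1) * (Φ r / r ^ 2))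
  have s3 := abs_add_le ((p - 1) * ((Real.log r / 2 + 1) * Φ r ^ p))
    ((q - 1) * ((Real.log r / 2 + 1) * Φ r ^ q))
  linarith

theorem ProfileBounds.continuousOn_correctorSource {d p q lam γ K : ℝ} {Φ Φ₁ : ℝ → ℝ}
    (h : ProfileBounds d p q lam γ K Φ Φ₁) (ε : ℝ) :
    ContinuousOn (correctorSource d p q Φ Φ₁ ε) (Ioi 0) := by
  have hlog : ContinuousOn (fun r : ℝ => Real.log r / 2 + 1) (Ioi 0) :=
    ((Real.continuousOn_log.mono fun r hr => ne_of_gt hr).div_const 2).add continuousOn_const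
  exact ((((continuousOn_const.mul (hlog.mul (h.profile.continuousOn_rpow p))).add
      (continuousOn_const.mul (hlog.mul (h.profile.continuousOn_rpow q)))).add
      (continuousOn_const.mul (h.profile.continuousOn.div (continuousOn_id.pow 2)
        fun r hr => (pow_pos hr 2).ne'))).add
      (continuousOn_const.mul ((h.profile.continuousOn'.div continuousOn_id
        fun r hr => ne_of_gt hr).add h.profile.continuousOn)))

theorem ProfileBounds.exists_corrector {d p q lam γ K : ℝ} {Φ Φ₁ : ℝ → ℝ}
    (h : ProfileBounds d p q lam γ K Φ Φ₁) {ε : ℝ} (hε : |ε| ≤ 1) :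
    ∃ χ χ₁, IsDecayingSolution d lam ε
      (fun r => linPotential p q Φ r * χ r + correctorSource d p q Φ Φ₁ ε r) χ χ₁ := by
  obtain ⟨C, hC, hb⟩ := h.correctorSource_bound
  refine h.exists_solution (N := fun r _ => correctorSource d p q Φ Φ₁ ε r) (B := 0) ?_
    (fun r hr x y => by simp) (fun r hr => hb ε r hε hr)
  exact (h.continuousOn_correctorSource ε).comp continuousOn_fst fun z hz => hz.1

/-- The correctors are bounded by the weight, uniformly as long as `|ε| log (1/rs) ≤ 1`. -/
theorem ProfileBounds.corrector_bound {d p q lam γ K : ℝ} {Φ Φ₁ : ℝ → ℝ}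
    (h : ProfileBounds d p q lam γ K Φ Φ₁) :
    ∃ C, 0 < C ∧ ∀ (ε rs : ℝ) (χ χ₁ : ℝ → ℝ), |ε| ≤ 1 → 0 < rs → rs ≤ 1 →
      |ε| * -Real.log rs ≤ 1 →
      IsDecayingSolution d lam ε
        (fun r => linPotential p q Φ r * χ r + correctorSource d p q Φ Φ₁ ε r) χ χ₁ →
      ∀ r, rs ≤ r → |χ r| ≤ C * decayWeight d lam r := by
  have hγ := h.γ_pos
  obtain ⟨C, hC, hb⟩ := h.correctorSource_bound
  obtain ⟨C', hC', hb'⟩ := h.linear_estimate (α := γ / 2) (by positivity)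
  refine ⟨C' * (C * (1 + 1 / (γ / 2))), by positivity,
    fun ε rs χ χ₁ hε hrs hrs1 hlog hχ r hr => ?_⟩
  refine (hb' ε rs C _ χ χ₁ hε hrs hrs1 hlog hC hχ
    (fun r hr => hb ε r hε (hrs.trans_le hr)) r hr).1.trans ?_
  have hcl := decayWeight_pos d lam (hrs.trans_le hr)
  gcongr
  unfold powerTail
  have := Real.rpow_pos_of_pos hrs (γ / 2)
  gcongr
  linarith

theorem exists_bound_of_tail {d lam y rs : ℝ} {f : ℝ → ℝ} (hrs : 0 < rs)
    (hf : ContinuousOn f (Ioi 0))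
    (h : ∃ C, 0 < C ∧ ∀ r, 1 ≤ r → |f r| ≤ C * decayWeight d lam r) :
    ∃ C, 0 < C ∧ ∀ r, rs ≤ r → |f r| ≤ C * (min r 1 ^ y * decayWeight d lam r) := by
  obtain ⟨C, hC, hb⟩ := h
  have hm : ContinuousOn (fun r : ℝ => min r 1) (Ioi 0) :=
    (continuous_id.min continuous_const).continuousOn
  have hc : ContinuousOn (fun r : ℝ => min r 1 ^ y * decayWeight d lam r) (Ioi 0) :=
    (hm.rpow_const fun r hr => Or.inl (lt_min hr one_pos).ne').mul (continuousOn_decayWeight d lam)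
  have hpos : ∀ r : ℝ, 0 < r → 0 < min r 1 ^ y * decayWeight d lam r := fun r hr =>
    mul_pos (Real.rpow_pos_of_pos (lt_min hr one_pos) _) (decayWeight_pos d lam hr)
  obtain ⟨C', hC', hb'⟩ := exists_bound_Icc (b := 1) hrs hf hc hpos
  refine ⟨C + C', by positivity, fun r hr => ?_⟩
  have := hpos r (hrs.trans_le hr)
  rcases le_total r 1 with h1 | h1
  · exact (hb' r hr h1).trans (by gcongr; linarith)
  · have h2 := hb r h1
    rw [← one_mul (decayWeight d lam r), ← Real.one_rpow y] at h2
    rw [min_eq_right h1] at this ⊢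
    exact h2.trans (by gcongr; linarith)

/-- The Gaussian decay cancels to leading order in `w₁ r / r + w r`, the combination that appears
when `ε` is changed. -/
theorem IsDecayingSolution.slope_bound {d lam ε : ℝ} {F w w₁ : ℝ → ℝ}
    (h : IsDecayingSolution d lam ε F w w₁) :
    ∃ C, 0 < C ∧ ∀ r, 1 ≤ r → |w₁ r / r + w r| ≤ C * decayWeight d lam r := by
  obtain ⟨M, hM⟩ := h.decay
  refine ⟨|M| + 1, by positivity, fun r hr => ?_⟩
  have hr0 : 0 < r := by linarith
  have hG := gaussianTail_pos d lam hr0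
  have e : w₁ r / r + w r = (w₁ r + r * w r) / r := by field_simp
  rw [e, abs_div, abs_of_pos hr0, div_le_iff₀ hr0, decayWeight_of_one_le d lam hr]
  calc _ ≤ M * (gaussianTail d lam r * (r ^ 3)⁻¹) := (hM r hr).2
    _ ≤ (|M| + 1) * (gaussianTail d lam r * (r ^ 1)⁻¹) := by
      gcongr
      · linarith [le_abs_self M]
      · norm_num
    _ = (|M| + 1) * (gaussianTail d lam r * (r ^ 2)⁻¹) * r := by field_simp

/-- Bound for the error term of `IsDecayingSolution.change_parameter` on `[rs, ∞)`. -/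
theorem IsDecayingSolution.slope_bound_of_le {d lam y rs : ℝ} {ε : ℝ} {F w w₁ : ℝ → ℝ}
    (hrs : 0 < rs) (h : IsDecayingSolution d lam ε F w w₁) :
    ∃ C, 0 < C ∧ ∀ r, rs ≤ r →
      |w₁ r / r + w r| ≤ C * (min r 1 ^ y * decayWeight d lam r) :=
  exists_bound_of_tail hrs ((h.continuousOn'.div continuousOn_id fun _ hr => ne_of_gt hr).add
    h.continuousOn) h.slope_bound

/-- The correctors depend in a Lipschitz way on `ε`, away from the origin. -/
theorem ProfileBounds.corrector_lipschitz {d p q lam γ K rs : ℝ} {Φ Φ₁ χ χ₁ : ℝ → ℝ}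
    (h : ProfileBounds d p q lam γ K Φ Φ₁) (hrs : 0 < rs) (hrs1 : rs ≤ 1)
    (hχ : IsDecayingSolution d lam 0
      (fun r => linPotential p q Φ r * χ r + correctorSource d p q Φ Φ₁ 0 r) χ χ₁) :
    ∃ C, 0 < C ∧ ∀ (ε : ℝ) (χ' χ₁' : ℝ → ℝ), |ε| ≤ 1 → |ε| * -Real.log rs ≤ 1 →
      IsDecayingSolution d lam ε
        (fun r => linPotential p q Φ r * χ' r + correctorSource d p q Φ Φ₁ ε r) χ' χ₁' →
      ∀ r, rs ≤ r → |χ' r - χ r| ≤ C * |ε| * decayWeight d lam r := by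
  obtain ⟨C₁, hC₁, h1⟩ := hχ.slope_bound_of_le (y := 1 - 2) hrs
  obtain ⟨C₂, hC₂, h2⟩ := h.div_sq_bound
  obtain ⟨C₃, hC₃, h3⟩ := h.slope
  obtain ⟨C₄, hC₄, h4⟩ := h.linear_estimate one_ne_zero
  have hγ := h.γ_pos
  obtain ⟨C₅, hC₅, h5⟩ := exists_bound_of_tail (d := d) (lam := lam) (y := 1 - 2)
    (f := fun r => Φ r / r ^ 2 / 4 + (Φ₁ r / r + Φ r)) hrs
    (((h.profile.continuousOn.div (continuousOn_id.pow 2) fun r hr =>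
      (pow_pos hr 2).ne').div_const 4).add ((h.profile.continuousOn'.div continuousOn_id
        fun r hr => ne_of_gt hr).add h.profile.continuousOn))
    ⟨C₂ + C₃, by positivity, fun r hr => by
      have hr0 : 0 < r := by linarith
      have e2 := h2 r hr0
      have e3 := h3 r hr0
      rw [min_eq_right hr, Real.one_rpow, one_mul] at e2 e3
      have hΦ := h.profile.pos r hr0
      have e4 : 0 ≤ Φ r / r ^ 2 := by positivity
      refine (abs_add_le _ _).trans ?_
      rw [abs_of_nonneg (by positivity), add_mul]
      linarith⟩
  have hζ : 0 ≤ powerTail 1 rs := powerTail_nonneg hrs hrs1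
  refine ⟨C₄ * ((C₅ + C₁) * (1 + powerTail 1 rs)), by positivity,
    fun ε χ' χ₁' hε hlog hχ' r hr => ?_⟩
  rcases eq_or_ne ε 0 with rfl | hε0
  · -- for `ε = 0` the estimate is the uniqueness of the decaying solution
    have key : ∀ Y, 0 < Y →
        |χ' r - χ r| ≤ C₄ * (Y * (1 + powerTail 1 rs)) * decayWeight d lam r := fun Y hY =>
      (h4 0 rs Y (fun _ => 0) _ _ hε hrs hrs1 hlog hY
        ((hχ'.sub hχ).congr fun r _ => by ring) (fun t ht => by
          rw [abs_zero]
          have := decayWeight_pos d lam (hrs.trans_le ht)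
          have := Real.rpow_pos_of_pos (lt_min (hrs.trans_le ht) one_pos) (1 - 2)
          positivity) r hr).1
    have hlim : Tendsto (fun Y : ℝ => C₄ * (Y * (1 + powerTail 1 rs)) * decayWeight d lam r)
        (𝓝[>] 0) (𝓝 (C₄ * (0 * (1 + powerTail 1 rs)) * decayWeight d lam r)) :=
      (((tendsto_id.mono_left nhdsWithin_le_nhds).mul_const _).const_mul _).mul_const _
    have := ge_of_tendsto hlim (eventually_nhdsWithin_of_forall key)
    simpa using this
  · have hε1 : 0 < |ε| := abs_pos.mpr hε0
    refine ((h4 ε rs ((C₅ + C₁) * |ε|) (fun r => ε * (Φ r / r ^ 2 / 4 + (Φ₁ r / r + Φ r)) +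
      ε * (χ₁ r / r + χ r)) _ _ hε hrs hrs1 hlog (by positivity)
      ((hχ'.sub (hχ.change_parameter ε)).congr fun r _ => by unfold correctorSource; ring)
      (fun t ht => ?_) r hr).1).trans (le_of_eq (by ring))
    have e1 := h1 t ht
    have e5 := h5 t ht
    refine (abs_add_le _ _).trans ?_
    rw [abs_mul ε, abs_mul ε]
    have a1 := mul_le_mul_of_nonneg_left e1 hε1.le
    have a5 := mul_le_mul_of_nonneg_left e5 hε1.le
    linarith

/-! ### The nonlinear remainder -/

/-- The quadratic remainder of the equation for `φ = Φ y`, when `r^(ε/2) (Φ + ε φ)` is inserted in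
the nonlinear equation with parameter `lam + ε` and the result is divided by `ε`. -/
def nonlinearSource (d p q : ℝ) (Φ : ℝ → ℝ) (ε r y : ℝ) : ℝ :=
  ε⁻¹ * (Φ r ^ p * taylorRemainder p (ε * y) (ε * Real.log r) +
      Φ r ^ q * taylorRemainder q (ε * y) (ε * Real.log r)) +
    ε / 2 * (ε / 2 + d - 2) * (Φ r / r ^ 2 * y)

/-- The limit of `nonlinearSource / ε` as `ε → 0`. -/
def quadraticSource (d p q : ℝ) (Φ : ℝ → ℝ) (r y : ℝ) : ℝ :=
  Φ r ^ p * taylorQuadratic p y (Real.log r) + Φ r ^ q * taylorQuadratic q y (Real.log r) +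
    (d - 2) / 2 * (Φ r / r ^ 2 * y)

/-- On `[rs, 1]` the factor `r^ε` is bounded, and for `r ≥ 1` it grows at most polynomially; the
growth is absorbed by the decay of `Φ^(p-1)`. -/
theorem exp_abs_log_le {c ε rs r : ℝ} (hc : 0 ≤ c) (hε : |ε| ≤ 1) (hrs : 0 < rs)
    (hlog : |ε| * -Real.log rs ≤ 1) (hr : rs ≤ r) :
    Real.exp (c * |ε * Real.log r|) ≤ Real.exp c * max r 1 ^ ⌈c⌉₊ := by
  have hr0 : 0 < r := hrs.trans_le hr
  rw [abs_mul]
  rcases le_total r 1 with h | h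
  · rw [max_eq_right h, one_pow, mul_one, abs_of_nonpos (Real.log_nonpos hr0.le h)]
    apply Real.exp_le_exp.mpr
    have h1 := Real.log_le_log hrs hr
    have h2 : |ε| * -Real.log r ≤ 1 := (by gcongr : _ ≤ |ε| * -Real.log rs).trans hlog
    exact mul_le_of_le_one_right hc h2
  · rw [max_eq_left h, abs_of_nonneg (Real.log_nonneg h)]
    have h1 := Real.log_nonneg h
    calc Real.exp (c * (|ε| * Real.log r)) ≤ Real.exp (c + ⌈c⌉₊ * Real.log r) := by
          apply Real.exp_le_exp.mpr
          have h2 : c * (|ε| * Real.log r) ≤ ⌈c⌉₊ * Real.log r := by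
            have h3 : |ε| * Real.log r ≤ Real.log r := mul_le_of_le_one_left h1 hε
            exact mul_le_mul (Nat.le_ceil c) h3 (by positivity) (by positivity)
          linarith
      _ = _ := by
          rw [Real.exp_add, mul_comm (⌈c⌉₊ : ℝ), ← Real.rpow_natCast, Real.rpow_def_of_pos hr0]

theorem abs_add_abs_log_le {γ A r y : ℝ} (hγ : 0 < γ) (hr : 0 < r) (hA : 0 ≤ A)
    (hy : |y| ≤ A * min r 1 ^ (-γ)) :
    |y| + |Real.log r| ≤ (A + (1 / γ + 1)) * (min r 1 ^ (-γ) * max r 1) := by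
  have h1 := abs_log_le hγ hr
  have h2 := Real.rpow_pos_of_pos (lt_min hr one_pos) (-γ)
  have h3 : min r 1 ^ (-γ) ≤ min r 1 ^ (-γ) * max r 1 :=
    le_mul_of_one_le_right h2.le (le_max_right r 1)
  rw [add_mul]
  exact add_le_add (hy.trans (by gcongr)) h1

theorem ProfileBounds.rpow_mul_pow_bound {d p q lam γ K s : ℝ} {Φ Φ₁ : ℝ → ℝ}
    (h : ProfileBounds d p q lam γ K Φ Φ₁) (hs : s = p ∨ s = q) (n k : ℕ) :
    ∃ C, 0 < C ∧ ∀ r, 0 < r →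
      Φ r ^ s * ((min r 1 ^ (-γ) * max r 1) ^ n * max r 1 ^ k) ≤
        C * (min r 1 ^ ((1 - n) * γ - 2) * decayWeight d lam r) := by
  obtain ⟨C, hC, hb⟩ := h.rpow_mul_bound hs (n + k)
  refine ⟨C, hC, fun r hr => ?_⟩
  have ht := lt_min hr one_pos
  have h1 := Real.rpow_pos_of_pos ht (-γ)
  have e : min r 1 ^ ((1 - n) * γ - 2) = (min r 1 ^ (-γ)) ^ n * min r 1 ^ (γ - 2) := by
    rw [← Real.rpow_natCast, ← Real.rpow_mul ht.le, ← Real.rpow_add ht]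
    congr 1; ring
  rw [e, mul_pow]
  calc _ = (min r 1 ^ (-γ)) ^ n * (Φ r ^ s * max r 1 ^ (n + k)) := by rw [pow_add]; ring
    _ ≤ (min r 1 ^ (-γ)) ^ n * (C * (min r 1 ^ (γ - 2) * decayWeight d lam r)) :=
      mul_le_mul_of_nonneg_left (hb r hr) (by positivity)
    _ = _ := by ring

theorem min_one_rpow_anti {r x y : ℝ} (hr : 0 < r) (h : x ≤ y) : min r 1 ^ y ≤ min r 1 ^ x :=
  Real.rpow_le_rpow_of_exponent_ge (lt_min hr one_pos) (min_le_right r 1) h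

theorem ProfileBounds.div_sq_mul_bound {d p q lam γ K : ℝ} {Φ Φ₁ : ℝ → ℝ}
    (h : ProfileBounds d p q lam γ K Φ Φ₁) :
    ∃ C, 0 < C ∧ ∀ A r y : ℝ, 0 < r → |y| ≤ A * min r 1 ^ (-γ) →
      |Φ r / r ^ 2 * y| ≤ C * A * (min r 1 ^ (-γ - 2) * decayWeight d lam r) := by
  obtain ⟨C, hC, hb⟩ := h.div_sq_bound
  refine ⟨C, hC, fun A r y hr hy => ?_⟩
  have hγ := h.γ_pos
  have hΦ := h.profile.pos r hr
  have hcl := decayWeight_pos d lam hr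
  have ht := lt_min hr one_pos
  have hA : 0 ≤ A := nonneg_of_mul_nonneg_left ((abs_nonneg y).trans hy) (Real.rpow_pos_of_pos ht _)
  have hpow := Real.rpow_pos_of_pos ht (γ - 2)
  rw [abs_mul, abs_of_pos (show 0 < Φ r / r ^ 2 by positivity)]
  have e4 : min r 1 ^ (γ - 2) * min r 1 ^ (-γ) ≤ min r 1 ^ (-γ - 2) := by
    rw [← Real.rpow_add ht]
    exact min_one_rpow_anti hr (by linarith)
  calc _ ≤ C * (min r 1 ^ (γ - 2) * decayWeight d lam r) * (A * min r 1 ^ (-γ)) :=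
        mul_le_mul (hb r hr) hy (abs_nonneg _) (by positivity)
    _ = C * A * (min r 1 ^ (γ - 2) * min r 1 ^ (-γ) * decayWeight d lam r) := by ring
    _ ≤ _ := by gcongr

theorem ProfileBounds.remainder_bound {d p q lam γ K s A : ℝ} {Φ Φ₁ : ℝ → ℝ}
    (h : ProfileBounds d p q lam γ K Φ Φ₁) (hs : s = p ∨ s = q) (hA : 0 < A) :
    ∃ C, 0 < C ∧ ∀ ε rs r y : ℝ, |ε| ≤ 1 → 0 < rs → |ε| * -Real.log rs ≤ 1 → rs ≤ r →
      |y| ≤ A * min r 1 ^ (-γ) → |ε * y| ≤ 1 / 2 →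
      |Φ r ^ s * taylorRemainder s (ε * y) (ε * Real.log r)| ≤
        C * |ε| ^ 2 * (min r 1 ^ (-γ - 2) * decayWeight d lam r) := by
  have hγ := h.γ_pos
  have hs1 : 1 < s := by
    rcases hs with rfl | rfl
    exacts [h.one_lt_p, h.one_lt_q]
  obtain ⟨C₁, hC₁, h1⟩ := abs_taylorRemainder_le s hs1
  obtain ⟨C₂, hC₂, h2⟩ := h.rpow_mul_pow_bound hs 2 ⌈s + 2⌉₊
  refine ⟨C₁ * (A + (1 / γ + 1)) ^ 2 * Real.exp (s + 2) * C₂, by positivity, ?_⟩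
  intro ε rs r y hε hrs hlog hr hy hεy
  have hr0 : 0 < r := hrs.trans_le hr
  have hΦ := Real.rpow_pos_of_pos (h.profile.pos r hr0) s
  have e1 := h1 (ε * y) (ε * Real.log r) hεy
  have e2 := h2 r hr0
  have e3 := exp_abs_log_le (show 0 ≤ s + 2 by linarith) hε hrs hlog hr
  have e4 := abs_add_abs_log_le hγ hr0 hA.le hy
  have e5 : (1 - ((2 : ℕ) : ℝ)) * γ - 2 = -γ - 2 := by push_cast; ring
  rw [e5] at e2
  rw [abs_mul ε y, abs_mul ε (Real.log r), ← mul_add] at e1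
  rw [abs_mul (Φ r ^ s), abs_of_pos hΦ]
  rw [abs_mul ε (Real.log r)] at e3
  have e6 : 0 ≤ |y| + |Real.log r| := by positivity
  calc _ ≤ Φ r ^ s * (C₁ * (|ε| * ((A + (1 / γ + 1)) * (min r 1 ^ (-γ) * max r 1))) ^ 2 *
        (Real.exp (s + 2) * max r 1 ^ ⌈s + 2⌉₊)) := by
        refine mul_le_mul_of_nonneg_left (e1.trans ?_) hΦ.le
        gcongr
    _ = C₁ * (A + (1 / γ + 1)) ^ 2 * Real.exp (s + 2) * |ε| ^ 2 *
        (Φ r ^ s * ((min r 1 ^ (-γ) * max r 1) ^ 2 * max r 1 ^ ⌈s + 2⌉₊)) := by ring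
    _ ≤ C₁ * (A + (1 / γ + 1)) ^ 2 * Real.exp (s + 2) * |ε| ^ 2 *
        (C₂ * (min r 1 ^ (-γ - 2) * decayWeight d lam r)) := by gcongr
    _ = _ := by ring

theorem ProfileBounds.nonlinearSource_bound {d p q lam γ K A : ℝ} {Φ Φ₁ : ℝ → ℝ}
    (h : ProfileBounds d p q lam γ K Φ Φ₁) (hA : 0 < A) :
    ∃ C, 0 < C ∧ ∀ ε rs r y : ℝ, ε ≠ 0 → |ε| ≤ 1 → 0 < rs → |ε| * -Real.log rs ≤ 1 → rs ≤ r →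
      |y| ≤ A * min r 1 ^ (-γ) → |ε * y| ≤ 1 / 2 →
      |nonlinearSource d p q Φ ε r y| ≤
        C * |ε| * (min r 1 ^ (-γ - 2) * decayWeight d lam r) := by
  have hγ := h.γ_pos
  have hd := h.dim
  obtain ⟨C₁, hC₁, h1⟩ := h.remainder_bound (Or.inl rfl) hA
  obtain ⟨C₂, hC₂, h2⟩ := h.remainder_bound (Or.inr rfl) hA
  obtain ⟨C₃, hC₃, h3⟩ := h.div_sq_mul_bound
  refine ⟨C₁ + C₂ + d * (C₃ * A), by positivity, ?_⟩
  intro ε rs r y hε0 hε hrs hlog hr hy hεy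
  have hr0 : 0 < r := hrs.trans_le hr
  have hΦ := h.profile.pos r hr0
  have hcl := decayWeight_pos d lam hr0
  have hε1 : 0 < |ε| := abs_pos.mpr hε0
  have e1 := h1 ε rs r y hε hrs hlog hr hy hεy
  have e2 := h2 ε rs r y hε hrs hlog hr hy hεy
  have e3 := h3 A r y hr0 hy
  have e5 : |ε / 2 * (ε / 2 + d - 2)| ≤ |ε| * d := by
    rw [abs_mul, abs_div, abs_two]
    have h6 := abs_le.mp hε
    have h7 : |ε / 2 + d - 2| ≤ d := by rw [abs_le]; constructor <;> linarith
    calc _ ≤ |ε| / 1 * d := by gcongr; norm_num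
      _ = _ := by ring
  obtain ⟨X, hX⟩ : ∃ X, X = min r 1 ^ (-γ - 2) * decayWeight d lam r := ⟨_, rfl⟩
  rw [← hX] at e1 e2 e3 ⊢
  have b3 := mul_le_mul e5 e3 (abs_nonneg _) (by positivity)
  rw [← abs_mul] at b3
  have b1 : |ε⁻¹ * (Φ r ^ p * taylorRemainder p (ε * y) (ε * Real.log r) +
      Φ r ^ q * taylorRemainder q (ε * y) (ε * Real.log r))| ≤ (C₁ + C₂) * |ε| * X := by
    rw [abs_mul, abs_inv, inv_mul_le_iff₀ hε1]
    refine (abs_add_le _ _).trans ?_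
    linarith
  refine (abs_add_le _ _).trans ?_
  linarith

theorem ProfileBounds.quadraticSource_bound {d p q lam γ K A : ℝ} {Φ Φ₁ : ℝ → ℝ}
    (h : ProfileBounds d p q lam γ K Φ Φ₁) (hA : 0 < A) :
    ∃ C, 0 < C ∧ ∀ r y : ℝ, 0 < r → |y| ≤ A * min r 1 ^ (-γ) →
      |quadraticSource d p q Φ r y| ≤ C * (min r 1 ^ (-γ - 2) * decayWeight d lam r) := by
  have hγ := h.γ_pos
  have hd := h.dim
  obtain ⟨C₁, hC₁, h1⟩ := h.rpow_mul_pow_bound (Or.inl rfl) 2 0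
  obtain ⟨C₂, hC₂, h2⟩ := h.rpow_mul_pow_bound (Or.inr rfl) 2 0
  obtain ⟨C₃, hC₃, h3⟩ := h.div_sq_mul_bound
  have hp := h.one_lt_p
  have hq := h.one_lt_q
  refine ⟨p ^ 2 * (A + (1 / γ + 1)) ^ 2 * C₁ + q ^ 2 * (A + (1 / γ + 1)) ^ 2 * C₂ +
    d * (C₃ * A), by positivity, ?_⟩
  intro r y hr hy
  have hΦ := h.profile.pos r hr
  have hcl := decayWeight_pos d lam hr
  have e5 : (1 - ((2 : ℕ) : ℝ)) * γ - 2 = -γ - 2 := by push_cast; ring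
  have hterm : ∀ s C : ℝ, 1 < s →
      Φ r ^ s * ((min r 1 ^ (-γ) * max r 1) ^ 2 * max r 1 ^ 0) ≤
        C * (min r 1 ^ ((1 - ((2 : ℕ) : ℝ)) * γ - 2) * decayWeight d lam r) →
      |Φ r ^ s * taylorQuadratic s y (Real.log r)| ≤
        s ^ 2 * (A + (1 / γ + 1)) ^ 2 * C * (min r 1 ^ (-γ - 2) * decayWeight d lam r) := by
    intro s C hs hb
    have hΦs := Real.rpow_pos_of_pos hΦ s
    have e4 := abs_add_abs_log_le hγ hr hA.le hy
    rw [e5] at hb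
    rw [abs_mul, abs_of_pos hΦs]
    calc _ ≤ Φ r ^ s * (s ^ 2 * ((A + (1 / γ + 1)) * (min r 1 ^ (-γ) * max r 1)) ^ 2) := by
          refine mul_le_mul_of_nonneg_left ((abs_taylorQuadratic_le s hs y _).trans ?_) hΦs.le
          gcongr
      _ = s ^ 2 * (A + (1 / γ + 1)) ^ 2 *
          (Φ r ^ s * ((min r 1 ^ (-γ) * max r 1) ^ 2 * max r 1 ^ 0)) := by ring
      _ ≤ s ^ 2 * (A + (1 / γ + 1)) ^ 2 *
          (C * (min r 1 ^ (-γ - 2) * decayWeight d lam r)) := by gcongr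
      _ = _ := by ring
  have e1 := hterm p C₁ hp (h1 r hr)
  have e2 := hterm q C₂ hq (h2 r hr)
  have e3 := h3 A r y hr hy
  have e6 : |(d - 2) / 2| ≤ d := by rw [abs_le]; constructor <;> linarith
  have b3 := mul_le_mul e6 e3 (abs_nonneg _) (by positivity)
  rw [← abs_mul] at b3
  unfold quadraticSource
  refine (abs_add_le _ _).trans ?_
  have b2 := abs_add_le (Φ r ^ p * taylorQuadratic p y (Real.log r))
    (Φ r ^ q * taylorQuadratic q y (Real.log r))
  linarith

theorem ProfileBounds.remainder_lipschitz {d p q lam γ K s : ℝ} {Φ Φ₁ : ℝ → ℝ}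
    (h : ProfileBounds d p q lam γ K Φ Φ₁) (hs : s = p ∨ s = q) :
    ∃ C, 0 < C ∧ ∀ ε rs r y y' : ℝ, |ε| ≤ 1 → 0 < rs → |ε| * -Real.log rs ≤ 1 → rs ≤ r →
      |ε * y| ≤ 1 / 2 → |ε * y'| ≤ 1 / 2 →
      |Φ r ^ s * (taylorRemainder s (ε * y) (ε * Real.log r) -
        taylorRemainder s (ε * y') (ε * Real.log r))| ≤
        C * |ε| * ((r ^ 2)⁻¹ * (Φ r * |y - y'|)) := by
  have hs1 : 1 < s := by
    rcases hs with rfl | rfl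
    exacts [h.one_lt_p, h.one_lt_q]
  obtain ⟨C₁, hC₁, h1⟩ := taylorRemainder_lipschitz s hs1
  obtain ⟨C₂, hC₂, h2⟩ : ∃ C, 0 < C ∧ ∀ r, 0 < r →
      Φ r ^ (s - 1) ≤ C * ((min r 1 ^ 2)⁻¹ * (max r 1 ^ (2 + ⌈s + 2⌉₊))⁻¹) := by
    rcases hs with rfl | rfl
    exacts [h.rpow_p _, h.rpow_q _]
  refine ⟨C₁ * Real.exp (s + 2) * C₂, by positivity, ?_⟩
  intro ε rs r y y' hε hrs hlog hr hεy hεy'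
  have hr0 : 0 < r := hrs.trans_le hr
  have hΦ := h.profile.pos r hr0
  have hΦs := Real.rpow_pos_of_pos hΦ (s - 1)
  have hE : 0 < max r 1 := lt_max_of_lt_left hr0
  have ht : 0 < min r 1 := lt_min hr0 one_pos
  have e1 := h1 (ε * y) (ε * y') (ε * Real.log r) hεy hεy'
  have e3 := exp_abs_log_le (show 0 ≤ s + 2 by linarith) hε hrs hlog hr
  have e : Φ r ^ s = Φ r ^ (s - 1) * Φ r := by
    rw [← Real.rpow_add_one hΦ.ne', sub_add_cancel]
  have e4 : (min r 1 ^ 2)⁻¹ * (max r 1 ^ (2 + ⌈s + 2⌉₊))⁻¹ * max r 1 ^ ⌈s + 2⌉₊ = (r ^ 2)⁻¹ := by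
    have e5 : r ^ 2 = min r 1 ^ 2 * max r 1 ^ 2 := by rw [← mul_pow, min_mul_max, mul_one]
    rw [e5, pow_add]; field_simp
  rw [← mul_sub ε, abs_mul ε (y - y')] at e1
  rw [abs_mul, abs_of_pos (Real.rpow_pos_of_pos hΦ s), e]
  calc _ ≤ C₂ * ((min r 1 ^ 2)⁻¹ * (max r 1 ^ (2 + ⌈s + 2⌉₊))⁻¹) * Φ r *
        (C₁ * (Real.exp (s + 2) * max r 1 ^ ⌈s + 2⌉₊) * (|ε| * |y - y'|)) := by
        gcongr
        · exact h2 r hr0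
        · exact e1.trans (by gcongr)
    _ = C₁ * Real.exp (s + 2) * C₂ * |ε| *
        ((min r 1 ^ 2)⁻¹ * (max r 1 ^ (2 + ⌈s + 2⌉₊))⁻¹ * max r 1 ^ ⌈s + 2⌉₊ *
          (Φ r * |y - y'|)) := by ring
    _ = _ := by rw [e4]

theorem ProfileBounds.nonlinearSource_lipschitz {d p q lam γ K : ℝ} {Φ Φ₁ : ℝ → ℝ}
    (h : ProfileBounds d p q lam γ K Φ Φ₁) :
    ∃ C, 0 < C ∧ ∀ ε rs r y y' : ℝ, ε ≠ 0 → |ε| ≤ 1 → 0 < rs → |ε| * -Real.log rs ≤ 1 →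
      rs ≤ r → |ε * y| ≤ 1 / 2 → |ε * y'| ≤ 1 / 2 →
      |nonlinearSource d p q Φ ε r y - nonlinearSource d p q Φ ε r y'| ≤
        C * (r ^ 2)⁻¹ * (Φ r * |y - y'|) := by
  have hd := h.dim
  obtain ⟨C₁, hC₁, h1⟩ := h.remainder_lipschitz (Or.inl rfl)
  obtain ⟨C₂, hC₂, h2⟩ := h.remainder_lipschitz (Or.inr rfl)
  refine ⟨C₁ + C₂ + d, by positivity, ?_⟩
  intro ε rs r y y' hε0 hε hrs hlog hr hεy hεy'
  have hr0 : 0 < r := hrs.trans_le hr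
  have hΦ := h.profile.pos r hr0
  have hε1 : 0 < |ε| := abs_pos.mpr hε0
  have e1 := h1 ε rs r y y' hε hrs hlog hr hεy hεy'
  have e2 := h2 ε rs r y y' hε hrs hlog hr hεy hεy'
  obtain ⟨X, hX⟩ : ∃ X, X = (r ^ 2)⁻¹ * (Φ r * |y - y'|) := ⟨_, rfl⟩
  have hX0 : 0 ≤ X := by rw [hX]; positivity
  have e3 : |Φ r / r ^ 2 * (y - y')| = X := by
    rw [abs_mul, abs_of_pos (show 0 < Φ r / r ^ 2 by positivity), hX]; ring
  rw [← hX] at e1 e2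
  rw [mul_assoc, ← hX]
  have e : nonlinearSource d p q Φ ε r y - nonlinearSource d p q Φ ε r y' =
      ε⁻¹ * (Φ r ^ p * (taylorRemainder p (ε * y) (ε * Real.log r) -
        taylorRemainder p (ε * y') (ε * Real.log r)) +
      Φ r ^ q * (taylorRemainder q (ε * y) (ε * Real.log r) -
        taylorRemainder q (ε * y') (ε * Real.log r))) +
      ε / 2 * (ε / 2 + d - 2) * (Φ r / r ^ 2 * (y - y')) := by
    unfold nonlinearSource; ring
  have e5 : |ε / 2 * (ε / 2 + d - 2)| ≤ d := by
    rw [abs_mul, abs_div, abs_two]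
    have h6 := abs_le.mp hε
    have h7 : |ε / 2 + d - 2| ≤ d := by rw [abs_le]; constructor <;> linarith
    calc _ ≤ 1 * d := by gcongr; linarith
      _ = d := one_mul d
  have b3 := mul_le_mul_of_nonneg_right e5 (abs_nonneg (Φ r / r ^ 2 * (y - y')))
  rw [← abs_mul, e3] at b3
  have b1 : |ε⁻¹ * (Φ r ^ p * (taylorRemainder p (ε * y) (ε * Real.log r) -
        taylorRemainder p (ε * y') (ε * Real.log r)) +
      Φ r ^ q * (taylorRemainder q (ε * y) (ε * Real.log r) -
        taylorRemainder q (ε * y') (ε * Real.log r)))| ≤ (C₁ + C₂) * X := by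
    rw [abs_mul, abs_inv, inv_mul_le_iff₀ hε1]
    refine (abs_add_le _ _).trans ?_
    linarith
  rw [e]
  refine (abs_add_le _ _).trans ?_
  linarith

theorem abs_taylorQuadratic_sub_le (s : ℝ) (hs : 1 < s) (y y' l : ℝ) :
    |taylorQuadratic s y l - taylorQuadratic s y' l| ≤
      s ^ 2 * (|y - y'| * (|y| + |y'| + |l|)) := by
  have e : taylorQuadratic s y l - taylorQuadratic s y' l =
      s * (s - 1) / 2 * ((y - y') * (y + y' + l)) := by
    unfold taylorQuadratic; ring
  have hs1 : 0 < s - 1 := by linarith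
  rw [e, abs_mul, abs_mul (y - y'), abs_of_nonneg (by positivity)]
  have h1 : s * (s - 1) / 2 ≤ s ^ 2 := by nlinarith
  have h2 : |y + y' + l| ≤ |y| + |y'| + |l| := abs_add_three y y' l
  gcongr

theorem ProfileBounds.remainder_sub_quadratic {d p q lam γ K s A A' : ℝ} {Φ Φ₁ : ℝ → ℝ}
    (h : ProfileBounds d p q lam γ K Φ Φ₁) (hs : s = p ∨ s = q) (hA : 0 < A) (hA' : 0 < A') :
    ∃ C, 0 < C ∧ ∀ ε rs r y y' : ℝ, ε ≠ 0 → |ε| ≤ 1 → 0 < rs → |ε| * -Real.log rs ≤ 1 →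
      rs ≤ r → |y| ≤ A * min r 1 ^ (-γ) → |y'| ≤ A * min r 1 ^ (-γ) →
      |y - y'| ≤ A' * |ε| * min r 1 ^ (-γ) → |ε * y| ≤ 1 / 2 →
      |Φ r ^ s * ((ε ^ 2)⁻¹ * taylorRemainder s (ε * y) (ε * Real.log r) -
        taylorQuadratic s y' (Real.log r))| ≤
        C * |ε| * (min r 1 ^ (-(2 * γ) - 2) * decayWeight d lam r) := by
  have hγ := h.γ_pos
  have hs1 : 1 < s := by
    rcases hs with rfl | rfl
    exacts [h.one_lt_p, h.one_lt_q]
  obtain ⟨C₁, hC₁, h1⟩ := taylorRemainder_sub_quadratic s hs1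
  obtain ⟨C₂, hC₂, h2⟩ := h.rpow_mul_pow_bound hs 3 ⌈s + 1⌉₊
  obtain ⟨L, hL⟩ : ∃ L, L = A + (A + (1 / γ + 1)) := ⟨_, rfl⟩
  have hL0 : 0 < L := by rw [hL]; positivity
  refine ⟨(C₁ * L ^ 3 * Real.exp (s + 1) + s ^ 2 * (A' * L)) * C₂, by positivity, ?_⟩
  intro ε rs r y y' hε0 hε hrs hlog hr hy hy' hyy hεy
  have hr0 : 0 < r := hrs.trans_le hr
  have hε1 : 0 < |ε| := abs_pos.mpr hε0
  have hΦ := Real.rpow_pos_of_pos (h.profile.pos r hr0) s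
  have hE : 1 ≤ max r 1 := le_max_right r 1
  have ht := lt_min hr0 one_pos
  have htγ : 1 ≤ min r 1 ^ (-γ) :=
    Real.one_le_rpow_of_pos_of_le_one_of_nonpos ht (min_le_right r 1) (by linarith)
  obtain ⟨Z, hZ⟩ : ∃ Z, Z = min r 1 ^ (-γ) * max r 1 := ⟨_, rfl⟩
  have hZ1 : 1 ≤ Z := by rw [hZ]; exact one_le_mul_of_one_le_of_one_le htγ hE
  have hZt : min r 1 ^ (-γ) ≤ Z := by
    rw [hZ]; exact le_mul_of_one_le_right (by linarith) hE
  obtain ⟨T, hT⟩ : ∃ T, T = max r 1 ^ ⌈s + 1⌉₊ := ⟨_, rfl⟩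
  have hT1 : 1 ≤ T := by rw [hT]; exact one_le_pow₀ hE
  have e1 := h1 (ε * y) (ε * Real.log r) hεy
  have e2 := h2 r hr0
  have e3 := exp_abs_log_le (show 0 ≤ s + 1 by linarith) hε hrs hlog hr
  have e4 := abs_add_abs_log_le hγ hr0 hA.le hy
  have e5 : (1 - ((3 : ℕ) : ℝ)) * γ - 2 = -(2 * γ) - 2 := by push_cast; ring
  rw [e5, ← hZ, ← hT] at e2
  rw [← hZ] at e4
  rw [← hT] at e3
  have e4L : |y| + |Real.log r| ≤ L * Z := e4.trans (by gcongr; rw [hL]; linarith)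
  have b1 : |(ε ^ 2)⁻¹ * taylorRemainder s (ε * y) (ε * Real.log r) -
      taylorQuadratic s y (Real.log r)| ≤ C₁ * L ^ 3 * Real.exp (s + 1) * |ε| * (Z ^ 3 * T) := by
    rw [taylorQuadratic_smul] at e1
    have e6 : (ε ^ 2)⁻¹ * taylorRemainder s (ε * y) (ε * Real.log r) -
        taylorQuadratic s y (Real.log r) = (ε ^ 2)⁻¹ *
        (taylorRemainder s (ε * y) (ε * Real.log r) -
          ε ^ 2 * taylorQuadratic s y (Real.log r)) := by
      field_simp
    rw [e6, abs_mul, abs_inv, abs_pow, inv_mul_le_iff₀ (by positivity)]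
    rw [abs_mul ε y, abs_mul ε (Real.log r), ← mul_add] at e1
    rw [abs_mul ε (Real.log r)] at e3
    refine e1.trans ?_
    have e7 : 0 ≤ |y| + |Real.log r| := by positivity
    calc _ ≤ C₁ * (|ε| * (L * Z)) ^ 3 * (Real.exp (s + 1) * T) := by gcongr
      _ = _ := by ring
  have b2 : |taylorQuadratic s y (Real.log r) - taylorQuadratic s y' (Real.log r)| ≤
      s ^ 2 * (A' * L) * |ε| * (Z ^ 3 * T) := by
    refine (abs_taylorQuadratic_sub_le s hs1 y y' _).trans ?_
    have e8 : |y| + |y'| + |Real.log r| ≤ L * Z := by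
      have : |y'| ≤ A * Z := hy'.trans (by gcongr)
      rw [hL, add_mul]
      linarith
    calc _ ≤ s ^ 2 * ((A' * |ε| * Z) * (L * Z)) := by
          gcongr
          exact hyy.trans (by gcongr)
      _ = s ^ 2 * (A' * L) * |ε| * (Z ^ 2 * 1) := by ring
      _ ≤ _ := by
          have : Z ^ 2 ≤ Z ^ 3 := pow_le_pow_right₀ hZ1 (by norm_num)
          gcongr
  have b3 : |(ε ^ 2)⁻¹ * taylorRemainder s (ε * y) (ε * Real.log r) -
      taylorQuadratic s y' (Real.log r)| ≤
      (C₁ * L ^ 3 * Real.exp (s + 1) + s ^ 2 * (A' * L)) * |ε| * (Z ^ 3 * T) := by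
    have := abs_add_le ((ε ^ 2)⁻¹ * taylorRemainder s (ε * y) (ε * Real.log r) -
      taylorQuadratic s y (Real.log r)) (taylorQuadratic s y (Real.log r) -
      taylorQuadratic s y' (Real.log r))
    rw [sub_add_sub_cancel] at this
    linarith
  rw [abs_mul, abs_of_pos hΦ]
  calc _ ≤ Φ r ^ s * ((C₁ * L ^ 3 * Real.exp (s + 1) + s ^ 2 * (A' * L)) * |ε| * (Z ^ 3 * T)) := by
        gcongr
    _ = (C₁ * L ^ 3 * Real.exp (s + 1) + s ^ 2 * (A' * L)) * |ε| * (Φ r ^ s * (Z ^ 3 * T)) := by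
        ring
    _ ≤ (C₁ * L ^ 3 * Real.exp (s + 1) + s ^ 2 * (A' * L)) * |ε| *
        (C₂ * (min r 1 ^ (-(2 * γ) - 2) * decayWeight d lam r)) := by gcongr
    _ = _ := by ring

/-- The nonlinear source, divided by `ε`, converges to its quadratic part with rate `ε`. -/
theorem ProfileBounds.nonlinearSource_sub_quadraticSource {d p q lam γ K A A' : ℝ}
    {Φ Φ₁ : ℝ → ℝ} (h : ProfileBounds d p q lam γ K Φ Φ₁) (hA : 0 < A) (hA' : 0 < A') :
    ∃ C, 0 < C ∧ ∀ ε rs r y y' : ℝ, ε ≠ 0 → |ε| ≤ 1 → 0 < rs → |ε| * -Real.log rs ≤ 1 →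
      rs ≤ r → |y| ≤ A * min r 1 ^ (-γ) → |y'| ≤ A * min r 1 ^ (-γ) →
      |y - y'| ≤ A' * |ε| * min r 1 ^ (-γ) → |ε * y| ≤ 1 / 2 →
      |ε⁻¹ * nonlinearSource d p q Φ ε r y - quadraticSource d p q Φ r y'| ≤
        C * |ε| * (min r 1 ^ (-(2 * γ) - 2) * decayWeight d lam r) := by
  have hγ := h.γ_pos
  have hd := h.dim
  obtain ⟨C₁, hC₁, h1⟩ := h.remainder_sub_quadratic (Or.inl rfl) hA hA'
  obtain ⟨C₂, hC₂, h2⟩ := h.remainder_sub_quadratic (Or.inr rfl) hA hA'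
  obtain ⟨C₃, hC₃, h3⟩ := h.div_sq_mul_bound
  refine ⟨C₁ + C₂ + C₃ * (A + d * A'), by positivity, ?_⟩
  intro ε rs r y y' hε0 hε hrs hlog hr hy hy' hyy hεy
  have hr0 : 0 < r := hrs.trans_le hr
  have hε1 : 0 < |ε| := abs_pos.mpr hε0
  have hcl := decayWeight_pos d lam hr0
  have e1 := h1 ε rs r y y' hε0 hε hrs hlog hr hy hy' hyy hεy
  have e2 := h2 ε rs r y y' hε0 hε hrs hlog hr hy hy' hyy hεy
  have e3 : |Φ r / r ^ 2 * (ε / 4 * y + (d - 2) / 2 * (y - y'))| ≤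
      C₃ * (|ε| * (A + d * A')) * (min r 1 ^ (-(2 * γ) - 2) * decayWeight d lam r) := by
    have ht := Real.rpow_pos_of_pos (lt_min hr0 one_pos) (-γ)
    refine (h3 (|ε| * (A + d * A')) r _ hr0 ?_).trans ?_
    · refine (abs_add_le _ _).trans ?_
      rw [abs_mul (ε / 4), abs_mul ((d - 2) / 2), abs_div,
        abs_of_pos (show (0 : ℝ) < 4 by norm_num),
        abs_of_pos (show 0 < (d - 2) / 2 by linarith)]
      calc _ ≤ |ε| / 1 * (A * min r 1 ^ (-γ)) + d * (A' * |ε| * min r 1 ^ (-γ)) := by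
            gcongr
            · norm_num
            · linarith
        _ = _ := by ring
    · exact mul_le_mul_of_nonneg_left (mul_le_mul_of_nonneg_right
        (min_one_rpow_anti hr0 (by linarith)) hcl.le) (by positivity)
  have e : ε⁻¹ * nonlinearSource d p q Φ ε r y - quadraticSource d p q Φ r y' =
      Φ r ^ p * ((ε ^ 2)⁻¹ * taylorRemainder p (ε * y) (ε * Real.log r) -
        taylorQuadratic p y' (Real.log r)) +
      Φ r ^ q * ((ε ^ 2)⁻¹ * taylorRemainder q (ε * y) (ε * Real.log r) -
        taylorQuadratic q y' (Real.log r)) +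
      Φ r / r ^ 2 * (ε / 4 * y + (d - 2) / 2 * (y - y')) := by
    unfold nonlinearSource quadraticSource
    field_simp
    ring
  rw [e]
  refine (abs_add_three _ _ _).trans ?_
  linarith

/-! ### The perturbation and its derivative at zero -/

theorem abs_mul_log_le_one {γ ε rs : ℝ} (hγ : 0 < γ) (hrs : 0 < rs) (hrs1 : rs ≤ 1)
    (hε : |ε| ≤ γ * rs ^ γ) : |ε| * -Real.log rs ≤ 1 := by
  have h1 := (Real.abs_log_mul_self_rpow_lt rs γ hrs hrs1 hγ).le
  have h2 := Real.rpow_pos_of_pos hrs γ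
  have h3 := Real.log_nonpos hrs.le hrs1
  rw [abs_mul, abs_of_pos h2, abs_of_nonpos h3, le_div_iff₀ hγ] at h1
  have h4 := mul_le_mul_of_nonneg_right hε (show 0 ≤ -Real.log rs by linarith)
  linarith

theorem one_add_powerTail_neg_le {γ rs : ℝ} (hγ : 0 < γ) (hrs : 0 < rs) (hrs1 : rs ≤ 1) :
    1 + powerTail (-γ) rs ≤ (1 + 1 / γ) * rs ^ (-γ) := by
  have h1 : 1 ≤ rs ^ (-γ) :=
    Real.one_le_rpow_of_pos_of_le_one_of_nonpos hrs hrs1 (by linarith)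
  have h2 : powerTail (-γ) rs = 1 / γ * rs ^ (-γ) - 1 / γ := by
    unfold powerTail; field_simp; ring
  have h3 : 0 < 1 / γ := by positivity
  rw [h2, add_mul]
  linarith

/-- The truncation of `x` at level `c`. -/
def clamp (c x : ℝ) : ℝ := max (-c) (min c x)

theorem abs_clamp_le {c : ℝ} (hc : 0 ≤ c) (x : ℝ) : |clamp c x| ≤ c :=
  abs_le.mpr ⟨le_max_left _ _, max_le (by linarith) (min_le_left _ _)⟩

theorem clamp_of_abs_le {c x : ℝ} (h : |x| ≤ c) : clamp c x = x := by
  rw [clamp, min_eq_right (abs_le.mp h).2, max_eq_right (abs_le.mp h).1]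

theorem abs_clamp_sub_le (c x y : ℝ) : |clamp c x - clamp c y| ≤ |x - y| := by
  have h1 := abs_max_sub_max_le_max (-c) (min c x) (-c) (min c y)
  have h2 := abs_min_sub_min_le_max c x c y
  simp only [sub_self, abs_zero] at h1 h2
  exact h1.trans (max_le (abs_nonneg _) (h2.trans (max_le (abs_nonneg _) le_rfl)))

theorem continuousOn_nonlinearSource {d p q ε : ℝ} {Φ : ℝ → ℝ} {S : Set (ℝ × ℝ)}
    {ρ y : ℝ × ℝ → ℝ} (hp : 0 ≤ p) (hq : 0 ≤ q) (hρ : ContinuousOn ρ S)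
    (hρ0 : ∀ z ∈ S, 0 < ρ z) (hΦ : ContinuousOn (fun z => Φ (ρ z)) S)
    (hΦ0 : ∀ z ∈ S, 0 < Φ (ρ z)) (hy : ContinuousOn y S) :
    ContinuousOn (fun z => nonlinearSource d p q Φ ε (ρ z) (y z)) S := by
  have hlog : ContinuousOn (fun z => Real.log (ρ z)) S := hρ.log fun z hz => (hρ0 z hz).ne'
  have hR : ∀ s, 0 ≤ s → ContinuousOn (fun z => Φ (ρ z) ^ s *
      taylorRemainder s (ε * y z) (ε * Real.log (ρ z))) S := by
    intro s hs
    have h1 : ContinuousOn (fun z => ε * y z) S := hy.const_mul ε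
    have h2 : ContinuousOn (fun z => (s - 1) / 2 * (ε * Real.log (ρ z))) S :=
      (hlog.const_mul ε).const_mul _
    refine (hΦ.rpow_const fun z hz => Or.inl (hΦ0 z hz).ne').mul ?_
    exact (((h2.rexp.mul ((h1.const_add 1).rpow_const fun z _ => Or.inr hs)).sub
      continuousOn_const).sub (h1.const_mul s)).sub h2
  exact (((hR p hp).add (hR q hq)).const_mul _).add
    (((hΦ.div (hρ.pow 2) fun z hz => (pow_pos (hρ0 z hz) 2).ne').mul hy).const_mul _)

/-- `w` (with derivative `w₁`) completes the corrector `ψ = Φ + χ` to a solution of the nonlinear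
equation on `[rs, ∞)`; `A` bounds the relative size of the perturbation. -/
structure IsPerturbation (d p q lam γ : ℝ) (Φ : ℝ → ℝ) (A ε rs : ℝ) (χ w w₁ : ℝ → ℝ) : Prop where
  solves : ∃ N : ℝ → ℝ, ContinuousOn N (Ioi 0) ∧
    IsDecayingSolution d lam ε (fun r => linPotential p q Φ r * w r + N r) w w₁ ∧
    ∀ r, rs ≤ r → N r = nonlinearSource d p q Φ ε r ((Φ r + χ r + w r) / Φ r)
  relative : ∀ r, rs ≤ r → |(Φ r + χ r + w r) / Φ r| ≤ A * min r 1 ^ (-γ)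
  small : ∀ r, rs ≤ r → |ε * ((Φ r + χ r + w r) / Φ r)| ≤ 1 / 2

theorem rpow_mul_decayWeight_anti {d lam y r s : ℝ} (hd : 2 ≤ d) (hy : y ≤ 0) (hr : 0 < r)
    (hrs : r ≤ s) (hs : s ≤ 1) :
    min s 1 ^ y * decayWeight d lam s ≤ min r 1 ^ y * decayWeight d lam r := by
  have hs0 := hr.trans_le hrs
  rw [min_eq_left hs, min_eq_left (hrs.trans hs), decayWeight_of_le_one d lam hs,
    decayWeight_of_le_one d lam (hrs.trans hs)]
  have h1 := Real.rpow_le_rpow_of_nonpos hr hrs hy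
  have h2 := Real.rpow_le_rpow_of_nonpos hr hrs (show -((d - 2) / 2) ≤ 0 by linarith)
  have h3 := Real.rpow_pos_of_pos hs0 y
  have h4 := Real.rpow_pos_of_pos hs0 (-((d - 2) / 2))
  gcongr

set_option maxHeartbeats 400000 in
/-- Existence of the perturbation. The source is truncated where `|w|` exceeds the weight, which
makes it globally Lipschitz; by the linear estimate the truncation is inactive on `[rs, ∞)`. -/
theorem ProfileBounds.exists_perturbation {d p q lam γ K : ℝ} {Φ Φ₁ : ℝ → ℝ}
    (h : ProfileBounds d p q lam γ K Φ Φ₁) :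
    ∃ δ A C, 0 < δ ∧ δ ≤ 1 ∧ δ ≤ γ ∧ 0 < A ∧ 0 < C ∧ ∀ (ε rs : ℝ) (χ χ₁ : ℝ → ℝ), 0 < rs →
      rs ≤ 1 → ε ≠ 0 → |ε| < δ * rs ^ γ → IsDecayingSolution d lam ε
        (fun r => linPotential p q Φ r * χ r + correctorSource d p q Φ Φ₁ ε r) χ χ₁ →
      ∃ w w₁, IsPerturbation d p q lam γ Φ A ε rs χ w w₁ ∧ ∀ r, rs ≤ r →
        |w r| ≤ C * (|ε| * rs ^ (-γ)) * decayWeight d lam r ∧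
        min r 1 * |w₁ r| ≤ C * (|ε| * rs ^ (-γ)) * ((1 + r) * decayWeight d lam r) := by
  have hγ := h.γ_pos
  have hd := h.dim
  obtain ⟨Cχ, hCχ, hχb⟩ := h.corrector_bound
  obtain ⟨Cl, hCl, hlow⟩ := h.lower
  obtain ⟨A, hA⟩ : ∃ A, A = 1 + (Cχ + 1) * Cl := ⟨_, rfl⟩
  have hA0 : 0 < A := by rw [hA]; positivity
  obtain ⟨CN, hCN, hN⟩ := h.nonlinearSource_bound hA0
  obtain ⟨CL, hCL, hLip⟩ := h.nonlinearSource_lipschitz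
  obtain ⟨Ce, hCe, hest⟩ := h.linear_estimate (α := -γ) (by linarith)
  obtain ⟨C, hC⟩ : ∃ C, C = Ce * (CN * (1 + 1 / γ)) := ⟨_, rfl⟩
  have hC0 : 0 < C := by rw [hC]; positivity
  -- `δ ≤ γ` ensures `|ε| log (1/rs) ≤ 1`, `δ ≤ 1/(2A)` the range of the Taylor expansion, and
  -- `δ ≤ 1/C` that the truncation is inactive
  obtain ⟨δ, hδ⟩ : ∃ δ, δ = min (min 1 γ) (min (1 / (2 * A)) (1 / C)) := ⟨_, rfl⟩
  have hδ0 : 0 < δ := by rw [hδ]; positivity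
  have hδ1 : δ ≤ 1 := by rw [hδ]; exact (min_le_left _ _).trans (min_le_left _ _)
  have hδγ : δ ≤ γ := by rw [hδ]; exact (min_le_left _ _).trans (min_le_right _ _)
  have hδA : δ ≤ 1 / (2 * A) := by rw [hδ]; exact (min_le_right _ _).trans (min_le_left _ _)
  have hδC : δ ≤ 1 / C := by rw [hδ]; exact (min_le_right _ _).trans (min_le_right _ _)
  refine ⟨δ, A, C, hδ0, hδ1, hδγ, hA0, hC0, ?_⟩
  intro ε rs χ χ₁ hrs hrs1 hε0 hε hχ
  have hε1 : 0 < |ε| := abs_pos.mpr hε0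
  have hrsγ := Real.rpow_pos_of_pos hrs γ
  have hrsγ' := Real.rpow_pos_of_pos hrs (-γ)
  have hmul : rs ^ γ * rs ^ (-γ) = 1 := by
    rw [← Real.rpow_add hrs, add_neg_cancel, Real.rpow_zero]
  have hεδ : |ε| * rs ^ (-γ) ≤ δ := by
    have := mul_le_mul_of_nonneg_right hε.le hrsγ'.le
    rwa [mul_assoc, hmul, mul_one] at this
  have hεle : |ε| ≤ 1 := by
    have := Real.rpow_le_one hrs.le hrs1 hγ.le
    have := mul_le_of_le_one_right hδ0.le this
    linarith
  have hlog : |ε| * -Real.log rs ≤ 1 :=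
    abs_mul_log_le_one hγ hrs hrs1 (hε.le.trans (by gcongr))
  -- relative size of an admissible perturbation
  have hrel : ∀ r x, rs ≤ r → |x| ≤ decayWeight d lam r →
      |(Φ r + χ r + x) / Φ r| ≤ A * min r 1 ^ (-γ) ∧
        |ε * ((Φ r + χ r + x) / Φ r)| ≤ 1 / 2 := by
    intro r x hr hx
    have hr0 := hrs.trans_le hr
    have hΦ := h.profile.pos r hr0
    have ht := lt_min hr0 one_pos
    have e1 : |(Φ r + χ r + x) / Φ r| ≤ A * min r 1 ^ (-γ) := by
      rw [abs_div, abs_of_pos hΦ, div_le_iff₀ hΦ]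
      have e2 := hχb ε rs χ χ₁ hεle hrs hrs1 hlog hχ r hr
      have e3 : |Φ r + χ r + x| ≤ Φ r + |χ r| + |x| :=
        (abs_add_three _ _ _).trans (by rw [abs_of_pos hΦ])
      have e4 : 1 ≤ min r 1 ^ (-γ) :=
        Real.one_le_rpow_of_pos_of_le_one_of_nonpos ht (min_le_right r 1) (by linarith)
      have e5 := mul_le_mul_of_nonneg_left (hlow r hr0) (show 0 ≤ Cχ + 1 by linarith)
      have e6 := mul_le_mul_of_nonneg_right e4 hΦ.le
      rw [hA]
      linarith
    refine ⟨e1, ?_⟩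
    have e7 : min r 1 ^ (-γ) ≤ rs ^ (-γ) :=
      Real.rpow_le_rpow_of_nonpos hrs (le_min hr hrs1) (by linarith)
    rw [abs_mul ε]
    calc _ ≤ |ε| * (A * rs ^ (-γ)) := by
          refine mul_le_mul_of_nonneg_left (e1.trans ?_) hε1.le
          gcongr
      _ = |ε| * rs ^ (-γ) * A := by ring
      _ ≤ 1 / (2 * A) * A := by gcongr; exact hεδ.trans hδA
      _ = 1 / 2 := by field_simp
  have hρ0 : ∀ r : ℝ, 0 < max r rs := fun r => lt_max_of_lt_right hrs
  obtain ⟨Y, hY⟩ : ∃ Y : ℝ → ℝ → ℝ, Y = fun r x => (Φ (max r rs) + χ (max r rs) +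
    clamp (decayWeight d lam (max r rs)) x) / Φ (max r rs) := ⟨_, rfl⟩
  have hYrel : ∀ r x, |Y r x| ≤ A * min (max r rs) 1 ^ (-γ) ∧ |ε * Y r x| ≤ 1 / 2 := by
    intro r x
    rw [hY]
    exact hrel _ _ (le_max_right r rs) (abs_clamp_le (decayWeight_pos d lam (hρ0 r)).le x)
  have hNb : ∀ r x, |nonlinearSource d p q Φ ε (max r rs) (Y r x)| ≤
      CN * |ε| * (min (max r rs) 1 ^ (-γ - 2) * decayWeight d lam (max r rs)) := fun r x =>
    hN ε rs _ _ hε0 hεle hrs hlog (le_max_right r rs) (hYrel r x).1 (hYrel r x).2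
  have hmaxc : ContinuousOn (fun z : ℝ × ℝ => max z.1 rs) (Ioi 0 ×ˢ univ) :=
    (continuous_fst.max continuous_const).continuousOn
  have hmaps : MapsTo (fun z : ℝ × ℝ => max z.1 rs) (Ioi 0 ×ˢ univ) (Ioi 0) := fun z _ =>
    mem_Ioi.mpr (hρ0 z.1)
  have hΦc := h.profile.continuousOn.comp hmaxc hmaps
  have hclc := (continuousOn_decayWeight d lam).comp hmaxc hmaps
  have hNc : ContinuousOn (fun z : ℝ × ℝ =>
      nonlinearSource d p q Φ ε (max z.1 rs) (Y z.1 z.2)) (Ioi 0 ×ˢ univ) := by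
    refine continuousOn_nonlinearSource (by linarith [h.one_lt_p]) (by linarith [h.one_lt_q])
      hmaxc (fun z _ => hρ0 z.1) hΦc (fun z _ => h.profile.pos _ (hρ0 z.1)) ?_
    rw [hY]
    exact (((hΦc.add (hχ.continuousOn.comp hmaxc hmaps)).add
      (ContinuousOn.sup hclc.neg (ContinuousOn.inf hclc continuousOn_snd))).div hΦc
      fun z _ => (h.profile.pos _ (hρ0 z.1)).ne')
  -- besides the truncation of `w`, the source is frozen in `r < rs`, where its bounds fail
  obtain ⟨w, w₁, hw⟩ := h.exists_solution (ε := ε) (α := -γ) (B := CL) (B₀ := CN * |ε|)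
    (N := fun r x => nonlinearSource d p q Φ ε (max r rs) (Y r x)) hNc
    (fun r hr x y => by
      refine (hLip ε rs _ _ _ hε0 hεle hrs hlog (le_max_right r rs) (hYrel r x).2
        (hYrel r y).2).trans ?_
      have hΦ := h.profile.pos _ (hρ0 r)
      have e1 : Φ (max r rs) * |Y r x - Y r y| ≤ |x - y| := by
        rw [hY, ← sub_div, abs_div, abs_of_pos hΦ, mul_div_cancel₀ _ hΦ.ne',
          add_sub_add_left_eq_sub]
        exact abs_clamp_sub_le _ _ _
      have e2 : (max r rs ^ 2)⁻¹ ≤ (r ^ 2)⁻¹ := by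
        gcongr; exact le_max_left r rs
      gcongr)
    (fun r hr => by
      refine (hNb r 0).trans ?_
      rcases le_total r rs with e | e
      · rw [max_eq_right e]
        exact mul_le_mul_of_nonneg_left (rpow_mul_decayWeight_anti (by linarith) (by linarith)
          hr e hrs1) (by positivity)
      · rw [max_eq_left e])
  have hwb := hest ε rs (CN * |ε|) _ w w₁ hεle hrs hrs1 hlog (by positivity) hw (fun r hr => by
    have := hNb r (w r)
    rwa [max_eq_left hr] at this ⊢)
  have hconst : Ce * (CN * |ε| * (1 + powerTail (-γ) rs)) ≤ C * (|ε| * rs ^ (-γ)) := by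
    have := one_add_powerTail_neg_le hγ hrs hrs1
    calc _ ≤ Ce * (CN * |ε| * ((1 + 1 / γ) * rs ^ (-γ))) := by gcongr
      _ = _ := by rw [hC]; ring
  have hfinal : ∀ r, rs ≤ r → |w r| ≤ C * (|ε| * rs ^ (-γ)) * decayWeight d lam r ∧
      min r 1 * |w₁ r| ≤ C * (|ε| * rs ^ (-γ)) * ((1 + r) * decayWeight d lam r) := by
    intro r hr
    have hr0 := hrs.trans_le hr
    have hcl := decayWeight_pos d lam hr0
    obtain ⟨e1, e2⟩ := hwb r hr
    exact ⟨e1.trans (by gcongr), e2.trans (by gcongr)⟩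
  -- the truncation is inactive
  have hwcl : ∀ r, rs ≤ r → |w r| ≤ decayWeight d lam r := by
    intro r hr
    have hcl := decayWeight_pos d lam (hrs.trans_le hr)
    have e1 : C * (|ε| * rs ^ (-γ)) ≤ 1 := by
      calc _ ≤ C * (1 / C) := by gcongr; exact hεδ.trans hδC
        _ = 1 := by field_simp
    exact (hfinal r hr).1.trans (mul_le_of_le_one_left hcl.le e1)
  refine ⟨w, w₁, ⟨⟨fun r => nonlinearSource d p q Φ ε (max r rs) (Y r (w r)), ?_, hw,
    fun r hr => ?_⟩, fun r hr => (hrel r _ hr (hwcl r hr)).1,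
    fun r hr => (hrel r _ hr (hwcl r hr)).2⟩, hfinal⟩
  · exact hNc.comp (continuousOn_id.prodMk hw.continuousOn) fun r hr => ⟨hr, mem_univ _⟩
  · rw [hY]
    simp only [max_eq_left hr, clamp_of_abs_le (hwcl r hr)]

/-- The derivative of the perturbation at `ε = 0`: the solution of the linearised equation with
the quadratic source. -/
theorem ProfileBounds.exists_derivative {d p q lam γ K : ℝ} {Φ Φ₁ χ χ₁ : ℝ → ℝ}
    (h : ProfileBounds d p q lam γ K Φ Φ₁) (hχ : IsDecayingSolution d lam 0
      (fun r => linPotential p q Φ r * χ r + correctorSource d p q Φ Φ₁ 0 r) χ χ₁) :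
    ∃ D D₁ A C, 0 < A ∧ 0 < C ∧ IsDecayingSolution d lam 0
      (fun r => linPotential p q Φ r * D r +
        quadraticSource d p q Φ r ((Φ r + χ r) / Φ r)) D D₁ ∧
      (∀ r, 0 < r → |(Φ r + χ r) / Φ r| ≤ A * min r 1 ^ (-γ)) ∧
      ∀ rs, 0 < rs → rs ≤ 1 → ∀ r, rs ≤ r → |D r| ≤ C * rs ^ (-γ) * decayWeight d lam r := by
  have hγ := h.γ_pos
  obtain ⟨Cχ, hCχ, hχb⟩ := h.corrector_bound
  obtain ⟨Cl, hCl, hlow⟩ := h.lower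
  have hrel : ∀ r, 0 < r → |(Φ r + χ r) / Φ r| ≤ (1 + Cχ * Cl) * min r 1 ^ (-γ) := by
    intro r hr
    have hΦ := h.profile.pos r hr
    have ht := lt_min hr one_pos
    rw [abs_div, abs_of_pos hΦ, div_le_iff₀ hΦ]
    have e2 := hχb 0 (min r 1) χ χ₁ (by simp) ht (min_le_right r 1) (by simp) hχ r (min_le_left r 1)
    have e3 : |Φ r + χ r| ≤ Φ r + |χ r| := (abs_add_le _ _).trans (by rw [abs_of_pos hΦ])
    have e4 : 1 ≤ min r 1 ^ (-γ) :=
      Real.one_le_rpow_of_pos_of_le_one_of_nonpos ht (min_le_right r 1) (by linarith)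
    have e5 := mul_le_mul_of_nonneg_left (hlow r hr) hCχ.le
    have e6 := mul_le_mul_of_nonneg_right e4 hΦ.le
    linarith
  obtain ⟨CQ, hCQ, hQ⟩ := h.quadraticSource_bound (show 0 < 1 + Cχ * Cl by positivity)
  obtain ⟨Ce, hCe, hest⟩ := h.linear_estimate (α := -γ) (by linarith)
  have hΦc := h.profile.continuousOn
  have hyc : ContinuousOn (fun r => (Φ r + χ r) / Φ r) (Ioi 0) :=
    (hΦc.add hχ.continuousOn).div hΦc fun r hr => (h.profile.pos r hr).ne'
  have hlog : ContinuousOn Real.log (Ioi 0) := Real.continuousOn_log.mono fun r hr => ne_of_gt hr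
  have hT : ∀ s, ContinuousOn (fun r => Φ r ^ s * taylorQuadratic s ((Φ r + χ r) / Φ r)
      (Real.log r)) (Ioi 0) := fun s =>
    (h.profile.continuousOn_rpow s).mul ((((hyc.pow 2).const_mul _).add
      ((hyc.mul hlog).const_mul _)).add ((hlog.pow 2).const_mul _))
  have hQc : ContinuousOn (fun r => quadraticSource d p q Φ r ((Φ r + χ r) / Φ r)) (Ioi 0) :=
    ((hT p).add (hT q)).add (((hΦc.div (continuousOn_id.pow 2) fun r hr =>
      (pow_pos hr 2).ne').mul hyc).const_mul _)
  have hQb : ∀ r, 0 < r → |quadraticSource d p q Φ r ((Φ r + χ r) / Φ r)| ≤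
      CQ * (min r 1 ^ (-γ - 2) * decayWeight d lam r) := fun r hr => hQ r _ hr (hrel r hr)
  obtain ⟨D, D₁, hD⟩ := h.exists_solution (ε := 0) (α := -γ) (B := 0) (B₀ := CQ)
    (N := fun r _ => quadraticSource d p q Φ r ((Φ r + χ r) / Φ r))
    (hQc.comp continuousOn_fst fun z hz => hz.1) (fun r hr x y => by simp) hQb
  refine ⟨D, D₁, 1 + Cχ * Cl, Ce * (CQ * (1 + 1 / γ)), by positivity, by positivity, hD, hrel,
    fun rs hrs hrs1 r hr => ?_⟩
  have hcl := decayWeight_pos d lam (hrs.trans_le hr)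
  refine (hest 0 rs CQ _ D D₁ (by simp) hrs hrs1 (by simp) hCQ hD
    (fun r hr => hQb r (hrs.trans_le hr)) r hr).1.trans ?_
  have := one_add_powerTail_neg_le hγ hrs hrs1
  calc _ ≤ Ce * (CQ * ((1 + 1 / γ) * rs ^ (-γ))) * decayWeight d lam r := by gcongr
    _ = _ := by ring

/-- The perturbation, divided by `ε`, converges to the derivative with rate `ε`. The constant
depends on `rs`, hence the cruder exponent `-2γ` in the linear estimate is harmless. -/
theorem ProfileBounds.perturbation_sub_derivative {d p q lam γ K A C rs : ℝ}
    {Φ Φ₁ χ χ₁ D D₁ : ℝ → ℝ} (h : ProfileBounds d p q lam γ K Φ Φ₁) (hA : 0 < A) (hC : 0 < C)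
    (hrs : 0 < rs) (hrs1 : rs ≤ 1)
    (hχ : IsDecayingSolution d lam 0
      (fun r => linPotential p q Φ r * χ r + correctorSource d p q Φ Φ₁ 0 r) χ χ₁)
    (hD : IsDecayingSolution d lam 0 (fun r => linPotential p q Φ r * D r +
        quadraticSource d p q Φ r ((Φ r + χ r) / Φ r)) D D₁)
    (hχA : ∀ r, 0 < r → |(Φ r + χ r) / Φ r| ≤ A * min r 1 ^ (-γ)) :
    ∃ C', 0 < C' ∧ ∀ (ε : ℝ) (χ' χ₁' w w₁ : ℝ → ℝ), ε ≠ 0 → |ε| ≤ 1 →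
      |ε| * -Real.log rs ≤ 1 → IsDecayingSolution d lam ε
        (fun r => linPotential p q Φ r * χ' r + correctorSource d p q Φ Φ₁ ε r) χ' χ₁' →
      IsPerturbation d p q lam γ Φ A ε rs χ' w w₁ →
      (∀ r, rs ≤ r → |w r| ≤ C * |ε| * decayWeight d lam r) →
      ∀ r, rs ≤ r → |ε⁻¹ * w r - D r| ≤ C' * |ε| * decayWeight d lam r := by
  have hγ := h.γ_pos
  obtain ⟨C₁, hC₁, h1⟩ := h.corrector_lipschitz hrs hrs1 hχ
  obtain ⟨Cl, hCl, hlow⟩ := h.lower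
  obtain ⟨C₂, hC₂, h2⟩ := h.nonlinearSource_sub_quadraticSource hA
    (show 0 < (C₁ + C) * Cl by positivity)
  obtain ⟨C₃, hC₃, h3⟩ := hD.slope_bound_of_le (y := -(2 * γ) - 2) hrs
  obtain ⟨Ce, hCe, hest⟩ := h.linear_estimate (α := -(2 * γ)) (by linarith)
  have hζ : 0 ≤ powerTail (-(2 * γ)) rs := powerTail_nonneg hrs hrs1
  refine ⟨Ce * ((C₂ + C₃) * (1 + powerTail (-(2 * γ)) rs)), by positivity, ?_⟩
  intro ε χ' χ₁' w w₁ hε0 hε hlog hχ' hw hwb r hr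
  have hε1 : 0 < |ε| := abs_pos.mpr hε0
  obtain ⟨N, -, hNs, hN⟩ := hw.solves
  -- `w / ε - D` solves the linearised equation; its source is the error of the quadratic
  -- approximation plus `ε` times the change of the parameter in the equation of `D`
  refine ((hest ε rs ((C₂ + C₃) * |ε|) (fun r => (ε⁻¹ * N r -
      quadraticSource d p q Φ r ((Φ r + χ r) / Φ r)) + ε * (D₁ r / r + D r))
    (fun r => ε⁻¹ * w r - D r) (fun r => ε⁻¹ * w₁ r - D₁ r) hε hrs hrs1 hlog (by positivity)
    (((hNs.const_mul ε⁻¹).sub (hD.change_parameter ε)).congr fun r _ => by ring)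
    (fun t ht => ?_) r hr).1).trans (le_of_eq (by ring))
  have ht0 := hrs.trans_le ht
  have hΦ := h.profile.pos t ht0
  have e1 := h2 ε rs t _ ((Φ t + χ t) / Φ t) hε0 hε hrs hlog ht (hw.relative t ht) (hχA t ht0)
    (by
      rw [← sub_div, abs_div, abs_of_pos hΦ, div_le_iff₀ hΦ]
      have e2 := h1 ε χ' χ₁' hε hlog hχ' t ht
      have e3 := hwb t ht
      have e4 : |Φ t + χ' t + w t - (Φ t + χ t)| ≤ |χ' t - χ t| + |w t| := by
        rw [show Φ t + χ' t + w t - (Φ t + χ t) = (χ' t - χ t) + w t by ring]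
        exact abs_add_le _ _
      have e5 := mul_le_mul_of_nonneg_left (hlow t ht0) (show 0 ≤ (C₁ + C) * |ε| by positivity)
      linarith) (hw.small t ht)
  rw [← hN t ht] at e1
  have e6 := mul_le_mul_of_nonneg_left (h3 t ht) hε1.le
  rw [← abs_mul] at e6
  refine (abs_add_le _ _).trans ?_
  linarith

/-! ### The perturbed solution -/

theorem IsDecayingSolution.contDiffOn {d lam ε : ℝ} {F w w₁ : ℝ → ℝ}
    (h : IsDecayingSolution d lam ε F w w₁) (hF : ContinuousOn F (Ioi 0)) :
    ContDiffOn ℝ 2 w (Ioi 0) := by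
  have hid : ContinuousOn (fun r : ℝ => r) (Ioi 0) := continuousOn_id
  refine contDiffOn_two_of_hasDerivAt h.hasDerivAt h.hasDerivAt' ?_
  exact ((((continuousOn_const.div hid fun r hr => ne_of_gt hr).neg.mul h.continuousOn').add
    ((((hid.pow 2).sub continuousOn_const).sub continuousOn_const).mul h.continuousOn)).sub hF)

theorem IsProfile.contDiffOn {d p q lam : ℝ} {Φ Φ₁ : ℝ → ℝ} (h : IsProfile d p q lam Φ Φ₁) :
    ContDiffOn ℝ 2 Φ (Ioi 0) := by
  have hid : ContinuousOn (fun r : ℝ => r) (Ioi 0) := continuousOn_id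
  refine contDiffOn_two_of_hasDerivAt h.hasDerivAt h.hasDerivAt' ?_
  exact ((((continuousOn_const.div hid fun r hr => ne_of_gt hr).neg.mul h.continuousOn').add
    (((hid.pow 2).sub continuousOn_const).mul h.continuousOn)).sub (h.continuousOn_rpow q)).sub
      (h.continuousOn_rpow p)

theorem IsPerturbation.mono {d p q lam γ A A' ε rs : ℝ} {Φ χ w w₁ : ℝ → ℝ} (hrs : 0 < rs)
    (h : IsPerturbation d p q lam γ Φ A ε rs χ w w₁) (hA : A ≤ A') :
    IsPerturbation d p q lam γ Φ A' ε rs χ w w₁ :=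
  ⟨h.solves, fun r hr => (h.relative r hr).trans (mul_le_mul_of_nonneg_right hA
    (Real.rpow_pos_of_pos (lt_min (hrs.trans_le hr) one_pos) _).le), h.small⟩

/-- The corrector `ψ = Φ + χ` solves its equation, with the leading coefficient of `Φ`. -/
theorem ProfileBounds.isCorrector {d : ℕ} {p q lam γ K : ℝ} {Φ : ℝ → ℝ}
    (h : ProfileBounds d p q lam γ K Φ (deriv Φ)) {ε : ℝ} (hε : |ε| ≤ 1) {χ χ₁ : ℝ → ℝ}
    (hχ : IsDecayingSolution d lam ε
      (fun r => linPotential p q Φ r * χ r + correctorSource d p q Φ (deriv Φ) ε r) χ χ₁) :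
    IsCorrector d p q lam Φ K ε (fun r => Φ r + χ r) := by
  have h1 : ∀ r, 0 < r → HasDerivAt (fun r => Φ r + χ r) (deriv Φ r + χ₁ r) r := fun r hr =>
    (h.profile.hasDerivAt r hr).add (hχ.hasDerivAt r hr)
  have h2 := fun r (hr : 0 < r) => (h.profile.hasDerivAt' r hr).add (hχ.hasDerivAt' r hr)
  refine ⟨h.profile.contDiffOn.add (hχ.contDiffOn ((h.continuousOn_linPotential.mul
    hχ.continuousOn).add (h.continuousOn_correctorSource ε))), fun r hr => ?_, ?_⟩
  · have e1 : deriv (fun r => Φ r + χ r) =ᶠ[𝓝 r] (deriv Φ + χ₁) := by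
      filter_upwards [Ioi_mem_nhds hr] with t ht using (h1 t ht).deriv
    unfold linOp
    rw [e1.deriv_eq, (h2 r hr).deriv, e1.eq_of_nhds, Pi.add_apply]
    have hΦ := h.profile.pos r hr
    have ep : Φ r ^ p = Φ r ^ (p - 1) * Φ r := by
      rw [← Real.rpow_add_one hΦ.ne', sub_add_cancel]
    have eq : Φ r ^ q = Φ r ^ (q - 1) * Φ r := by
      rw [← Real.rpow_add_one hΦ.ne', sub_add_cancel]
    unfold correctorSource linPotential
    rw [ep, eq]
    field_simp
    ring
  · obtain ⟨C, hC, hb⟩ := h.tail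
    obtain ⟨C', hC', hb'⟩ := h.corrector_bound
    refine hasGaussianTail_of_bound (C := C + C') h.K_pos fun r hr => ?_
    have e1 := hb r hr
    have e2 := hb' ε 1 χ χ₁ hε one_pos le_rfl (by simp) hχ r hr
    rw [decayWeight_of_one_le _ _ hr] at e2
    rw [add_sub_right_comm, add_mul]
    exact (abs_add_le _ _).trans (add_le_add e1 e2)

/-- The equation of the perturbation is the nonlinear equation in the variables
`u = r^(ε/2) (Φ + ε (Φ + χ + w))`; here `a`, `b`, `L`, `Rp`, `Rq` stand for `Φ^(p-1)`, `Φ^(q-1)`,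
`log r` and the two Taylor remainders. -/
theorem perturbed_equation {d ε r lam p q f f₁ x x₁ w w₁ a b L Rp Rq f₂ x₂ w₂ : ℝ} (hr : r ≠ 0)
    (hε : ε ≠ 0) (hf : f ≠ 0)
    (hf₂ : f₂ = -((d - 1) / r) * f₁ + (r ^ 2 - lam) * f - b * f - a * f)
    (hx₂ : x₂ = -((d + ε - 1) / r) * x₁ + (r ^ 2 - lam - ε) * x - ((p * a + q * b) * x +
      ((p - 1) * ((L / 2 + 1) * (a * f)) + (q - 1) * ((L / 2 + 1) * (b * f)) +
        (ε / 4 + d / 2 - 1) * (f / r ^ 2) + (1 + ε) * (f₁ / r + f))))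
    (hw₂ : w₂ = -((d + ε - 1) / r) * w₁ + (r ^ 2 - lam - ε) * w - ((p * a + q * b) * w +
      (ε⁻¹ * (a * f * Rp + b * f * Rq) +
        ε / 2 * (ε / 2 + d - 2) * (f / r ^ 2 * ((f + x + w) / f))))) :
    (f₂ + ε * (f₂ + x₂ + w₂) + ε / 2 * ((f₁ + ε * (f₁ + x₁ + w₁)) / r -
        (f + ε * (f + x + w)) / r ^ 2) +
      ε / 2 / r * (f₁ + ε * (f₁ + x₁ + w₁) + ε / 2 * ((f + ε * (f + x + w)) / r))) +
      (d - 1) / r * (f₁ + ε * (f₁ + x₁ + w₁) + ε / 2 * ((f + ε * (f + x + w)) / r)) -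
      (r ^ 2 - (lam + ε)) * (f + ε * (f + x + w)) +
      b * f * (Rq + 1 + q * (ε * ((f + x + w) / f)) + (q - 1) / 2 * (ε * L)) +
      a * f * (Rp + 1 + p * (ε * ((f + x + w) / f)) + (p - 1) / 2 * (ε * L)) = 0 := by
  subst hf₂ hx₂ hw₂
  field_simp
  ring

/-- Positivity holds as `ε (ψ + w)` is at most half of `Φ`; the same bound puts the powers of the
solution in the range of the Taylor expansion. -/
theorem ProfileBounds.isPositiveSolutionOn {d : ℕ} {p q lam γ K A ε rs : ℝ}
    {Φ Φ₁ χ χ₁ w w₁ : ℝ → ℝ} (h : ProfileBounds d p q lam γ K Φ Φ₁) (hε0 : ε ≠ 0) (hε : |ε| ≤ 1)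
    (hrs : 0 < rs)
    (hχ : IsDecayingSolution d lam ε
      (fun r => linPotential p q Φ r * χ r + correctorSource d p q Φ Φ₁ ε r) χ χ₁)
    (hw : IsPerturbation d p q lam γ Φ A ε rs χ w w₁) :
    IsPositiveSolutionOn d p q (lam + ε) (Ici rs)
      (fun r => r ^ (ε / 2) * (Φ r + ε * (Φ r + χ r + w r))) := by
  obtain ⟨N, hNc, hNs, hN⟩ := hw.solves
  obtain ⟨Φ₂, hΦ₂⟩ : ∃ f : ℝ → ℝ, f = fun r =>
    -((d - 1) / r) * Φ₁ r + (r ^ 2 - lam) * Φ r - Φ r ^ q - Φ r ^ p := ⟨_, rfl⟩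
  obtain ⟨χ₂, hχ₂⟩ : ∃ f : ℝ → ℝ, f = fun r => -((d + ε - 1) / r) * χ₁ r +
    (r ^ 2 - lam - ε) * χ r - (linPotential p q Φ r * χ r + correctorSource d p q Φ Φ₁ ε r) :=
    ⟨_, rfl⟩
  obtain ⟨w₂, hw₂⟩ : ∃ f : ℝ → ℝ, f = fun r => -((d + ε - 1) / r) * w₁ r +
    (r ^ 2 - lam - ε) * w r - (linPotential p q Φ r * w r + N r) := ⟨_, rfl⟩
  have dΦ := h.profile.hasDerivAt
  have dΦ' : ∀ r, 0 < r → HasDerivAt Φ₁ (Φ₂ r) r := by rw [hΦ₂]; exact h.profile.hasDerivAt'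
  have dχ := hχ.hasDerivAt
  have dχ' : ∀ r, 0 < r → HasDerivAt χ₁ (χ₂ r) r := by rw [hχ₂]; exact hχ.hasDerivAt'
  have dw := hNs.hasDerivAt
  have dw' : ∀ r, 0 < r → HasDerivAt w₁ (w₂ r) r := by rw [hw₂]; exact hNs.hasDerivAt'
  obtain ⟨v, hv⟩ : ∃ f : ℝ → ℝ, f = fun r => Φ r + ε * (Φ r + χ r + w r) := ⟨_, rfl⟩
  obtain ⟨v₁, hv₁⟩ : ∃ f : ℝ → ℝ, f = fun r => Φ₁ r + ε * (Φ₁ r + χ₁ r + w₁ r) := ⟨_, rfl⟩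
  obtain ⟨v₂, hv₂⟩ : ∃ f : ℝ → ℝ, f = fun r => Φ₂ r + ε * (Φ₂ r + χ₂ r + w₂ r) := ⟨_, rfl⟩
  have dv : ∀ r, 0 < r → HasDerivAt v (v₁ r) r := fun r hr => by
    rw [hv, hv₁]
    exact (dΦ r hr).add ((((dΦ r hr).add (dχ r hr)).add (dw r hr)).const_mul ε)
  have dv' : ∀ r, 0 < r → HasDerivAt v₁ (v₂ r) r := fun r hr => by
    rw [hv₁, hv₂]
    exact (dΦ' r hr).add ((((dΦ' r hr).add (dχ' r hr)).add (dw' r hr)).const_mul ε)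
  have du : ∀ r, 0 < r → HasDerivAt (fun r => r ^ (ε / 2) * v r)
      (r ^ (ε / 2) * (v₁ r + ε / 2 * (v r / r))) r := fun r hr => by
    refine ((Real.hasDerivAt_rpow_const (p := ε / 2) (Or.inl hr.ne')).mul (dv r hr)).congr_deriv ?_
    rw [Real.rpow_sub_one hr.ne']
    field_simp
    ring
  have du' : ∀ r, 0 < r → HasDerivAt (fun r => r ^ (ε / 2) * (v₁ r + ε / 2 * (v r / r)))
      (r ^ (ε / 2) * (v₂ r + ε / 2 * (v₁ r / r - v r / r ^ 2) +
        ε / 2 / r * (v₁ r + ε / 2 * (v r / r)))) r := fun r hr => by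
    refine ((Real.hasDerivAt_rpow_const (p := ε / 2) (Or.inl hr.ne')).mul
      ((dv' r hr).add (((dv r hr).div (hasDerivAt_id r) hr.ne').const_mul (ε / 2)))).congr_deriv ?_
    rw [Real.rpow_sub_one hr.ne']
    simp only [Pi.add_apply, Pi.div_apply, id]
    field_simp
    ring
  have hvΦ : ∀ r, 0 < r → v r = Φ r * (1 + ε * ((Φ r + χ r + w r) / Φ r)) := fun r hr => by
    have := (h.profile.pos r hr).ne'
    rw [hv]; field_simp
  have hvpos : ∀ r, rs ≤ r → 0 < v r ∧ v r ≤ 2 * Φ r := fun r hr => by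
    have hr0 := hrs.trans_le hr
    have hΦ := h.profile.pos r hr0
    obtain ⟨e1, e2⟩ := abs_le.mp (hw.small r hr)
    rw [hvΦ r hr0]
    exact ⟨mul_pos hΦ (by linarith), by nlinarith⟩
  have hpos : ∀ r, rs ≤ r → 0 < r ^ (ε / 2) * v r := fun r hr =>
    mul_pos (Real.rpow_pos_of_pos (hrs.trans_le hr) _) (hvpos r hr).1
  have e1 := derivWithin_Ici_of_hasDerivAt hrs du
  have e2 := derivWithin_Ici_of_hasDerivAt hrs du'
  have hsub : Ici rs ⊆ Ioi 0 := fun r hr => hrs.trans_le hr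
  subst hv
  refine ⟨ContDiffOn.mono ?_ hsub, hpos, fun r hr => ?_, ?_⟩
  · have hΦC := h.profile.contDiffOn
    have hχC := hχ.contDiffOn ((h.continuousOn_linPotential.mul hχ.continuousOn).add
      (h.continuousOn_correctorSource ε))
    have hwC := hNs.contDiffOn ((h.continuousOn_linPotential.mul hNs.continuousOn).add hNc)
    exact (contDiffOn_id.rpow_const_of_ne fun r hr => ne_of_gt hr).mul
      (hΦC.add (contDiffOn_const.mul ((hΦC.add hχC).add hwC)))
  · have hr0 := hsub hr
    have hΦ := h.profile.pos r hr0
    rw [derivWithin_congr e1 (e1 hr), e2 hr, e1 hr]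
    have hX := Real.rpow_pos_of_pos hr0 (ε / 2)
    -- powers of the perturbed solution in terms of the Taylor remainder
    have hpw : ∀ s : ℝ,
        |r ^ (ε / 2) * (Φ r + ε * (Φ r + χ r + w r))| ^ (s - 1) *
          (r ^ (ε / 2) * (Φ r + ε * (Φ r + χ r + w r))) =
        r ^ (ε / 2) * (Φ r ^ (s - 1) * Φ r * (taylorRemainder s
          (ε * ((Φ r + χ r + w r) / Φ r)) (ε * Real.log r) + 1 +
          s * (ε * ((Φ r + χ r + w r) / Φ r)) + (s - 1) / 2 * (ε * Real.log r))) := by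
      intro s
      have e3 := hvΦ r hr0
      have e4 : 0 < 1 + ε * ((Φ r + χ r + w r) / Φ r) := by
        linarith [(abs_le.mp (hw.small r hr)).1]
      simp only at e3
      have e6 : 0 < r ^ (ε / 2) * (Φ r + ε * (Φ r + χ r + w r)) := hpos r hr
      rw [abs_of_pos e6, ← Real.rpow_add_one e6.ne', sub_add_cancel, e3,
        ← Real.rpow_add_one hΦ.ne', sub_add_cancel,
        Real.mul_rpow hX.le (mul_pos hΦ e4).le, Real.mul_rpow hΦ.le e4.le, ← Real.rpow_mul hr0.le]
      have e5 : r ^ (ε / 2 * s) = r ^ (ε / 2) * Real.exp ((s - 1) / 2 * (ε * Real.log r)) := by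
        rw [Real.rpow_def_of_pos hr0, Real.rpow_def_of_pos hr0, ← Real.exp_add]
        congr 1; ring
      rw [e5]
      unfold taylorRemainder
      ring
    rw [hpw p, hpw q, hv₁, hv₂]
    have ep : Φ r ^ p = Φ r ^ (p - 1) * Φ r := by
      rw [← Real.rpow_add_one hΦ.ne', sub_add_cancel]
    have eq : Φ r ^ q = Φ r ^ (q - 1) * Φ r := by
      rw [← Real.rpow_add_one hΦ.ne', sub_add_cancel]
    have key := perturbed_equation (d := d) (lam := lam) (p := p) (q := q) (f₁ := Φ₁ r)
      (x := χ r) (x₁ := χ₁ r) (w := w r) (w₁ := w₁ r) (a := Φ r ^ (p - 1)) (b := Φ r ^ (q - 1))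
      (L := Real.log r) (f₂ := Φ₂ r) (x₂ := χ₂ r) (w₂ := w₂ r)
      (Rp := taylorRemainder p (ε * ((Φ r + χ r + w r) / Φ r)) (ε * Real.log r))
      (Rq := taylorRemainder q (ε * ((Φ r + χ r + w r) / Φ r)) (ε * Real.log r))
      (ne_of_gt hr0) hε0 hΦ.ne'
      (by rw [hΦ₂, ← ep, ← eq])
      (by rw [hχ₂, ← ep, ← eq]; rfl)
      (by rw [hw₂, ← ep, ← eq]; simp only; rw [hN r hr]; rfl)
    linear_combination r ^ (ε / 2) * key
  · obtain ⟨C, hC, hup⟩ := h.upper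
    have hlim := (tendsto_exp_neg_sq_mul_rpow ((lam - d) / 2 + 1)).const_mul (2 * C)
    rw [mul_zero] at hlim
    refine squeeze_zero' ?_ ?_ hlim
    · filter_upwards [eventually_ge_atTop rs] with r hr using (hpos r hr).le
    · filter_upwards [eventually_ge_atTop rs, eventually_ge_atTop 1] with r hr hr1
      have hr0 := hrs.trans_le hr
      have e3 : r ^ (ε / 2) ≤ r := by
        have := Real.rpow_le_rpow_of_exponent_le hr1
          (show ε / 2 ≤ 1 by linarith [(abs_le.mp hε).2])
        rwa [Real.rpow_one] at this
      have e4 := hup r hr0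
      rw [min_eq_right hr1, max_eq_left hr1, Real.one_rpow, one_mul,
        decayWeight_of_one_le _ _ hr1] at e4
      have e5 : r ^ 2 * (gaussianTail d lam r * (r ^ 2)⁻¹) = gaussianTail d lam r := by
        field_simp
      rw [e5] at e4
      have e6 := gaussianTail_pos d lam hr0
      calc _ ≤ r * (2 * (C * gaussianTail d lam r)) := by
            refine mul_le_mul e3 ((hvpos r hr).2.trans ?_) (hvpos r hr).1.le hr0.le
            gcongr
        _ = _ := by
            unfold gaussianTail
            rw [Real.rpow_add_one hr0.ne']
            ring

end HarmonicField

end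

theorem mainTheorem3 (d : ℕ) (hd : 3 ≤ d) (p q lamStar : ℝ)
    (hp : ((d : ℝ) + 2) / ((d : ℝ) - 2) < p) (hJL : HarmonicField.BelowJosephLundgren d p)
    (hq1 : 1 < q) (hqp : q < p) (hlam0 : 0 < lamStar) (hlam1 : lamStar < (d : ℝ))
    (Φ : ℝ → ℝ) (hΦ : HarmonicField.IsSingularSolution d p q lamStar Φ) :
    -- `K` and the correctors `ψ ε` depend neither on `rs` nor, for `K`, on `ε`
    ∃ K : ℝ, 0 < K ∧ HarmonicField.HasGaussianTail d lamStar K Φ ∧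
    ∃ ψ : ℝ → ℝ → ℝ, ∃ r₀ δ C : ℝ, 0 < r₀ ∧ r₀ < 1 ∧ 0 < δ ∧ 0 < C ∧
      (∀ ε : ℝ, |ε| < δ → HarmonicField.IsCorrector d p q lamStar Φ K ε (ψ ε)) ∧
      ∀ rs : ℝ, 0 < rs → rs < r₀ →
        ∃ w : ℝ → ℝ → ℝ,
          -- the exterior solution for every nonzero small `ε`
          (∀ ε : ℝ, 0 < |ε| → |ε| < δ * rs ^ (HarmonicField.sigma d p - 1) →
            ContDiffOn ℝ 2 (w ε) (Set.Ici rs) ∧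
            (∃ u : ℝ → ℝ,
              HarmonicField.IsPositiveSolutionOn d p q (lamStar + ε) (Set.Ici rs) u ∧
              ∀ r ∈ Set.Ici rs, u r = r ^ (ε / 2) * (Φ r + ε * (ψ ε r + w ε r))) ∧
            HarmonicField.XNorm d lamStar rs (w ε)
              + HarmonicField.XNorm d lamStar rs
                  (fun r => min 1 r * (1 + r)⁻¹ * derivWithin (w ε) (Set.Ici rs) r)
              ≤ ENNReal.ofReal (C * |ε| * rs ^ (1 - HarmonicField.sigma d p))) ∧
          -- `w` vanishes at `ε = 0`
          (∀ r ∈ Set.Ici rs, w 0 r = 0) ∧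
          -- `w` is differentiable in `ε` at `ε = 0`, in the weighted norm, with derivative `D`
          ∃ D : ℝ → ℝ,
            Filter.Tendsto
              (fun ε : ℝ =>
                HarmonicField.XNorm d lamStar rs (fun r => (w ε r - w 0 r) / ε - D r))
              (nhdsWithin 0 {0}ᶜ) (nhds 0) ∧
            HarmonicField.XNorm d lamStar rs D
              ≤ ENNReal.ofReal (C * rs ^ (1 - HarmonicField.sigma d p)) := by
  have hd3 : (3 : ℝ) ≤ d := by exact_mod_cast hd
  obtain ⟨hp1, hμd, hω⟩ := HarmonicField.oscillation_of_belowJosephLundgren hd hp hJL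
  obtain ⟨K, h⟩ := hΦ.isProfile.profileBounds (μ := 2 / (p - 1)) hd3 hlam0 hlam1.le hq1 hqp
    (div_mul_cancel₀ 2 (by linarith)) hμd (Real.sqrt_pos.mpr hω) (Real.sq_sqrt hω.le)
  have hσ : HarmonicField.sigma d p - 1 = ((d : ℝ) - 2) / 2 - 2 / (p - 1) := by
    unfold HarmonicField.sigma; ring
  have hσ' : 1 - HarmonicField.sigma d p = -(((d : ℝ) - 2) / 2 - 2 / (p - 1)) := by
    rw [← hσ]; ring
  rw [hσ, hσ']
  -- the exponent of the smallness condition: `γ = σ - 1 > 0`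
  obtain ⟨γ, hγ_def⟩ : ∃ γ, γ = ((d : ℝ) - 2) / 2 - 2 / (p - 1) := ⟨_, rfl⟩
  rw [← hγ_def] at h ⊢
  have hγ := h.γ_pos
  obtain ⟨CΦ, hCΦ, htail⟩ := h.tail
  -- outside the relevant range of `ε` the families are filled with `0`
  have hcorr : ∀ ε : ℝ, ∃ χ χ₁ : ℝ → ℝ, |ε| ≤ 1 → HarmonicField.IsDecayingSolution d lamStar ε
      (fun r => HarmonicField.linPotential p q Φ r * χ r +
        HarmonicField.correctorSource d p q Φ (deriv Φ) ε r) χ χ₁ := by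
    intro ε
    by_cases hε : |ε| ≤ 1
    · obtain ⟨χ, χ₁, hχ⟩ := h.exists_corrector hε
      exact ⟨χ, χ₁, fun _ => hχ⟩
    · exact ⟨0, 0, fun h => absurd h hε⟩
  choose χ χ₁ hχ using hcorr
  have hχ0 := hχ 0 (by simp)
  obtain ⟨δ, A₁, C₁, hδ, hδ1, hδγ, hA₁, hC₁, hpert⟩ := h.exists_perturbation
  obtain ⟨D, D₁, A₂, C₂, hA₂, hC₂, hD, hχA, hDb⟩ := h.exists_derivative hχ0
  refine ⟨K, h.K_pos, HarmonicField.hasGaussianTail_of_bound h.K_pos htail,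
    fun ε r => Φ r + χ ε r, 1 / 2, δ, 4 * C₁ + 2 * C₂, by norm_num, by norm_num, hδ,
    by positivity, fun ε hε => h.isCorrector (by linarith) (hχ ε (by linarith)), ?_⟩
  intro rs hrs hrs2
  have hrs1 : rs ≤ 1 := by linarith
  have hrsγ := Real.rpow_pos_of_pos hrs γ
  have hrsγ' := Real.rpow_pos_of_pos hrs (-γ)
  have hrsγ1 := Real.rpow_le_one hrs.le hrs1 hγ.le
  have hδrs : δ * rs ^ γ ≤ 1 := (mul_le_of_le_one_right hδ.le hrsγ1).trans hδ1
  have hex : ∀ ε : ℝ, ∃ w w₁ : ℝ → ℝ, (ε = 0 → w = 0) ∧ (ε ≠ 0 → |ε| < δ * rs ^ γ →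
      HarmonicField.IsPerturbation d p q lamStar γ Φ A₁ ε rs (χ ε) w w₁ ∧ ∀ r, rs ≤ r →
        |w r| ≤ C₁ * (|ε| * rs ^ (-γ)) * HarmonicField.decayWeight d lamStar r ∧
        min r 1 * |w₁ r| ≤ C₁ * (|ε| * rs ^ (-γ)) *
          ((1 + r) * HarmonicField.decayWeight d lamStar r)) := by
    intro ε
    by_cases hε : ε ≠ 0 ∧ |ε| < δ * rs ^ γ
    · obtain ⟨w, w₁, hw⟩ := hpert ε rs (χ ε) (χ₁ ε) hrs hrs1 hε.1 hε.2
        (hχ ε (hε.2.le.trans hδrs))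
      exact ⟨w, w₁, fun h0 => absurd h0 hε.1, fun _ _ => hw⟩
    · exact ⟨0, 0, fun _ => rfl, fun h1 h2 => absurd ⟨h1, h2⟩ hε⟩
  choose w w₁ hw0 hw using hex
  refine ⟨w, fun ε hε0 hε => ?_, fun r _ => by rw [hw0 0 rfl]; rfl, D, ?_, ?_⟩
  · have hεne : ε ≠ 0 := abs_pos.mp hε0
    have hε1 : |ε| ≤ 1 := hε.le.trans hδrs
    obtain ⟨hP, hb⟩ := hw ε hεne hε
    obtain ⟨N, hNc, hNs, -⟩ := hP.solves
    refine ⟨(hNs.contDiffOn ((h.continuousOn_linPotential.mul hNs.continuousOn).add hNc)).mono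
      fun r hr => hrs.trans_le hr,
      ⟨_, h.isPositiveSolutionOn hεne hε1 hrs (hχ ε hε1) hP, fun r _ => rfl⟩, ?_⟩
    have hX0 : 0 ≤ C₁ * (|ε| * rs ^ (-γ)) := by positivity
    refine (add_le_add (HarmonicField.XNorm_le hrs hrs1 hX0 fun r hr => (hb r hr).1)
      (HarmonicField.XNorm_le hrs hrs1 hX0 fun r hr => ?_)).trans ?_
    · have hr0 := hrs.trans_le hr
      rw [HarmonicField.derivWithin_Ici_of_hasDerivAt hrs hNs.hasDerivAt hr, abs_mul, abs_mul,
        abs_of_pos (lt_min one_pos hr0), abs_of_pos (show 0 < (1 + r)⁻¹ by positivity),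
        mul_right_comm, ← div_eq_mul_inv, div_le_iff₀ (by positivity), min_comm]
      exact (hb r hr).2.trans (le_of_eq (by ring))
    · rw [← ENNReal.ofReal_add (by positivity) (by positivity)]
      apply ENNReal.ofReal_le_ofReal
      have : 0 ≤ 2 * C₂ * (|ε| * rs ^ (-γ)) := by positivity
      linarith
  -- for fixed `rs` the difference quotient is within `O(|ε|)` of `D`
  · obtain ⟨C', hC', hdiff⟩ := h.perturbation_sub_derivative (A := A₁ + A₂)
      (C := C₁ * rs ^ (-γ)) (by positivity) (by positivity) hrs hrs1 hχ0 hD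
      fun r hr => (hχA r hr).trans (mul_le_mul_of_nonneg_right (by linarith)
        (Real.rpow_pos_of_pos (lt_min hr one_pos) _).le)
    have hlim : Tendsto (fun ε : ℝ => ENNReal.ofReal (2 * (C' * |ε|))) (𝓝[≠] 0) (𝓝 0) := by
      have hc : Continuous fun ε : ℝ => ENNReal.ofReal (2 * (C' * |ε|)) :=
        ENNReal.continuous_ofReal.comp (by fun_prop)
      have := (hc.tendsto 0).mono_left (nhdsWithin_le_nhds (s := {0}ᶜ))
      simpa using this
    refine tendsto_of_tendsto_of_tendsto_of_le_of_le' tendsto_const_nhds hlim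
      (Eventually.of_forall fun _ => zero_le) ?_
    have hball : ∀ᶠ ε : ℝ in 𝓝[≠] 0, |ε| < δ * rs ^ γ := by
      have hc : Tendsto (fun ε : ℝ => |ε|) (𝓝[≠] 0) (𝓝 0) := by
        simpa using (continuous_abs.tendsto (0 : ℝ)).mono_left
          (nhdsWithin_le_nhds (s := {0}ᶜ))
      exact hc.eventually_lt_const (by positivity)
    filter_upwards [hball, self_mem_nhdsWithin] with ε hε hε0
    have hε1 : |ε| ≤ 1 := hε.le.trans hδrs
    obtain ⟨hP, hb⟩ := hw ε hε0 hε
    refine HarmonicField.XNorm_le hrs hrs1 (by positivity) fun r hr => ?_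
    have hlog := HarmonicField.abs_mul_log_le_one hγ hrs hrs1
      (hε.le.trans (mul_le_mul_of_nonneg_right hδγ hrsγ.le))
    have := hdiff ε (χ ε) (χ₁ ε) (w ε) (w₁ ε) hε0 hε1 hlog (hχ ε hε1)
      (hP.mono hrs (by linarith)) (fun r hr => ((hb r hr).1).trans (le_of_eq (by ring))) r hr
    rwa [hw0 0 rfl, Pi.zero_apply, sub_zero, div_eq_inv_mul]
  · refine (HarmonicField.XNorm_le (A := C₂ * rs ^ (-γ)) hrs hrs1 (by positivity)
      fun r hr => hDb rs hrs hrs1 r hr).trans (ENNReal.ofReal_le_ofReal ?_)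
    have : 0 ≤ 4 * C₁ * rs ^ (-γ) := by positivity
    linarith
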